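/- There are absolute constants, a preprocessing program and a query program for the word RAM with words of $\Theta(\log n)$ bits (arithmetic operations, comparisons, bitwise operations, shifts and memory accesses at unit cost) such that the following holds. Let $G$ be a digraph with vertex set $\{0,\dots,n-1\}$, let $(s,t)$ be a pair of vertices of $G$ such that $t$ is reachable from $s$ in $G$, and let $C$ be any set of $(s,t)$ cut-vertices of $G$, that is, of vertices $v$ for which there is no $s$ to $t$ path in $G-v$ (so $s$ and $t$ themselves count as $(s,t)$ cut-vertices). Given $G$, $s$, $t$ and $C$, the preprocessing program computes, in time polynomial in $n$, an oracle that consists of $O(|C|)$ words. Given this oracle and any three (not necessarily distinct) vertices $x,y,z\in C$, the query program reports, in $O(1)$ time, whether or not there is a $y$ to $z$ path in $G-x$ (there is none if $y=x$ or $z=x$). -/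

import Mathlib

/-! ### Reachability in digraphs and cut-vertices -/

/-- There is a directed path from `u` to `v` in `G` (of length `0` if `u = v`). -/
def HasPath {V : Type*} (G : Digraph V) (u v : V) : Prop :=
  Relation.ReflTransGen G.Adj u v

/-- There is a directed path from `u` to `v` in `G - x`, the digraph obtained from `G` by deleting
the vertex `x`. Both ends have to be vertices of `G - x`. -/
def HasPathAvoiding {V : Type*} (G : Digraph V) (x u v : V) : Prop :=
  u ≠ x ∧ v ≠ x ∧ Relation.ReflTransGen (fun a b => G.Adj a b ∧ a ≠ x ∧ b ≠ x) u v

/-- `x` is an `(s,t)` cut-vertex: there is no path from `s` to `t` in `G - x`.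
In particular `s` and `t` themselves are cut-vertices. -/
def IsCutVertex {V : Type*} (G : Digraph V) (s t x : V) : Prop :=
  ¬ HasPathAvoiding G x s t

/-! ### A word RAM, programmed in a structured language

Words are natural numbers below `2 ^ w`, where `w` is the word size. A machine has registers, which
are named by the program text, and a memory, which is addressed by words computed at run time. Every
literal, arithmetic operation, memory access, assignment and test costs one step. -/

namespace WordRAM

/-- The binary operations of the machine. -/
inductive Op where
  | add | sub | mul | div | mod | and | or | xor | shl | shr | eq | lt

/-- The value of a binary operation, before reduction modulo `2 ^ w`.
Subtraction is truncated at `0`, division by `0` gives `0`, comparisons give `1` or `0`. -/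
def Op.eval : Op → ℕ → ℕ → ℕ
  | .add, a, b => a + b
  | .sub, a, b => a - b
  | .mul, a, b => a * b
  | .div, a, b => a / b
  | .mod, a, b => a % b
  | .and, a, b => a &&& b
  | .or, a, b => a ||| b
  | .xor, a, b => a ^^^ b
  | .shl, a, b => a <<< b
  | .shr, a, b => a >>> b
  | .eq, a, b => if a = b then 1 else 0
  | .lt, a, b => if a < b then 1 else 0

/-- Expressions: literals, registers, memory cells (the address is the value of an expression), and
binary operations. -/
inductive Exp where
  | lit (k : ℕ)
  | reg (r : ℕ)
  | load (addr : Exp)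
  | bin (o : Op) (e₁ e₂ : Exp)

/-- Commands: `store e₁ e₂` writes the value of `e₂` to the memory cell whose address is the value
of `e₁`; `cond e p q` runs `p` if `e` is nonzero and `q` otherwise; `loop e p` repeats `p` as long
as `e` is nonzero. -/
inductive Cmd where
  | skip
  | assign (r : ℕ) (e : Exp)
  | store (e₁ e₂ : Exp)
  | seq (p q : Cmd)
  | cond (e : Exp) (p q : Cmd)
  | loop (e : Exp) (p : Cmd)

/-- A configuration of the machine: the contents of the registers and of the memory cells. -/
structure State where
  reg : ℕ → ℕ
  mem : ℕ → ℕ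

/-- The value of an expression on a machine with word size `w`. -/
def Exp.eval (w : ℕ) (σ : State) : Exp → ℕ
  | .lit k => k % 2 ^ w
  | .reg r => σ.reg r
  | .load e => σ.mem (e.eval w σ)
  | .bin o e₁ e₂ => o.eval (e₁.eval w σ) (e₂.eval w σ) % 2 ^ w

/-- The number of steps needed to evaluate an expression. -/
def Exp.cost : Exp → ℕ
  | .lit _ => 1
  | .reg _ => 1
  | .load e => e.cost + 1
  | .bin _ e₁ e₂ => e₁.cost + e₂.cost + 1

/-- `Exec w p σ T τ`: on a machine with word size `w`, the program `p` started in the configuration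
`σ` halts after exactly `T` steps in the configuration `τ`. -/
inductive Exec (w : ℕ) : Cmd → State → ℕ → State → Prop
  | skip (σ : State) : Exec w .skip σ 1 σ
  | assign (r : ℕ) (e : Exp) (σ : State) :
      Exec w (.assign r e) σ (e.cost + 1)
        { reg := Function.update σ.reg r (e.eval w σ), mem := σ.mem }
  | store (e₁ e₂ : Exp) (σ : State) :
      Exec w (.store e₁ e₂) σ (e₁.cost + e₂.cost + 1)
        { reg := σ.reg, mem := Function.update σ.mem (e₁.eval w σ) (e₂.eval w σ) }
  | seq {p q : Cmd} {σ σ' τ : State} {T T' : ℕ} :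
      Exec w p σ T σ' → Exec w q σ' T' τ → Exec w (.seq p q) σ (T + T') τ
  | cond_pos {e : Exp} {p q : Cmd} {σ τ : State} {T : ℕ} :
      e.eval w σ ≠ 0 → Exec w p σ T τ → Exec w (.cond e p q) σ (e.cost + 1 + T) τ
  | cond_neg {e : Exp} {p q : Cmd} {σ τ : State} {T : ℕ} :
      e.eval w σ = 0 → Exec w q σ T τ → Exec w (.cond e p q) σ (e.cost + 1 + T) τ
  | loop_step {e : Exp} {p : Cmd} {σ σ' τ : State} {T T' : ℕ} :
      e.eval w σ ≠ 0 → Exec w p σ T σ' → Exec w (.loop e p) σ' T' τ →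
        Exec w (.loop e p) σ (e.cost + 1 + T + T') τ
  | loop_end {e : Exp} {p : Cmd} {σ : State} :
      e.eval w σ = 0 → Exec w (.loop e p) σ (e.cost + 1) σ

/-- The word size of the machine on digraphs with `n` vertices: `c` times the bit length of `n`. -/
def wordSize (c n : ℕ) : ℕ := c * (Nat.log 2 n + 1)

open Classical in
/-- The input of the preprocessing program: registers `0`, `1`, `2` hold `n`, `s`, `t`; the memory
holds the adjacency matrix of `G` row by row, followed by the indicator vector of `C`; all other
registers and cells hold `0`. -/
noncomputable def inputState {n : ℕ} (G : Digraph (Fin n)) (s t : Fin n) (C : Finset (Fin n)) :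
    State where
  reg r := if r = 0 then n else if r = 1 then s else if r = 2 then t else 0
  mem a :=
    if (∃ u v : Fin n, a = u * n + v ∧ G.Adj u v) ∨ (∃ v ∈ C, a = n * n + v) then 1 else 0

/-- The output of the preprocessing program: register `0` holds the number of words, and register
`1` holds the address of the first one. -/
def State.output (σ : State) : List ℕ :=
  (List.range (σ.reg 0)).map fun i => σ.mem (σ.reg 1 + i)

/-- The initial configuration of the query program: registers `0`, `1`, `2` hold the names of the
query vertices `x`, `y`, `z`; the memory holds the words of the oracle `D` from address `0` on; all
other registers and cells hold `0`. -/
def queryState (D : List ℕ) (x y z : ℕ) : State where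
  reg r := if r = 0 then x else if r = 1 then y else if r = 2 then z else 0
  mem a := D.getD a 0

end WordRAM

/-! Call u earlier than v when some path from s reaches u without meeting v. On cut-vertices this is
a linear order. Number C along it as 0, …, k - 1 and contract every stretch of path outside C to one
edge. An edge from a to some b > a + 1 would bypass the cut-vertex a + 1, so edges rise by at most
one; the edges a → a + 1 all exist. Hence reachability in G - x between vertices of C is
reachability, without one vertex, in a directed path with extra back edges
(`backEdgeReach_hasPathAvoiding`).

Let i be deleted and let j → l be the query. If j ≤ l, the answer is yes exactly when i is outside
[j, l]. If l < j < i, a path never gets past i. Let h(a) be the last i > a whose deletion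
disconnects a + 1 from a. Heights are nested (`height_le`), so if q is the leftmost maximum of h on
[l, i - 1], the vertices of [l, i - 1] that reach l are exactly those up to q (`reach_iff_le`). The
case i < l < j is its mirror image. If l < i < j, a path must jump over i by a back edge. Let m be
the first vertex above i that j reaches, and low(m) the first vertex that m reaches under the
deletion of any single vertex strictly between the two. The answer is yes exactly when low(m) ≤ q
(`reach_iff_across`).

Range maxima take constant time and linear space: blocks of logarithmic length, a sparse table over
blocks, and for each position a bit mask of the suffix maxima in its block, read by a tabulated
least significant bit. Names are turned into positions by two-level perfect hashing: some multiplier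
gives k buckets whose squared sizes sum to at most 3k, and each bucket is injected into a table of
twice its squared size, so 6k slots suffice. The other tables also fit into 6k rows; with 18 columns
the oracle has 108k words.

The programs are mostly not written out. `Comp` and `StraightLine` are closed under the operations
used in the definitions of the tables and of the query, so instance search yields the programs
together with polynomial bounds, which exclude overflow for a large enough constant in the word
size. Left shifts are not among these operations, since their values are not polynomially bounded;
powers of two are tabulated instead. Only the Floyd-Warshall closures for all G - x and the output
loop are programmed by hand. -/

namespace WordRAM

/-! ### Running programs with bounds on the number of steps -/

/-- The program `p` started in `σ` halts after at most `B` steps in the configuration `τ`. -/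
def Run (w : ℕ) (p : Cmd) (σ : State) (B : ℕ) (τ : State) : Prop :=
  ∃ T ≤ B, Exec w p σ T τ

theorem Run.mono {w p σ B B' τ} (h : Run w p σ B τ) (hB : B ≤ B') : Run w p σ B' τ :=
  let ⟨T, hT, hE⟩ := h
  ⟨T, hT.trans hB, hE⟩

theorem Run.seq {w p q σ σ' τ B B'} (h : Run w p σ B σ') (h' : Run w q σ' B' τ) :
    Run w (.seq p q) σ (B + B') τ :=
  let ⟨T, hT, hE⟩ := h
  let ⟨T', hT', hE'⟩ := h'
  ⟨T + T', Nat.add_le_add hT hT', hE.seq hE'⟩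

/-- Writing to a register. -/
def State.set (σ : State) (r v : ℕ) : State where
  reg := Function.update σ.reg r v
  mem := σ.mem

@[simp] theorem State.set_mem (σ : State) (r v : ℕ) : (σ.set r v).mem = σ.mem := rfl

@[simp] theorem State.set_reg_self (σ : State) (r v : ℕ) : (σ.set r v).reg r = v := by
  simp [State.set]

theorem State.set_reg_of_ne (σ : State) {r r' : ℕ} (v : ℕ) (h : r' ≠ r) :
    (σ.set r v).reg r' = σ.reg r' := by
  simp [State.set, h]

theorem Run.assign {w r e σ v} (h : e.eval w σ = v) :
    Run w (.assign r e) σ (e.cost + 1) (σ.set r v) := by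
  subst h
  exact ⟨_, le_rfl, .assign r e σ⟩

theorem Run.store {w e₁ e₂ σ a v} (ha : e₁.eval w σ = a) (hv : e₂.eval w σ = v) :
    Run w (.store e₁ e₂) σ (e₁.cost + e₂.cost + 1)
      { reg := σ.reg, mem := Function.update σ.mem a v } := by
  subst ha hv
  exact ⟨_, le_rfl, .store e₁ e₂ σ⟩

theorem Run.cond_pos {w e p q σ τ B} (he : e.eval w σ ≠ 0) (h : Run w p σ B τ) :
    Run w (.cond e p q) σ (e.cost + 1 + B) τ :=
  let ⟨_, hT, hE⟩ := h
  ⟨_, Nat.add_le_add_left hT _, .cond_pos he hE⟩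

theorem Run.cond_neg {w e p q σ τ B} (he : e.eval w σ = 0) (h : Run w q σ B τ) :
    Run w (.cond e p q) σ (e.cost + 1 + B) τ :=
  let ⟨_, hT, hE⟩ := h
  ⟨_, Nat.add_le_add_left hT _, .cond_neg he hE⟩

/-- `for i < reg b do body`. -/
def forCmd (i b : ℕ) (body : Cmd) : Cmd :=
  .seq (.assign i (.lit 0))
    (.loop (.bin .lt (.reg i) (.reg b))
      (.seq body (.assign i (.bin .add (.reg i) (.lit 1)))))

/-- Each round pays 4 steps for the test and 4 for the increment; the last test and the
initialization cost 6. The counter never exceeds m, so it does not wrap around. -/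
theorem run_forCmd {w i b m B : ℕ} {body : Cmd} {σ : State} (Inv : ℕ → State → Prop)
    (hm : m < 2 ^ w) (hw : 1 ≤ w)
    (hi : ∀ k τ, Inv k τ → τ.reg i = k ∧ τ.reg b = m)
    (h0 : Inv 0 (σ.set i 0))
    (hs : ∀ k τ, k < m → Inv k τ →
      ∃ τ', Run w body τ B τ' ∧ τ'.reg i = k ∧ Inv (k + 1) (τ'.set i (k + 1))) :
    ∃ τ, Run w (forCmd i b body) σ (m * (B + 8) + 6) τ ∧ Inv m τ := by
  have h1 : 1 < 2 ^ w := Nat.one_lt_two_pow (by omega)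
  have key : ∀ d k τ, k + d = m → Inv k τ →
      ∃ τ', Run w (.loop (.bin .lt (.reg i) (.reg b))
        (.seq body (.assign i (.bin .add (.reg i) (.lit 1))))) τ (d * (B + 8) + 4) τ' ∧
        Inv m τ' := by
    intro d
    induction d with
    | zero =>
      intro k τ hk hI
      obtain rfl : k = m := by omega
      obtain ⟨h₁, h₂⟩ := hi k τ hI
      refine ⟨τ, ⟨_, ?_, .loop_end ?_⟩, hI⟩
      · simp [Exp.cost]
      · simp [Exp.eval, Op.eval, h₁, h₂]
    | succ d ih =>
      intro k τ hk hI
      obtain ⟨h₁, h₂⟩ := hi k τ hI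
      obtain ⟨τ', hR, hr, hI'⟩ := hs k τ (by omega) hI
      obtain ⟨τ'', ⟨T'', hT'', hE''⟩, hI''⟩ := ih (k + 1) _ (by omega) hI'
      have hinc : Run w (.assign i (.bin .add (.reg i) (.lit 1))) τ' 4 (τ'.set i (k + 1)) := by
        refine Run.assign ?_
        simp [Exp.eval, Op.eval, hr, Nat.mod_eq_of_lt h1,
          Nat.mod_eq_of_lt (show k + 1 < 2 ^ w by omega)]
      obtain ⟨T, hT, hE⟩ := hR.seq hinc
      refine ⟨τ'', ⟨_, ?_, .loop_step ?_ hE hE''⟩, hI''⟩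
      · rw [Nat.add_mul]; simp only [Exp.cost]; omega
      · simp [Exp.eval, Op.eval, h₁, h₂, show k < m by omega, Nat.mod_eq_of_lt h1]
  obtain ⟨τ, hR, hI⟩ := key m 0 _ (by omega) h0
  refine ⟨τ, ?_, hI⟩
  have hz : Run w (.assign i (.lit 0)) σ 2 (σ.set i 0) := Run.assign (by simp [Exp.eval])
  exact (hz.seq hR).mono (by omega)

/-! ### Polynomially bounded operations -/

/-- The operation `o` maps polynomially bounded numbers to polynomially bounded numbers. -/
def PolyOp (o : Op) : Prop :=
  ∀ K₁ K₂, ∃ K, ∀ N a b, 2 ≤ N → a < N ^ K₁ → b < N ^ K₂ → o.eval a b < N ^ K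

theorem polyOp_of_le {o : Op} (h : ∀ a b, o.eval a b ≤ a) : PolyOp o :=
  fun K₁ _ => ⟨K₁, fun _ a b _ ha _ => (h a b).trans_lt ha⟩

theorem polyOp_of_le_one {o : Op} (h : ∀ a b, o.eval a b ≤ 1) : PolyOp o :=
  fun _ _ => ⟨1, fun _ a b hN _ _ => (h a b).trans_lt (by rw [pow_one]; omega)⟩

theorem polyOp_add : PolyOp .add := by
  intro K₁ K₂
  refine ⟨K₁ + K₂ + 1, fun N a b hN ha hb => ?_⟩
  have h₁ : N ^ K₁ ≤ N ^ (K₁ + K₂) := Nat.pow_le_pow_right (by omega) (by omega)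
  have h₂ : N ^ K₂ ≤ N ^ (K₁ + K₂) := Nat.pow_le_pow_right (by omega) (by omega)
  have h₃ : N ^ (K₁ + K₂) * 2 ≤ N ^ (K₁ + K₂ + 1) := by
    rw [pow_succ]; exact Nat.mul_le_mul_left _ hN
  simp only [Op.eval]
  omega

theorem polyOp_mul : PolyOp .mul := by
  intro K₁ K₂
  refine ⟨K₁ + K₂, fun N a b _ ha hb => ?_⟩
  rw [pow_add]
  exact Nat.mul_lt_mul'' ha hb

theorem polyOp_sub : PolyOp .sub := polyOp_of_le fun a b => Nat.sub_le a b
theorem polyOp_div : PolyOp .div := polyOp_of_le fun a b => Nat.div_le_self a b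
theorem polyOp_mod : PolyOp .mod := polyOp_of_le fun a b => Nat.mod_le a b
theorem polyOp_shr : PolyOp .shr := polyOp_of_le fun a b => by
  simpa [Op.eval, Nat.shiftRight_eq_div_pow] using Nat.div_le_self _ _
theorem polyOp_eq : PolyOp .eq := polyOp_of_le_one fun a b => by
  simp only [Op.eval]; split <;> omega
theorem polyOp_lt : PolyOp .lt := polyOp_of_le_one fun a b => by
  simp only [Op.eval]; split <;> omega

theorem lit_lt_pow {N k : ℕ} (hN : 2 ≤ N) : k < N ^ k :=
  (Nat.lt_two_pow_self).trans_le (Nat.pow_le_pow_left hN k)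

/-! ### Functions computed by expressions -/

/-- All registers and memory cells hold numbers below `N ^ A`. -/
def Bounded (N A : ℕ) (σ : State) : Prop :=
  (∀ r, σ.reg r < N ^ A) ∧ ∀ a, σ.mem a < N ^ A

/-- The function `f` is polynomially bounded and the value of an expression, if words are large
enough. -/
class StraightLine (f : State → ℕ) : Prop where
  out : ∃ e : Exp, ∀ A, ∃ K, ∀ N σ, 2 ≤ N → Bounded N A σ →
    f σ < N ^ K ∧ ∀ w, N ^ K ≤ 2 ^ w → e.eval w σ = f σ

namespace StraightLine

instance const (k : ℕ) : StraightLine fun _ => k where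
  out := ⟨.lit k, fun _ => ⟨k, fun _ _ hN _ => ⟨lit_lt_pow hN, fun _ hw =>
    Nat.mod_eq_of_lt ((lit_lt_pow hN).trans_le hw)⟩⟩⟩

instance reg (r : ℕ) : StraightLine fun σ => σ.reg r where
  out := ⟨.reg r, fun A => ⟨A, fun _ _ _ hB => ⟨hB.1 r, fun _ _ => rfl⟩⟩⟩

instance load (f : State → ℕ) [h : StraightLine f] : StraightLine fun σ => σ.mem (f σ) where
  out := by
    obtain ⟨e, he⟩ := h.out
    refine ⟨.load e, fun A => ?_⟩
    obtain ⟨K, hK⟩ := he A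
    refine ⟨K + A, fun N σ hN hB => ⟨(hB.2 _).trans_le ?_, fun w hw => ?_⟩⟩
    · exact Nat.pow_le_pow_right (by omega) (by omega)
    · simp only [Exp.eval]
      rw [(hK N σ hN hB).2 w ((Nat.pow_le_pow_right (by omega) (by omega)).trans hw)]

theorem bin {o : Op} (ho : PolyOp o) {f g : State → ℕ} (hf : StraightLine f)
    (hg : StraightLine g) : StraightLine fun σ => o.eval (f σ) (g σ) where
  out := by
    obtain ⟨e, he⟩ := hf.out
    obtain ⟨e', he'⟩ := hg.out
    refine ⟨.bin o e e', fun A => ?_⟩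
    obtain ⟨K, hK⟩ := he A
    obtain ⟨K', hK'⟩ := he' A
    obtain ⟨K'', hK''⟩ := ho K K'
    refine ⟨K + K' + K'', fun N σ hN hB => ?_⟩
    have hlt := hK'' N _ _ hN (hK N σ hN hB).1 (hK' N σ hN hB).1
    have hle : ∀ k ≤ K + K' + K'', N ^ k ≤ N ^ (K + K' + K'') := fun k hk =>
      Nat.pow_le_pow_right (by omega) hk
    refine ⟨hlt.trans_le (hle _ (by omega)), fun w hw => ?_⟩
    simp only [Exp.eval]
    rw [(hK N σ hN hB).2 w ((hle _ (by omega)).trans hw),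
      (hK' N σ hN hB).2 w ((hle _ (by omega)).trans hw)]
    exact Nat.mod_eq_of_lt (hlt.trans_le ((hle _ (by omega)).trans hw))

variable (f g : State → ℕ) [hf : StraightLine f] [hg : StraightLine g]

instance add : StraightLine fun σ => f σ + g σ := bin polyOp_add hf hg
instance sub : StraightLine fun σ => f σ - g σ := bin polyOp_sub hf hg
instance mul : StraightLine fun σ => f σ * g σ := bin polyOp_mul hf hg
instance div : StraightLine fun σ => f σ / g σ := bin polyOp_div hf hg
instance mod : StraightLine fun σ => f σ % g σ := bin polyOp_mod hf hg
instance shr : StraightLine fun σ => f σ >>> g σ := bin polyOp_shr hf hg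

end StraightLine

open Classical in
/-- The predicate `c` is decided by an expression. -/
class StraightLineProp (c : State → Prop) : Prop where
  out : StraightLine fun σ => if c σ then 1 else 0

namespace StraightLineProp

instance eq (f g : State → ℕ) [hf : StraightLine f] [hg : StraightLine g] :
    StraightLineProp fun σ => f σ = g σ where
  out := by
    convert StraightLine.bin polyOp_eq hf hg using 3
    simp only [Op.eval]
    congr

instance lt (f g : State → ℕ) [hf : StraightLine f] [hg : StraightLine g] :
    StraightLineProp fun σ => f σ < g σ where
  out := by
    convert StraightLine.bin polyOp_lt hf hg using 3
    simp only [Op.eval]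
    congr

theorem congr {c c' : State → Prop} (h : StraightLineProp c) (e : ∀ σ, c' σ ↔ c σ) :
    StraightLineProp c' := by
  rwa [show c' = c from funext fun σ => propext (e σ)]

-- Without branching in expressions, the choice is `b * f + (1 - b) * g`. Both arms are always
-- evaluated, so an arm that is not taken may be meaningless but must be polynomially bounded.
open Classical in
instance ite (c : State → Prop) (f g : State → ℕ) [hc : StraightLineProp c] [StraightLine f]
    [StraightLine g] [∀ σ, Decidable (c σ)] : StraightLine fun σ => if c σ then f σ else g σ := by
  have key : ∀ b : State → ℕ, StraightLine b →
    StraightLine fun σ => b σ * f σ + (1 - b σ) * g σ := fun b _ => inferInstance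
  convert key _ hc.out using 2 with σ
  split <;> simp

instance not (c : State → Prop) [hc : StraightLineProp c] : StraightLineProp fun σ => ¬ c σ := by
  classical
  have h : StraightLineProp fun σ => (if c σ then 1 else 0) = 0 := inferInstance
  exact h.congr fun σ => by simp

instance and (c c' : State → Prop) [hc : StraightLineProp c] [hc' : StraightLineProp c'] :
    StraightLineProp fun σ => c σ ∧ c' σ := by
  classical
  have h : StraightLineProp fun σ => (if c σ then if c' σ then 1 else 0 else 0) = 1 :=
    inferInstance
  exact h.congr fun σ => by split <;> simp [*]

instance or (c c' : State → Prop) [hc : StraightLineProp c] [hc' : StraightLineProp c'] :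
    StraightLineProp fun σ => c σ ∨ c' σ := by
  classical
  have h : StraightLineProp fun σ => (if c σ then 1 else if c' σ then 1 else 0) = 1 :=
    inferInstance
  exact h.congr fun σ => by split <;> simp [*]

instance le (f g : State → ℕ) [hf : StraightLine f] [hg : StraightLine g] :
    StraightLineProp fun σ => f σ ≤ g σ := by
  have h : StraightLineProp fun σ => ¬ g σ < f σ := inferInstance
  exact h.congr fun σ => by simp

end StraightLineProp

end WordRAM

namespace WordRAM

/-! ### Functions computed by programs with bounded loops -/

/-- Data that a program may read: two numbers and a table of `lim` cells. -/
structure Inst where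
  n : ℕ
  s : ℕ
  lim : ℕ
  cell : ℕ → ℕ

/-- A type of contexts: an instance together with finitely many numbers. -/
class Ctx (Γ : Type) where
  inst : Γ → Inst
  arity : ℕ
  arg : Γ → ℕ → ℕ

instance : Ctx Inst where
  inst I := I
  arity := 0
  arg _ _ := 0

instance {Γ : Type} [Ctx Γ] : Ctx (Γ × ℕ) where
  inst p := Ctx.inst p.1
  arity := Ctx.arity Γ + 1
  arg p i := if i = Ctx.arity Γ then p.2 else Ctx.arg p.1 i

variable {Γ : Type} [Ctx Γ]

/-- The numbers of the context are polynomially bounded in `N`. -/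
structure Bdd (N A : ℕ) (γ : Γ) : Prop where
  two_le : 2 ≤ N
  n_le : (Ctx.inst γ).n < N ^ A
  s_le : (Ctx.inst γ).s < N ^ A
  lim_le : (Ctx.inst γ).lim < N ^ A
  cell_le : ∀ a, (Ctx.inst γ).cell a < N ^ A
  arg_le : ∀ i < Ctx.arity Γ, Ctx.arg γ i < N ^ A

/-- The configuration `σ` holds the context `γ`, with the `i`-th number in register `ι i`. -/
structure Rep (ι : ℕ → ℕ) (γ : Γ) (σ : State) : Prop where
  n_eq : σ.reg 0 = (Ctx.inst γ).n
  s_eq : σ.reg 1 = (Ctx.inst γ).s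
  lim_eq : σ.reg 2 = (Ctx.inst γ).lim
  cell_eq : ∀ a < (Ctx.inst γ).lim, σ.mem a = (Ctx.inst γ).cell a
  cell_zero : ∀ a, (Ctx.inst γ).lim ≤ a → (Ctx.inst γ).cell a = 0
  arg_eq : ∀ i < Ctx.arity Γ, σ.reg (ι i) = Ctx.arg γ i

theorem Bdd.mono {N A A' : ℕ} {γ : Γ} (h : Bdd N A γ) (hA : A ≤ A') : Bdd N A' γ := by
  have h2 := h.two_le
  have hp : N ^ A ≤ N ^ A' := Nat.pow_le_pow_right (by omega) hA
  exact ⟨h2, h.n_le.trans_le hp, h.s_le.trans_le hp, h.lim_le.trans_le hp,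
    fun a => (h.cell_le a).trans_le hp, fun i hi => (h.arg_le i hi).trans_le hp⟩

theorem Bdd.pair {N A : ℕ} {γ : Γ} (h : Bdd N A γ) {i : ℕ} (hi : i < N ^ A) :
    Bdd N A (γ, i) := by
  refine ⟨h.two_le, h.n_le, h.s_le, h.lim_le, h.cell_le, fun j hj => ?_⟩
  simp only [Ctx.arg, Ctx.arity] at hj ⊢
  split
  · exact hi
  · exact h.arg_le j (by omega)

theorem Bdd.snd {N A : ℕ} {p : Γ × ℕ} (h : Bdd N A p) : p.2 < N ^ A := by
  have := h.arg_le (Ctx.arity Γ) (by simp only [Ctx.arity]; omega)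
  simpa only [Ctx.arg, if_true] using this

theorem Rep.snd {ι : ℕ → ℕ} {p : Γ × ℕ} {σ : State} (h : Rep ι p σ) :
    σ.reg (ι (Ctx.arity Γ)) = p.2 := by
  have := h.arg_eq (Ctx.arity Γ) (by simp only [Ctx.arity]; omega)
  simpa only [Ctx.arg, if_true] using this

theorem Rep.congr {ι : ℕ → ℕ} {γ : Γ} {σ τ : State} {d : ℕ} (h : Rep ι γ σ) (hd : 3 ≤ d)
    (hι : ∀ i < Ctx.arity Γ, ι i < d) (hr : ∀ r < d, τ.reg r = σ.reg r)
    (hm : τ.mem = σ.mem) : Rep ι γ τ := by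
  refine ⟨(hr 0 (by omega)).trans h.n_eq, (hr 1 (by omega)).trans h.s_eq,
    (hr 2 (by omega)).trans h.lim_eq, fun a ha => ?_, h.cell_zero, fun i hi => ?_⟩
  · rw [hm]; exact h.cell_eq a ha
  · rw [hr _ (hι i hi)]; exact h.arg_eq i hi

theorem Rep.pair {ι : ℕ → ℕ} {γ : Γ} {σ : State} {i r : ℕ} (h : Rep ι γ σ)
    (hr : σ.reg r = i) : Rep (Function.update ι (Ctx.arity Γ) r) (γ, i) σ := by
  refine ⟨h.n_eq, h.s_eq, h.lim_eq, h.cell_eq, h.cell_zero, fun j hj => ?_⟩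
  simp only [Ctx.arg, Ctx.arity] at hj ⊢
  split
  · next hj' => subst hj'; simpa using hr
  · next hj' => simpa [hj'] using h.arg_eq j (by omega)

/-- The program `p` computes `v` in register `d`, leaving the registers below `d` and the memory as
they are. -/
def Computes (w : ℕ) (p : Cmd) (d : ℕ) (σ : State) (B v : ℕ) : Prop :=
  ∃ τ, Run w p σ B τ ∧ τ.mem = σ.mem ∧ (∀ r < d, τ.reg r = σ.reg r) ∧ τ.reg d = v

/-- The function `f` is polynomially bounded and computed by a program in polynomial time. -/
class Comp (f : Γ → ℕ) : Prop where
  bound : ∀ A, ∃ K, ∀ N γ, Bdd N A γ → f γ < N ^ K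
  prog : ∀ ι d, 3 ≤ d → (∀ i < Ctx.arity Γ, ι i < d) → ∃ p : Cmd, ∀ A, ∃ K, ∀ N γ σ w,
    Bdd N A γ → Rep ι γ σ → N ^ K ≤ 2 ^ w → Computes w p d σ (N ^ K) (f γ)

namespace Comp

theorem of_exp {f : Γ → ℕ} (hf : ∀ A, ∃ K, ∀ N γ, Bdd N A γ → f γ < N ^ K)
    (h : ∀ ι : ℕ → ℕ, ∃ e : Exp, ∀ A, ∃ K, ∀ N γ σ w, Bdd N A γ → Rep ι γ σ → N ^ K ≤ 2 ^ w →
      e.eval w σ = f γ) : Comp f where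
  bound := hf
  prog ι d hd hι := by
    obtain ⟨e, he⟩ := h ι
    refine ⟨.assign d e, fun A => ?_⟩
    obtain ⟨K, hK⟩ := he A
    refine ⟨K + (e.cost + 1), fun N γ σ w hB hR hw => ⟨_, (Run.assign (hK N γ σ w hB hR ?_)).mono ?_,
      rfl, fun r hr => σ.set_reg_of_ne _ (by omega), σ.set_reg_self _ _⟩⟩
    · exact (Nat.pow_le_pow_right (by have := hB.two_le; omega) (by omega)).trans hw
    · rw [pow_add]
      have h1 : 1 ≤ N ^ K := Nat.one_le_pow _ _ (by have := hB.two_le; omega)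
      exact (lit_lt_pow hB.two_le).le.trans (Nat.le_mul_of_pos_left _ h1)

instance const (k : ℕ) : Comp fun _ : Γ => k :=
  of_exp (fun _ => ⟨k, fun _ _ hB => lit_lt_pow hB.two_le⟩) fun _ => ⟨.lit k, fun _ => ⟨k,
    fun _ _ _ _ hB _ hw => Nat.mod_eq_of_lt ((lit_lt_pow hB.two_le).trans_le hw)⟩⟩

instance n : Comp fun γ : Γ => (Ctx.inst γ).n :=
  of_exp (fun A => ⟨A, fun _ _ hB => hB.n_le⟩) fun _ => ⟨.reg 0, fun A => ⟨A,
    fun _ _ _ _ _ hR _ => hR.n_eq⟩⟩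

instance s : Comp fun γ : Γ => (Ctx.inst γ).s :=
  of_exp (fun A => ⟨A, fun _ _ hB => hB.s_le⟩) fun _ => ⟨.reg 1, fun A => ⟨A,
    fun _ _ _ _ _ hR _ => hR.s_eq⟩⟩

instance var : Comp fun p : Γ × ℕ => p.2 :=
  of_exp (fun A => ⟨A, fun _ _ hB => hB.snd⟩) fun ι => ⟨.reg (ι (Ctx.arity Γ)), fun A => ⟨A,
    fun _ _ _ _ _ hR _ => hR.snd⟩⟩

theorem reindex {Δ : Type} [Ctx Δ] {f : Δ → ℕ} (h : Comp f) (φ : Γ → Δ) (κ : ℕ → ℕ)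
    (hφ : ∀ γ, Ctx.inst (φ γ) = Ctx.inst γ) (hκ : ∀ i < Ctx.arity Δ, κ i < Ctx.arity Γ)
    (harg : ∀ γ, ∀ i < Ctx.arity Δ, Ctx.arg (φ γ) i = Ctx.arg γ (κ i)) :
    Comp fun γ => f (φ γ) := by
  have hb : ∀ N A γ, Bdd N A γ → Bdd N A (φ γ) := fun N A γ hB => by
    refine ⟨hB.two_le, ?_, ?_, ?_, ?_, fun i hi => ?_⟩
    · rw [hφ]; exact hB.n_le
    · rw [hφ]; exact hB.s_le
    · rw [hφ]; exact hB.lim_le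
    · rw [hφ]; exact hB.cell_le
    · rw [harg γ i hi]; exact hB.arg_le _ (hκ i hi)
  refine ⟨fun A => ?_, fun ι d hd hι => ?_⟩
  · obtain ⟨K, hK⟩ := h.bound A
    exact ⟨K, fun N γ hB => hK N _ (hb N A γ hB)⟩
  · obtain ⟨p, hp⟩ := h.prog (ι ∘ κ) d hd fun i hi => hι _ (hκ i hi)
    refine ⟨p, fun A => ?_⟩
    obtain ⟨K, hK⟩ := hp A
    refine ⟨K, fun N γ σ w hB hR => hK N _ σ w (hb N A γ hB) ?_⟩
    refine ⟨?_, ?_, ?_, ?_, ?_, fun i hi => ?_⟩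
    · rw [hφ]; exact hR.n_eq
    · rw [hφ]; exact hR.s_eq
    · rw [hφ]; exact hR.lim_eq
    · rw [hφ]; exact hR.cell_eq
    · rw [hφ]; exact hR.cell_zero
    · rw [harg γ i hi]; exact hR.arg_eq _ (hκ i hi)

theorem weaken {f : Γ → ℕ} (h : Comp f) : Comp fun p : Γ × ℕ => f p.1 :=
  h.reindex Prod.fst id (fun _ => rfl) (fun i hi => by simp only [Ctx.arity, id]; omega)
    fun γ i hi => by simp only [Ctx.arg, id, if_neg (show i ≠ Ctx.arity Γ by omega)]

/-- Needed for `least`: there a predicate of the inner bound variable is evaluated under an outer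
bound variable on which it does not depend. -/
theorem weaken_snd {f : Γ × ℕ → ℕ} (h : Comp f) :
    Comp fun p : (Γ × ℕ) × ℕ => f (p.1.1, p.2) :=
  h.reindex (fun p : (Γ × ℕ) × ℕ => (p.1.1, p.2)) (fun i => if i = Ctx.arity Γ then i + 1 else i)
    (fun _ => rfl)
    (fun i hi => by simp only [Ctx.arity] at hi ⊢; split <;> omega)
    fun γ i hi => by
      simp only [Ctx.arg, Ctx.arity] at hi ⊢
      split_ifs <;> first | rfl | omega

instance weaken₁ (f : Γ → ℕ) [h : Comp f] : Comp fun p : Γ × ℕ => f p.1 := h.weaken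
instance weaken₂ (f : Γ → ℕ) [h : Comp f] : Comp fun p : (Γ × ℕ) × ℕ => f p.1.1 :=
  h.weaken.weaken
instance weaken₃ (f : Γ → ℕ) [h : Comp f] : Comp fun p : ((Γ × ℕ) × ℕ) × ℕ => f p.1.1.1 :=
  h.weaken.weaken.weaken

theorem bin {o : Op} (ho : PolyOp o) {f g : Γ → ℕ} (hf : Comp f) (hg : Comp g) :
    Comp fun γ => o.eval (f γ) (g γ) where
  bound A := by
    obtain ⟨K, hK⟩ := hf.bound A
    obtain ⟨K', hK'⟩ := hg.bound A
    obtain ⟨K'', hK''⟩ := ho K K'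
    exact ⟨K'', fun N γ hB => hK'' N _ _ hB.two_le (hK N γ hB) (hK' N γ hB)⟩
  prog ι d hd hι := by
    obtain ⟨p, hp⟩ := hf.prog ι d hd hι
    obtain ⟨q, hq⟩ := hg.prog ι (d + 1) (by omega) fun i hi => (hι i hi).trans (by omega)
    refine ⟨.seq p (.seq q (.assign d (.bin o (.reg d) (.reg (d + 1))))), fun A => ?_⟩
    obtain ⟨K, hK⟩ := hp A
    obtain ⟨K', hK'⟩ := hq A
    obtain ⟨L, hL⟩ := hf.bound A
    obtain ⟨L', hL'⟩ := hg.bound A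
    obtain ⟨K'', hK''⟩ := ho L L'
    refine ⟨K + K' + K'' + 3, fun N γ σ w hB hR hw => ?_⟩
    have hN := hB.two_le
    have hle : ∀ k ≤ K + K' + K'' + 3, N ^ k ≤ 2 ^ w := fun k hk =>
      (Nat.pow_le_pow_right (by omega) hk).trans hw
    obtain ⟨τ, hτ, hm, hr, hv⟩ := hK N γ σ w hB hR (hle _ (by omega))
    obtain ⟨τ', hτ', hm', hr', hv'⟩ := hK' N γ τ w hB (hR.congr hd hι hr hm) (hle _ (by omega))
    have hlt := hK'' N _ _ hN (hL N γ hB) (hL' N γ hB)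
    have hE : (Exp.bin o (.reg d) (.reg (d + 1))).eval w τ' = o.eval (f γ) (g γ) := by
      simp only [Exp.eval, hv', hr' d (by omega), hv]
      exact Nat.mod_eq_of_lt (hlt.trans_le (hle _ (by omega)))
    refine ⟨_, (hτ.seq (hτ'.seq (Run.assign hE))).mono ?_, hm'.trans hm, fun r hr₁ => ?_,
      State.set_reg_self _ _ _⟩
    · have h₁ : N ^ K ≤ N ^ (K + K' + K'') := Nat.pow_le_pow_right (by omega) (by omega)
      have h₂ : N ^ K' ≤ N ^ (K + K' + K'') := Nat.pow_le_pow_right (by omega) (by omega)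
      have h₃ : 1 ≤ N ^ (K + K' + K'') := Nat.one_le_pow _ _ (by omega)
      have h₄ : 8 ≤ N ^ 3 := Nat.pow_le_pow_left hN 3
      rw [pow_add _ _ 3]
      simp only [Exp.cost]
      nlinarith
    · rw [State.set_reg_of_ne _ _ (by omega), hr' r (by omega), hr r hr₁]

section

variable (f g : Γ → ℕ) [hf : Comp f] [hg : Comp g]

instance add : Comp fun γ => f γ + g γ := bin polyOp_add hf hg
instance sub : Comp fun γ => f γ - g γ := bin polyOp_sub hf hg
instance mul : Comp fun γ => f γ * g γ := bin polyOp_mul hf hg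
instance div : Comp fun γ => f γ / g γ := bin polyOp_div hf hg
instance mod : Comp fun γ => f γ % g γ := bin polyOp_mod hf hg
instance shr : Comp fun γ => f γ >>> g γ := bin polyOp_shr hf hg

end

/-- Memory agrees with the table only below `lim`, and the output is written from there on. Hence
the test, with the value 0 beyond `lim`. -/
instance cell (f : Γ → ℕ) [hf : Comp f] : Comp fun γ => (Ctx.inst γ).cell (f γ) where
  bound A := ⟨A, fun N γ hB => hB.cell_le _⟩
  prog ι d hd hι := by
    obtain ⟨p, hp⟩ := hf.prog ι d hd hι
    refine ⟨.seq p (.cond (.bin .lt (.reg d) (.reg 2)) (.assign d (.load (.reg d)))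
      (.assign d (.lit 0))), fun A => ?_⟩
    obtain ⟨K, hK⟩ := hp A
    refine ⟨K + 4, fun N γ σ w hB hR hw => ?_⟩
    have hN := hB.two_le
    have h₁ : 1 ≤ N ^ K := Nat.one_le_pow _ _ (by omega)
    have h₄ : 16 ≤ N ^ 4 := Nat.pow_le_pow_left hN 4
    have hT : N ^ K + 8 ≤ N ^ (K + 4) := by rw [pow_add]; nlinarith
    obtain ⟨τ, hτ, hm, hr, hv⟩ := hK N γ σ w hB hR
      ((Nat.pow_le_pow_right (by omega) (by omega)).trans hw)
    have hlim : τ.reg 2 = (Ctx.inst γ).lim := (hr 2 (by omega)).trans hR.lim_eq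
    by_cases h : f γ < (Ctx.inst γ).lim
    · refine ⟨τ.set d ((Ctx.inst γ).cell (f γ)), (hτ.seq (Run.cond_pos ?_ (Run.assign ?_))).mono ?_,
        hm, fun r hr₁ => ?_, State.set_reg_self _ _ _⟩
      · simp [Exp.eval, Op.eval, hv, hlim, h,
          Nat.mod_eq_of_lt (show 1 < 2 ^ w by omega)]
      · simp only [Exp.eval, hv, hm]; exact hR.cell_eq _ h
      · simp only [Exp.cost]; omega
      · rw [State.set_reg_of_ne _ _ (by omega), hr r hr₁]
    · refine ⟨τ.set d ((Ctx.inst γ).cell (f γ)), (hτ.seq (Run.cond_neg ?_ (Run.assign ?_))).mono ?_,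
        hm, fun r hr₁ => ?_, State.set_reg_self _ _ _⟩
      · simp [Exp.eval, Op.eval, hv, hlim, h]
      · simp only [Exp.eval, Nat.zero_mod]; exact (hR.cell_zero _ (by omega)).symm
      · simp only [Exp.cost]; omega
      · rw [State.set_reg_of_ne _ _ (by omega), hr r hr₁]

/-- The only looping combinator; counting, bounded quantifiers and bounded search are reduced to it.
Register d holds the bound, d + 1 the counter, d + 2 the partial sum, and d + 3 the summand. All
partial sums stay below `N ^ L`, so they are exact. -/
instance sum (b : Γ → ℕ) (f : Γ → ℕ → ℕ) [hb : Comp b] [hf : Comp fun p : Γ × ℕ => f p.1 p.2] :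
    Comp fun γ => ∑ i ∈ Finset.range (b γ), f γ i := by
  have hbd : ∀ A, ∃ K, A ≤ K ∧ ∃ L, ∀ N (γ : Γ), Bdd N A γ →
      b γ < N ^ K ∧ (∀ i < b γ, Bdd N K (γ, i)) ∧
      ∀ j ≤ b γ, ∑ i ∈ Finset.range j, f γ i < N ^ L := by
    intro A
    obtain ⟨K, hK⟩ := hb.bound A
    obtain ⟨L, hL⟩ := hf.bound (A + K)
    refine ⟨A + K, by omega, K + L, fun N γ hB => ?_⟩
    have hN := hB.two_le
    have h₁ : b γ < N ^ (A + K) :=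
      (hK N γ hB).trans_le (Nat.pow_le_pow_right (by omega) (by omega))
    have h₂ : ∀ i < b γ, Bdd N (A + K) (γ, i) := fun i hi =>
      (hB.mono (by omega)).pair (hi.trans h₁)
    refine ⟨h₁, h₂, fun j hj => ?_⟩
    calc ∑ i ∈ Finset.range j, f γ i ≤ ∑ i ∈ Finset.range j, N ^ L :=
          Finset.sum_le_sum fun i hi =>
            (hL N (γ, i) (h₂ i ((Finset.mem_range.1 hi).trans_le hj))).le
      _ = j * N ^ L := by simp
      _ < N ^ (K + L) := by
          rw [pow_add]
          exact Nat.mul_lt_mul_of_pos_right (hj.trans_lt (hK N γ hB)) (by positivity)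
  refine ⟨fun A => ?_, fun ι d hd hι => ?_⟩
  · obtain ⟨K, -, L, h⟩ := hbd A
    exact ⟨L, fun N γ hB => (h N γ hB).2.2 _ le_rfl⟩
  · obtain ⟨p, hp⟩ := hb.prog ι d hd hι
    obtain ⟨q, hq⟩ := hf.prog (Function.update ι (Ctx.arity Γ) (d + 1)) (d + 3) (by omega) (by
      intro i hi
      simp only [Ctx.arity] at hi
      by_cases h : i = Ctx.arity Γ
      · subst h; simp
      · simp only [Function.update, h, dif_neg, not_false_iff]
        have := hι i (by omega)
        omega)
    refine ⟨.seq p (.seq (.assign (d + 2) (.lit 0)) (.seq (forCmd (d + 1) d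
      (.seq q (.assign (d + 2) (.bin .add (.reg (d + 2)) (.reg (d + 3))))))
      (.assign d (.reg (d + 2))))), fun A => ?_⟩
    obtain ⟨Kp, hKp⟩ := hp A
    obtain ⟨K, hAK, L, hKL⟩ := hbd A
    obtain ⟨Kq, hKq⟩ := hq K
    refine ⟨Kp + K + L + Kq + 6, fun N γ σ w hB hR hw => ?_⟩
    obtain ⟨hbK, hBi, hsum⟩ := hKL N γ hB
    have hN := hB.two_le
    have hle : ∀ k ≤ Kp + K + L + Kq + 6, N ^ k ≤ 2 ^ w := fun k hk =>
      (Nat.pow_le_pow_right (by omega) hk).trans hw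
    obtain ⟨τ, hτ, hm, hr, hv⟩ := hKp N γ σ w hB hR (hle _ (by omega))
    have h2w : 2 ≤ 2 ^ w := hN.trans (by simpa using hle 1 (by omega))
    have hw1 : 1 ≤ w := by
      rcases Nat.eq_zero_or_pos w with h | h
      · subst h; omega
      · exact h
    obtain ⟨τ', hτ', hI⟩ := run_forCmd (w := w) (i := d + 1) (b := d) (m := b γ)
      (B := N ^ Kq + 4) (σ := τ.set (d + 2) 0)
      (body := .seq q (.assign (d + 2) (.bin .add (.reg (d + 2)) (.reg (d + 3)))))
      (fun j ρ => ρ.mem = σ.mem ∧ (∀ r < d, ρ.reg r = σ.reg r) ∧ ρ.reg d = b γ ∧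
        ρ.reg (d + 1) = j ∧ ρ.reg (d + 2) = ∑ i ∈ Finset.range j, f γ i)
      (hbK.trans_le (hle _ (by omega))) hw1
      (fun j ρ h => ⟨h.2.2.2.1, h.2.2.1⟩)
      (by
        refine ⟨hm, fun r hr₁ => ?_, ?_, State.set_reg_self _ _ _, ?_⟩
        · rw [State.set_reg_of_ne _ _ (by omega), State.set_reg_of_ne _ _ (by omega), hr r hr₁]
        · rw [State.set_reg_of_ne _ _ (by omega), State.set_reg_of_ne _ _ (by omega), hv]
        · rw [State.set_reg_of_ne _ _ (by omega), State.set_reg_self]; simp)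
      (by
        rintro j ρ hj ⟨hρm, hρr, hρd, hρi, hρs⟩
        obtain ⟨ρ', hρ', hm', hr', hv'⟩ := hKq N (γ, j) ρ w (hBi j hj)
          ((hR.congr hd hι hρr hρm).pair hρi) (hle _ (by omega))
        have hE : (Exp.bin .add (.reg (d + 2)) (.reg (d + 3))).eval w ρ' =
            ∑ i ∈ Finset.range (j + 1), f γ i := by
          simp only [Exp.eval, Op.eval, hv', hr' (d + 2) (by omega), hρs]
          rw [Finset.sum_range_succ]
          refine Nat.mod_eq_of_lt ?_
          rw [← Finset.sum_range_succ]
          exact (hsum (j + 1) hj).trans_le (hle _ (by omega))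
        refine ⟨_, (hρ'.seq (Run.assign hE)).mono (by simp [Exp.cost]), ?_, hm'.trans hρm,
          fun r hr₁ => ?_, ?_, ?_, ?_⟩
        · rw [State.set_reg_of_ne _ _ (by omega), hr' _ (by omega), hρi]
        · rw [State.set_reg_of_ne _ _ (by omega), State.set_reg_of_ne _ _ (by omega),
            hr' _ (by omega), hρr r hr₁]
        · rw [State.set_reg_of_ne _ _ (by omega), State.set_reg_of_ne _ _ (by omega),
            hr' _ (by omega), hρd]
        · rw [State.set_reg_self]
        · rw [State.set_reg_of_ne _ _ (by omega), State.set_reg_self])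
    obtain ⟨hm', hr', -, -, hs'⟩ := hI
    have hz : Run w (.assign (d + 2) (.lit 0)) τ 2 (τ.set (d + 2) 0) :=
      Run.assign (by simp [Exp.eval])
    refine ⟨_, (hτ.seq (hz.seq (hτ'.seq (Run.assign (r := d) (e := .reg (d + 2)) hs')))).mono ?_,
      hm', fun r hr₁ => ?_, State.set_reg_self _ _ _⟩
    · have h₁ : N ^ Kp ≤ N ^ (Kp + K + L + Kq) := Nat.pow_le_pow_right (by omega) (by omega)
      have h₂ : N ^ K * N ^ Kq ≤ N ^ (Kp + K + L + Kq) := by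
        rw [← pow_add]; exact Nat.pow_le_pow_right (by omega) (by omega)
      have h₃ : 1 ≤ N ^ Kq := Nat.one_le_pow _ _ (by omega)
      have h₄ : 64 ≤ N ^ 6 := Nat.pow_le_pow_left hN 6
      have h₅ : 1 ≤ N ^ (Kp + K + L + Kq) := Nat.one_le_pow _ _ (by omega)
      have h₆ : b γ * (N ^ Kq + 4 + 8) ≤ 13 * (N ^ K * N ^ Kq) := by
        calc b γ * (N ^ Kq + 4 + 8) ≤ N ^ K * (13 * N ^ Kq) :=
              Nat.mul_le_mul hbK.le (by omega)
          _ = _ := by ring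
      rw [pow_add _ _ 6]
      simp only [Exp.cost]
      nlinarith
    · rw [State.set_reg_of_ne _ _ (by omega), hr' r hr₁]

end Comp

end WordRAM

/-! ### Decidable predicates, counting and bounded search in polynomial time -/

namespace WordRAM

variable {Γ : Type} [Ctx Γ]

open Classical in
/-- The predicate `c` is decided by a program in polynomial time. -/
class CompProp (c : Γ → Prop) : Prop where
  out : Comp fun γ => if c γ then 1 else 0

namespace CompProp

theorem congr {c c' : Γ → Prop} (h : CompProp c) (e : ∀ γ, c' γ ↔ c γ) : CompProp c' := by
  rwa [show c' = c from funext fun γ => propext (e γ)]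

instance eq (f g : Γ → ℕ) [hf : Comp f] [hg : Comp g] : CompProp fun γ => f γ = g γ where
  out := by
    convert Comp.bin polyOp_eq hf hg using 3
    simp only [Op.eval]
    congr

instance lt (f g : Γ → ℕ) [hf : Comp f] [hg : Comp g] : CompProp fun γ => f γ < g γ where
  out := by
    convert Comp.bin polyOp_lt hf hg using 3
    simp only [Op.eval]
    congr

open Classical in
instance ite (c : Γ → Prop) (f g : Γ → ℕ) [hc : CompProp c] [Comp f] [Comp g]
    [∀ γ, Decidable (c γ)] : Comp fun γ => if c γ then f γ else g γ := by
  have key : ∀ b : Γ → ℕ, Comp b → Comp fun γ => b γ * f γ + (1 - b γ) * g γ :=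
    fun b _ => inferInstance
  convert key _ hc.out using 2 with γ
  split <;> simp

instance not (c : Γ → Prop) [CompProp c] : CompProp fun γ => ¬ c γ := by
  classical
  have h : CompProp fun γ => (if c γ then 1 else 0) = 0 := inferInstance
  exact h.congr fun γ => by simp

instance and (c c' : Γ → Prop) [CompProp c] [CompProp c'] : CompProp fun γ => c γ ∧ c' γ := by
  classical
  have h : CompProp fun γ => (if c γ then if c' γ then 1 else 0 else 0) = 1 := inferInstance
  exact h.congr fun γ => by split <;> simp [*]

instance or (c c' : Γ → Prop) [CompProp c] [CompProp c'] : CompProp fun γ => c γ ∨ c' γ := by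
  classical
  have h : CompProp fun γ => (if c γ then 1 else if c' γ then 1 else 0) = 1 := inferInstance
  exact h.congr fun γ => by split <;> simp [*]

instance imp (c c' : Γ → Prop) [CompProp c] [CompProp c'] : CompProp fun γ => c γ → c' γ := by
  have h : CompProp fun γ => ¬ c γ ∨ c' γ := inferInstance
  exact h.congr fun γ => imp_iff_not_or

instance iff (c c' : Γ → Prop) [CompProp c] [CompProp c'] : CompProp fun γ => c γ ↔ c' γ := by
  have h : CompProp fun γ => (c γ → c' γ) ∧ (c' γ → c γ) := inferInstance
  exact h.congr fun γ => iff_iff_implies_and_implies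

instance le (f g : Γ → ℕ) [Comp f] [Comp g] : CompProp fun γ => f γ ≤ g γ := by
  have h : CompProp fun γ => ¬ g γ < f γ := inferInstance
  exact h.congr fun γ => by simp

instance forall_lt (b : Γ → ℕ) (c : Γ → ℕ → Prop) [Comp b]
    [CompProp fun p : Γ × ℕ => c p.1 p.2] : CompProp fun γ => ∀ i < b γ, c γ i := by
  classical
  have h : CompProp fun γ => ∑ i ∈ Finset.range (b γ), (if ¬ c γ i then 1 else 0) = 0 :=
    inferInstance
  exact h.congr fun γ => by simp [Finset.sum_eq_zero_iff]

end CompProp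

open Classical in
/-- The number of `i < b` with property `c`. -/
noncomputable def cnt (b : ℕ) (c : ℕ → Prop) : ℕ := ∑ i ∈ Finset.range b, if c i then 1 else 0

open Classical in
/-- The least `i < b` with property `c`, and `b` if there is none. -/
noncomputable def least (b : ℕ) (c : ℕ → Prop) : ℕ := cnt b fun i => ∀ j < i + 1, ¬ c j

theorem cnt_eq_card (b : ℕ) (c : ℕ → Prop) [DecidablePred c] :
    cnt b c = ((Finset.range b).filter c).card := by
  rw [Finset.card_filter]
  unfold cnt
  congr! 3

theorem cnt_eq_of_iff_lt {b m : ℕ} {c : ℕ → Prop} (h : ∀ i < b, c i ↔ i < m) (hm : m ≤ b) :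
    cnt b c = m := by
  classical
  rw [cnt_eq_card]
  conv_rhs => rw [← Finset.card_range m]
  congr 1
  ext i
  simp only [Finset.mem_filter, Finset.mem_range]
  constructor
  · rintro ⟨h₁, h₂⟩; exact (h i h₁).1 h₂
  · intro h₁; exact ⟨by omega, (h i (by omega)).2 h₁⟩

/-- The indices i for which no j ≤ i has the property are exactly those below m, so counting them
gives m. -/
theorem least_eq {b m : ℕ} {c : ℕ → Prop} (hm : m < b) (h : c m) (hl : ∀ j < m, ¬ c j) :
    least b c = m := by
  refine cnt_eq_of_iff_lt (fun i _ => ⟨fun h' => ?_, fun h' j hj => hl j (by omega)⟩) hm.le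
  by_contra hn
  exact h' m (by omega) h

theorem least_spec {b : ℕ} {c : ℕ → Prop} (h : ∃ i < b, c i) :
    least b c < b ∧ c (least b c) ∧ ∀ j < least b c, ¬ c j := by
  classical
  obtain ⟨i, hi, hc⟩ := h
  have hex : ∃ i, c i := ⟨i, hc⟩
  have hlt : Nat.find hex < b := (Nat.find_min' hex hc).trans_lt hi
  rw [least_eq hlt (Nat.find_spec hex) fun j hj => Nat.find_min hex hj]
  exact ⟨hlt, Nat.find_spec hex, fun j hj => Nat.find_min hex hj⟩

/-- The inequality `1 ≤ v >>> (b + 1)` says `2 ^ (b + 1) ≤ v`, that is, b lies below the logarithm.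
-/
theorem log_eq_cnt (v : ℕ) : Nat.log 2 v = cnt v fun b => 1 ≤ v >>> (b + 1) := by
  rcases Nat.eq_zero_or_pos v with rfl | hv
  · simp [cnt]
  refine (cnt_eq_of_iff_lt (fun i _ => ?_) (Nat.log_le_self 2 v)).symm
  rw [Nat.shiftRight_eq_div_pow, Nat.le_div_iff_mul_le (by positivity), one_mul,
    Nat.lt_iff_add_one_le, ← Nat.le_log_iff_pow_le (by norm_num) hv.ne']

instance Comp.cnt (b : Γ → ℕ) (c : Γ → ℕ → Prop) [Comp b]
    [CompProp fun p : Γ × ℕ => c p.1 p.2] : Comp fun γ => cnt (b γ) (c γ) := by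
  classical
  unfold WordRAM.cnt
  infer_instance

instance Comp.least (b : Γ → ℕ) (c : Γ → ℕ → Prop) [Comp b]
    [h : CompProp fun p : Γ × ℕ => c p.1 p.2] : Comp fun γ => least (b γ) (c γ) := by
  unfold WordRAM.least
  have : CompProp fun p : (Γ × ℕ) × ℕ => c p.1.1 p.2 := ⟨h.out.weaken_snd⟩
  infer_instance

end WordRAM

namespace WordRAM

/-! ### The contents of the oracle -/

namespace Inst

variable (I : Inst)

/-- Membership in the set of cut-vertices. -/
def C (v : ℕ) : Prop := v < I.n ∧ I.cell (I.n * I.n + v) = 1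

/-- There is a path from `u` to `v` that avoids `x`. -/
def R (x u v : ℕ) : Prop :=
  u ≠ x ∧ v ≠ x ∧ (u = v ∨ I.cell (I.n * I.n + I.n + ((x * I.n + u) * I.n + v)) = 1)

/-- The number of cut-vertices. -/
noncomputable def k : ℕ := cnt I.n I.C

/-- The position of the cut-vertex `v` in the order by dominance. -/
noncomputable def pos (v : ℕ) : ℕ := cnt I.n fun u => I.C u ∧ I.R v I.s u

/-- The cut-vertex at position `i`. -/
noncomputable def vert (i : ℕ) : ℕ := least I.n fun v => I.C v ∧ I.pos v = i

/-- Reachability between positions, for `e = 0`; otherwise in the reversed order and digraph. -/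
def P (e i j l : ℕ) : Prop :=
  I.R (I.vert (if e = 0 then i else I.k - 1 - i)) (I.vert (if e = 0 then j else I.k - 1 - l))
    (I.vert (if e = 0 then l else I.k - 1 - j))

/-- The last position `i > a` without which `a` is not reachable from `a + 1`. -/
noncomputable def hgt (e a : ℕ) : ℕ :=
  least I.k fun m => ∀ i < I.k, a < i → ¬ I.P e i (a + 1) a → i ≤ m

/-- The leftmost position of the maximal height on `[l, r]`. -/
noncomputable def argMax (e l r : ℕ) : ℕ :=
  least (r + 1) fun q => l ≤ q ∧ ∀ q' < r + 1, l ≤ q' → I.hgt e q' ≤ I.hgt e q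

/-- The length of a block of positions. -/
noncomputable def blk : ℕ := Nat.log 2 I.k + 1

/-- The suffix maxima among the positions up to `r` in the block of `r`, as a bit mask. -/
noncomputable def mask (e r : ℕ) : ℕ :=
  least (2 * I.k) fun m => ∀ t < I.blk, (m >>> t % 2 = 1 ↔
    (I.blk * (r / I.blk) + t ≤ r ∧
      ∀ q < r + 1, I.blk * (r / I.blk) + t ≤ q →
        I.hgt e q ≤ I.hgt e (I.blk * (r / I.blk) + t)))

/-- The position of the least significant bit of `v`. -/
noncomputable def lsb (v : ℕ) : ℕ := least v fun t => v >>> t % 2 = 1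

/-- The number `2 ^ t`, if it is at most `k`. -/
noncomputable def pow (t : ℕ) : ℕ := least (I.k + 1) fun v => v >>> t = 1

/-- The sparse table, which has the range maxima over `2 ^ t` consecutive blocks. -/
noncomputable def sparse (e r : ℕ) : ℕ :=
  I.argMax e (r % (I.k / I.blk + 1) * I.blk)
    ((r % (I.k / I.blk + 1) + I.pow (r / (I.k / I.blk + 1))) * I.blk - 1)

/-- The first position that is reachable from `b` without any single position between them. -/
noncomputable def low (b : ℕ) : ℕ := least I.k fun l => ∀ i < b, l < i → I.P 0 i b l

/-- A prime that exceeds `n`. -/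
noncomputable def p : ℕ :=
  least (2 * I.n + 2) fun q => I.n < q ∧ 2 ≤ q ∧ ∀ d < q, 2 ≤ d → q % d ≠ 0

/-- The hash function with multiplier `a` and range `m`. -/
noncomputable def hash (a m v : ℕ) : ℕ := a * v % I.p % m

/-- A multiplier for which the cut-vertices have few collisions. -/
noncomputable def mul₀ : ℕ :=
  least I.p fun a => ∑ u ∈ Finset.range I.n, cnt I.n (fun v => I.C u ∧ I.C v ∧
    I.hash a I.k u = I.hash a I.k v) ≤ 3 * I.k

/-- The bucket of `v` in the first level of the hash table. -/
noncomputable def bucket (v : ℕ) : ℕ := I.hash I.mul₀ I.k v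

/-- The number of slots of the bucket `b`. -/
noncomputable def size (b : ℕ) : ℕ :=
  2 * (cnt I.n (fun u => I.C u ∧ I.bucket u = b) * cnt I.n (fun u => I.C u ∧ I.bucket u = b))

/-- The first slot of the bucket `b`. -/
noncomputable def offset (b : ℕ) : ℕ := ∑ i ∈ Finset.range b, I.size i

/-- A multiplier that is injective on the bucket `b`. -/
noncomputable def mul (b : ℕ) : ℕ :=
  least I.p fun a => ∀ u < I.n, ∀ v < I.n, I.C u → I.C v → I.bucket u = b → I.bucket v = b →
    I.hash a (I.size b) u = I.hash a (I.size b) v → u = v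

/-- The slot of `v` in the hash table. -/
noncomputable def slot (v : ℕ) : ℕ :=
  I.offset (I.bucket v) + I.hash (I.mul (I.bucket v)) (I.size (I.bucket v)) v

/-- The position of the cut-vertex in the slot `r`. -/
noncomputable def posAt (r : ℕ) : ℕ := I.pos (least I.n fun v => I.C v ∧ I.slot v = r)

/-- The entry in column `q` and row `r` of the oracle. -/
noncomputable def col (q r : ℕ) : ℕ :=
  if q = 0 then I.k else if q = 1 then I.p else if q = 2 then I.mul₀ else if q = 3 then I.blk
  else if q = 4 then I.mul r else if q = 5 then I.offset r else if q = 6 then I.size r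
  else if q = 7 then I.posAt r else if q = 8 then lsb r else if q = 9 then Nat.log 2 r
  else if q = 10 then I.pow (Nat.log 2 r) else if q = 11 then I.low r
  else if q = 12 then I.hgt 0 r else if q = 13 then I.hgt 1 r
  else if q = 14 then I.mask 0 r else if q = 15 then I.mask 1 r
  else if q = 16 then I.sparse 0 r else I.sparse 1 r

/-- The words of the oracle, row by row. -/
noncomputable def word (i : ℕ) : ℕ := I.col (i % 18) (i / 18)

end Inst

/-! ### The oracle is computable in polynomial time -/

section

variable {Γ : Type} [Ctx Γ] (x y z u : Γ → ℕ) [Comp x] [Comp y] [Comp z] [Comp u]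

instance : CompProp fun γ => (Ctx.inst γ).C (x γ) := by
  unfold Inst.C; infer_instance
instance : CompProp fun γ => (Ctx.inst γ).R (x γ) (y γ) (z γ) := by
  unfold Inst.R; infer_instance
instance : Comp fun γ : Γ => (Ctx.inst γ).k := by
  unfold Inst.k; infer_instance
instance : Comp fun γ => (Ctx.inst γ).pos (x γ) := by
  unfold Inst.pos; infer_instance
instance : Comp fun γ => (Ctx.inst γ).vert (x γ) := by
  unfold Inst.vert; infer_instance
instance : CompProp fun γ => (Ctx.inst γ).P (x γ) (y γ) (z γ) (u γ) := by
  unfold Inst.P; infer_instance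
instance : Comp fun γ => (Ctx.inst γ).hgt (x γ) (y γ) := by
  unfold Inst.hgt; infer_instance
instance : Comp fun γ => (Ctx.inst γ).argMax (x γ) (y γ) (z γ) := by
  unfold Inst.argMax; infer_instance

instance : Comp fun γ => Nat.log 2 (x γ) := by
  simp only [log_eq_cnt]; infer_instance
instance : Comp fun γ : Γ => (Ctx.inst γ).blk := by
  unfold Inst.blk; infer_instance
instance : Comp fun γ => (Ctx.inst γ).mask (x γ) (y γ) := by
  unfold Inst.mask; infer_instance
instance : Comp fun γ => Inst.lsb (x γ) := by
  unfold Inst.lsb; infer_instance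
instance : Comp fun γ => (Ctx.inst γ).pow (x γ) := by
  unfold Inst.pow; infer_instance
instance : Comp fun γ => (Ctx.inst γ).sparse (x γ) (y γ) := by
  unfold Inst.sparse; infer_instance
instance : Comp fun γ => (Ctx.inst γ).low (x γ) := by
  unfold Inst.low; infer_instance
instance : Comp fun γ : Γ => (Ctx.inst γ).p := by
  unfold Inst.p; infer_instance
instance : Comp fun γ => (Ctx.inst γ).hash (x γ) (y γ) (z γ) := by
  unfold Inst.hash; infer_instance
instance : Comp fun γ : Γ => (Ctx.inst γ).mul₀ := by
  unfold Inst.mul₀; infer_instance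
instance : Comp fun γ => (Ctx.inst γ).bucket (x γ) := by
  unfold Inst.bucket; infer_instance
instance : Comp fun γ => (Ctx.inst γ).size (x γ) := by
  unfold Inst.size; infer_instance
instance : Comp fun γ => (Ctx.inst γ).offset (x γ) := by
  unfold Inst.offset; infer_instance
instance : Comp fun γ => (Ctx.inst γ).mul (x γ) := by
  unfold Inst.mul; infer_instance
instance : Comp fun γ => (Ctx.inst γ).slot (x γ) := by
  unfold Inst.slot; infer_instance
instance : Comp fun γ => (Ctx.inst γ).posAt (x γ) := by
  unfold Inst.posAt; infer_instance
instance : Comp fun γ => (Ctx.inst γ).col (x γ) (y γ) := by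
  unfold Inst.col; infer_instance
instance : Comp fun γ => (Ctx.inst γ).word (x γ) := by
  unfold Inst.word; infer_instance

end

end WordRAM

/-! ### Cut-vertices are ordered by dominance -/

section CutVertices

variable {V : Type*} {G : Digraph V} {s t : V}

theorem HasPathAvoiding.refl (G : Digraph V) {x u : V} (h : u ≠ x) : HasPathAvoiding G x u u :=
  ⟨h, h, .refl⟩

theorem HasPathAvoiding.trans {x u v w : V} (h : HasPathAvoiding G x u v)
    (h' : HasPathAvoiding G x v w) : HasPathAvoiding G x u w :=
  ⟨h.1, h'.2.1, h.2.2.trans h'.2.2⟩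

theorem HasPathAvoiding.head {x u v w : V} (hu : u ≠ x) (h : G.Adj u v)
    (h' : HasPathAvoiding G x v w) : HasPathAvoiding G x u w :=
  ⟨hu, h'.2.1, .head ⟨h, hu, h'.1⟩ h'.2.2⟩

theorem HasPathAvoiding.tail {x u v w : V} (h' : HasPathAvoiding G x u v) (h : G.Adj v w)
    (hw : w ≠ x) : HasPathAvoiding G x u w :=
  ⟨h'.1, hw, .tail h'.2.2 ⟨h, h'.2.1, hw⟩⟩

theorem HasPath.avoid_or_through {w : V} (h : HasPath G w t) (v : V) :
    HasPathAvoiding G v w t ∨ HasPath G w v ∧ HasPath G v t := by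
  induction h using Relation.ReflTransGen.head_induction_on with
  | refl =>
    by_cases h : t = v
    · subst h; exact .inr ⟨.refl, .refl⟩
    · exact .inl (.refl G h)
  | @head a c hac hct ih =>
    rcases ih with ih | ih
    · by_cases h : a = v
      · subst h; exact .inr ⟨.refl, .head hac hct⟩
      · exact .inl (ih.head h hac)
    · exact .inr ⟨.head hac ih.1, ih.2⟩

/-- Follow the given path: either it meets u, and its initial part reaches u without w, or it avoids
u. -/
theorem HasPathAvoiding.avoid_or_through {v w : V} (h : HasPathAvoiding G w s v) (u : V) :
    HasPathAvoiding G w s u ∨ HasPathAvoiding G u s v := by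
  obtain ⟨h₁, -, h⟩ := h
  induction h with
  | refl =>
    by_cases h : s = u
    · subst h; exact .inl (.refl G h₁)
    · exact .inr (.refl G h)
  | @tail b c hb hbc ih =>
    rcases ih with ih | ih
    · exact .inl ih
    · by_cases h : c = u
      · subst h; exact .inl ⟨h₁, hbc.2.2, hb.tail hbc⟩
      · exact .inr (ih.tail hbc.1 h)

/-- If the path meets u or v, consider the last visit to either; the rest of the path avoids the
other one. -/
theorem HasPath.last_visit {w u v : V} (h : HasPath G w t) (huv : u ≠ v) :
    HasPathAvoiding G u w t ∧ HasPathAvoiding G v w t ∨ HasPathAvoiding G u v t ∨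
      HasPathAvoiding G v u t := by
  induction h using Relation.ReflTransGen.head_induction_on with
  | refl =>
    by_cases hu : t = u
    · subst hu; exact .inr (.inr (.refl G huv))
    by_cases hv : t = v
    · subst hv; exact .inr (.inl (.refl G huv.symm))
    exact .inl ⟨.refl G hu, .refl G hv⟩
  | @head a c hac hct ih =>
    rcases ih with ⟨ih₁, ih₂⟩ | ih
    · by_cases hu : a = u
      · subst hu; exact .inr (.inr (ih₂.head huv hac))
      by_cases hv : a = v
      · subst hv; exact .inr (.inl (ih₁.head huv.symm hac))
      exact .inl ⟨ih₁.head hu hac, ih₂.head hv hac⟩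
    · exact .inr ih

theorem HasPath.first_visit {w u v : V} (h : HasPath G s w) (huv : u ≠ v) :
    HasPathAvoiding G u s w ∧ HasPathAvoiding G v s w ∨ HasPathAvoiding G u s v ∨
      HasPathAvoiding G v s u := by
  induction h with
  | refl =>
    by_cases hu : s = u
    · subst hu; exact .inr (.inr (.refl G huv))
    by_cases hv : s = v
    · subst hv; exact .inr (.inl (.refl G huv.symm))
    exact .inl ⟨.refl G hu, .refl G hv⟩
  | @tail b c hb hbc ih =>
    rcases ih with ⟨ih₁, ih₂⟩ | ih
    · by_cases hu : c = u
      · subst hu; exact .inr (.inr (ih₂.tail hbc huv))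
      by_cases hv : c = v
      · subst hv; exact .inr (.inl (ih₁.tail hbc huv.symm))
      exact .inl ⟨ih₁.tail hbc hu, ih₂.tail hbc hv⟩
    · exact .inr ih

variable (hst : HasPath G s t)
include hst

/-- A path from s to t must meet u, so one of u and v is met first. -/
theorem IsCutVertex.total {u v : V} (hu : IsCutVertex G s t u) (huv : u ≠ v) :
    HasPathAvoiding G v s u ∨ HasPathAvoiding G u s v := by
  rcases hst.first_visit huv with h | h | h
  · exact (hu h.1).elim
  · exact .inr h
  · exact .inl h

/-- Take the last of u and v on a path from s to t. If it were u, then s could reach t through u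
without v. -/
theorem IsCutVertex.path_to_target {u v : V} (hu : IsCutVertex G s t u)
    (hv : IsCutVertex G s t v) (h : HasPathAvoiding G v s u) : HasPathAvoiding G u v t := by
  rcases hst.last_visit h.2.1 with h' | h' | h'
  · exact (hu h'.1).elim
  · exact h'
  · exact (hv (h.trans h')).elim

theorem IsCutVertex.antisymm {u v : V} (hu : IsCutVertex G s t u) (hv : IsCutVertex G s t v)
    (h : HasPathAvoiding G v s u) : ¬ HasPathAvoiding G u s v := fun h' =>
  hu (h'.trans (hu.path_to_target hst hv h))

/-- On the path to v that avoids w, either u is met, as wanted, or v is reached without u, which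
antisymmetry excludes. -/
theorem IsCutVertex.trans {u v w : V} (hu : IsCutVertex G s t u) (hv : IsCutVertex G s t v)
    (h : HasPathAvoiding G v s u) (h' : HasPathAvoiding G w s v) : HasPathAvoiding G w s u :=
  (h'.avoid_or_through u).resolve_right (hu.antisymm hst hv h)

end CutVertices

/-! ### Reachability on a directed path with additional back edges -/

/-- `P i j l` behaves as the relation `l is reachable from j without i` in a digraph on
`0, …, k - 1` that consists of the path `0 → 1 → ⋯ → k - 1` and edges that go back. -/
structure BackEdgeReach (k : ℕ) (P : ℕ → ℕ → ℕ → Prop) : Prop where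
  refl : ∀ {i j}, i < k → j < k → i ≠ j → P i j j
  ne_left : ∀ {i j l}, i < k → j < k → l < k → P i j l → j ≠ i
  ne_right : ∀ {i j l}, i < k → j < k → l < k → P i j l → l ≠ i
  trans : ∀ {i a b c}, i < k → a < k → b < k → c < k → P i a b → P i b c → P i a c
  forward : ∀ {i j l}, i < k → l < k → j ≤ l → (i < j ∨ l < i) → P i j l
  blocked : ∀ {i j l}, j < i → i < l → l < k → ¬ P i j l
  mono_right : ∀ {i i' j l}, j < i → l < i → i < i' → i' < k → P i j l → P i' j l
  mono_left : ∀ {i i' j l}, i' < i → i < j → i < l → j < k → l < k → P i j l → P i' j l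
  cross : ∀ {i j l c}, i < k → j < k → P i j l → l ≤ c → c < j → ∃ a b, a ≤ c ∧ c < b ∧ b < k ∧
    P i j b ∧ P i a l ∧ ∀ i' < k, i' ≠ a → i' ≠ b → P i' b a

theorem BackEdgeReach.congr {k : ℕ} {P P' : ℕ → ℕ → ℕ → Prop} (hB : BackEdgeReach k P)
    (h : ∀ i j l, i < k → j < k → l < k → (P' i j l ↔ P i j l)) : BackEdgeReach k P' where
  refl hi hj hij := (h _ _ _ hi hj hj).2 (hB.refl hi hj hij)
  ne_left hi hj hl hP := hB.ne_left hi hj hl ((h _ _ _ hi hj hl).1 hP)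
  ne_right hi hj hl hP := hB.ne_right hi hj hl ((h _ _ _ hi hj hl).1 hP)
  trans hi ha hb hc hP hP' := (h _ _ _ hi ha hc).2
    (hB.trans hi ha hb hc ((h _ _ _ hi ha hb).1 hP) ((h _ _ _ hi hb hc).1 hP'))
  forward hi hl hjl hi' := (h _ _ _ hi (by omega) hl).2 (hB.forward hi hl hjl hi')
  blocked hj hl hlk hP := hB.blocked hj hl hlk ((h _ _ _ (by omega) (by omega) hlk).1 hP)
  mono_right hj hl hi hi' hP := (h _ _ _ hi' (by omega) (by omega)).2
    (hB.mono_right hj hl hi hi' ((h _ _ _ (by omega) (by omega) (by omega)).1 hP))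
  mono_left hi hj hl hjk hlk hP := (h _ _ _ (by omega) hjk hlk).2
    (hB.mono_left hi hj hl hjk hlk ((h _ _ _ (by omega) hjk hlk).1 hP))
  cross hi hj hP hl hc := by
    obtain ⟨a, b, p₁, p₂, p₃, p₄, p₅, p₆⟩ := hB.cross hi hj ((h _ _ _ hi hj (by omega)).1 hP) hl hc
    exact ⟨a, b, p₁, p₂, p₃, (h _ _ _ hi hj p₃).2 p₄, (h _ _ _ hi (by omega) (by omega)).2 p₅,
      fun i' hi' h₁ h₂ => (h _ _ _ hi' p₃ (by omega)).2 (p₆ i' hi' h₁ h₂)⟩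

/-! ### Digraphs whose edges rise by at most one -/

section BackEdges

variable {k : ℕ} {E : ℕ → ℕ → Prop}

/-- Reachability without `i` along the relation `E`. -/
def AvoidReach (E : ℕ → ℕ → Prop) (i j l : ℕ) : Prop :=
  j ≠ i ∧ l ≠ i ∧ Relation.ReflTransGen (fun a b => E a b ∧ a ≠ i ∧ b ≠ i) j l

theorem AvoidReach.single {i a b : ℕ} (h : E a b) (ha : a ≠ i) (hb : b ≠ i) :
    AvoidReach E i a b := ⟨ha, hb, .single ⟨h, ha, hb⟩⟩

theorem AvoidReach.trans {i a b c : ℕ} (h : AvoidReach E i a b) (h' : AvoidReach E i b c) :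
    AvoidReach E i a c := ⟨h.1, h'.2.1, h.2.2.trans h'.2.2⟩

variable (hE : ∀ a b, E a b → b ≤ a + 1)
include hE

/-- To get above i, a path from below would have to step on i. It therefore stays below i and also
avoids everything above. -/
theorem AvoidReach.lt_and_avoid {i j l : ℕ} (h : AvoidReach E i j l) (hj : j < i) :
    l < i ∧ ∀ i', i < i' → AvoidReach E i' j l := by
  obtain ⟨-, -, h⟩ := h
  induction h with
  | refl => exact ⟨hj, fun i' hi' => ⟨by omega, by omega, .refl⟩⟩
  | @tail b c hb hbc ih =>
    have := hE b c hbc.1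
    have hc : c < i := by have := hbc.2.2; omega
    exact ⟨hc, fun i' hi' => (ih.2 i' hi').trans (.single hbc.1 (by omega) (by omega))⟩

theorem AvoidReach.gt_and_avoid {i j l : ℕ} (h : AvoidReach E i j l) (hl : i < l) :
    i < j ∧ ∀ i', i' < i → AvoidReach E i' j l := by
  obtain ⟨-, -, h⟩ := h
  induction h using Relation.ReflTransGen.head_induction_on with
  | refl => exact ⟨hl, fun i' hi' => ⟨by omega, by omega, .refl⟩⟩
  | @head a c hac hc ih =>
    have := hE a c hac.1
    have ha : i < a := by have := hac.2.1; omega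
    exact ⟨ha, fun i' hi' => AvoidReach.trans (.single hac.1 (by omega) (by omega)) (ih.2 i' hi')⟩

theorem backEdgeReach_avoidReach (hk : ∀ a b, E a b → a < k)
    (hs : ∀ a, a + 1 < k → E a (a + 1)) : BackEdgeReach k (AvoidReach E) where
  refl _ _ h := ⟨h.symm, h.symm, .refl⟩
  ne_left _ _ _ h := h.1
  ne_right _ _ _ h := h.2.1
  trans _ _ _ _ h h' := h.trans h'
  forward {i j l} hi hl hjl h := by
    induction l, hjl using Nat.le_induction with
    | base => exact ⟨by omega, by omega, .refl⟩
    | succ l hjl ih =>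
      exact (ih (by omega) (by omega)).trans (.single (hs l hl) (by omega) (by omega))
  blocked {i j l} hj hl _ h := by
    have := (h.lt_and_avoid hE hj).1
    omega
  mono_right hj hl hi _ h := (h.lt_and_avoid hE hj).2 _ hi
  mono_left hi hj hl _ _ h := (h.gt_and_avoid hE hl).2 _ hi
  -- The first edge of the path from above c to at most c serves as b → a.
  cross {i j l c} hi hj h hl hc := by
    obtain ⟨h₁, h₂, h⟩ := h
    induction h using Relation.ReflTransGen.head_induction_on with
    | refl => omega
    | @head a d had hd ih =>
      by_cases hdc : d ≤ c
      · exact ⟨d, a, hdc, hc, hj, ⟨h₁, h₁, .refl⟩, ⟨had.2.2, h₂, hd⟩,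
          fun i' _ hia hib => .single had.1 hib.symm hia.symm⟩
      · have hdk : d < k := by
          rcases Relation.ReflTransGen.cases_head hd with rfl | ⟨e, hde, -⟩
          · omega
          · exact hk _ _ hde.1
        obtain ⟨a', b', p₁, p₂, p₃, p₄, p₅, p₆⟩ := ih hdk (by omega) had.2.2
        exact ⟨a', b', p₁, p₂, p₃, (AvoidReach.single had.1 had.2.1 had.2.2).trans p₄, p₅, p₆⟩

end BackEdges

/-! ### Contraction to the cut-vertices -/

section Contract

variable {V : Type*} {G : Digraph V}

/-- There is a nontrivial path from `u` to `v` whose inner vertices are not in `C`. -/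
def DirectPath (G : Digraph V) (C : Set V) (u v : V) : Prop :=
  ∃ w, Relation.ReflTransGen (fun a b => G.Adj a b ∧ b ∉ C) u w ∧ G.Adj w v

theorem DirectPath.hasPathAvoiding {C : Set V} {x u v : V} (h : DirectPath G C u v) (hx : x ∈ C)
    (hu : u ≠ x) (hv : v ≠ x) : HasPathAvoiding G x u v := by
  obtain ⟨w, hw, hwv⟩ := h
  refine HasPathAvoiding.tail ?_ hwv hv
  clear hwv hv
  induction hw with
  | refl => exact .refl G hu
  | tail _ hbc ih => exact ih.tail hbc.1 fun h => hbc.2 (h ▸ hx)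

/-- A path between vertices of `C` can be contracted to its vertices in `C`. -/
theorem exists_contraction {C : Set V} (ok : V → Prop) {u w : V} (hu : u ∈ C)
    (h : Relation.ReflTransGen (fun a b => G.Adj a b ∧ ok a ∧ ok b) u w) :
    ∃ c ∈ C, (c = u ∨ ok c) ∧
      Relation.ReflTransGen (fun a b => DirectPath G C a b ∧ (a = u ∨ ok a) ∧ ok b ∧
        a ∈ C ∧ b ∈ C) u c ∧
      Relation.ReflTransGen (fun a b => G.Adj a b ∧ b ∉ C) c w := by
  induction h with
  | refl => exact ⟨u, hu, .inl rfl, .refl, .refl⟩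
  | @tail b d hb hbd ih =>
    obtain ⟨c, hc, hok, h₁, h₂⟩ := ih
    by_cases hd : d ∈ C
    · exact ⟨d, hd, .inr hbd.2.2, h₁.tail ⟨⟨b, h₂, hbd.1⟩, hok, hbd.2.2, hc, hd⟩, .refl⟩
    · exact ⟨c, hc, hok, h₁, h₂.tail ⟨hbd.1, hd⟩⟩

/-- After its last vertex in C a path has no vertex of C, so nothing remains if it ends in C. The
alternative `a = u` is there because the induction starts from the empty path, which says nothing
about `ok u`. -/
theorem contract_path {C : Set V} (ok : V → Prop) {u v : V} (hu : u ∈ C) (hv : v ∈ C)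
    (h : Relation.ReflTransGen (fun a b => G.Adj a b ∧ ok a ∧ ok b) u v) :
    Relation.ReflTransGen (fun a b => DirectPath G C a b ∧ (a = u ∨ ok a) ∧ ok b ∧
        a ∈ C ∧ b ∈ C) u v := by
  obtain ⟨c, _, _, h₁, h₂⟩ := exists_contraction ok hu h
  rcases Relation.ReflTransGen.cases_tail h₂ with rfl | ⟨b, -, hb⟩
  · exact h₁
  · exact (hb.2 hv).elim

variable {s t : V} {C : Set V} {k : ℕ} {f : ℕ → V}

/-- Reachability between cut-vertices that are listed in their natural order. -/
theorem backEdgeReach_hasPathAvoiding (hst : HasPath G s t) (hC : ∀ v ∈ C, IsCutVertex G s t v)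
    (hf : ∀ i < k, f i ∈ C) (hsurj : ∀ c ∈ C, ∃ i < k, f i = c)
    (hmono : ∀ i j, i < j → j < k → HasPathAvoiding G (f j) s (f i)) :
    BackEdgeReach k fun i j l => HasPathAvoiding G (f i) (f j) (f l) := by
  have hinj : ∀ i < k, ∀ j < k, f i = f j → i = j := by
    intro i hi j hj h
    by_contra hne
    rcases Nat.lt_or_gt_of_ne hne with h' | h'
    · exact (hmono i j h' hj).2.1 h
    · exact (hmono j i h' hi).2.1 h.symm
  let E : ℕ → ℕ → Prop := fun a b => a < k ∧ b < k ∧ DirectPath G C (f a) (f b)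
  -- If b > a + 1, then s reaches `f a`, `f a` reaches `f b`, and `f b` reaches t, all without the
  -- cut-vertex `f (a + 1)`.
  have hE : ∀ a b, E a b → b ≤ a + 1 := by
    rintro a b ⟨ha, hb, h⟩
    by_contra! hab
    have hne : ∀ c < k, c ≠ a + 1 → f c ≠ f (a + 1) := fun c hc h h' =>
      h (hinj c hc _ (by omega) h')
    have h₁ := h.hasPathAvoiding (hf (a + 1) (by omega)) (hne a ha (by omega))
      (hne b hb (by omega))
    have hcut := hC _ (hf (a + 1) (by omega))
    exact hcut (((hmono a (a + 1) (by omega) (by omega)).trans h₁).trans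
      (hcut.path_to_target hst (hC _ (hf b hb)) (hmono (a + 1) b hab hb)))
  -- paths in `G` between vertices of `C` correspond to paths along `E`
  have lift : ∀ ok : V → Prop, ∀ j < k, ∀ v, Relation.ReflTransGen (fun a b => DirectPath G C a b ∧
      (a = f j ∨ ok a) ∧ ok b ∧ a ∈ C ∧ b ∈ C) (f j) v → ∃ l < k, f l = v ∧
      Relation.ReflTransGen (fun a b => E a b ∧ (a = j ∨ ok (f a)) ∧ ok (f b)) j l := by
    intro ok j hj v h
    induction h with
    | refl => exact ⟨j, hj, rfl, .refl⟩
    | @tail b c _ hbc ih =>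
      obtain ⟨l, hl, rfl, h⟩ := ih
      obtain ⟨m, hm, rfl⟩ := hsurj c hbc.2.2.2.2
      refine ⟨m, hm, rfl, h.tail ⟨⟨hl, hm, hbc.1⟩, ?_, hbc.2.2.1⟩⟩
      exact hbc.2.1.imp (fun h => hinj _ hl _ hj h) id
  -- Since s reaches `f a` without `f (a + 1)`, every path from `f a` to t passes through `f (a +
  -- 1)`.
  have hs : ∀ a, a + 1 < k → E a (a + 1) := by
    intro a ha
    have hcut := hC _ (hf (a + 1) ha)
    have h₁ : HasPath G (f a) t := by
      rcases hst.avoid_or_through (f a) with h | h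
      · exact (hC _ (hf a (by omega)) h).elim
      · exact h.2
    have h₂ : HasPath G (f a) (f (a + 1)) := by
      rcases h₁.avoid_or_through (f (a + 1)) with h | h
      · exact (hcut ((hmono a (a + 1) (by omega) ha).trans h)).elim
      · exact h.1
    have h₃ := contract_path (C := C) (fun _ => True) (hf a (by omega)) (hf (a + 1) ha)
      (Relation.ReflTransGen.mono (fun x y h => ⟨h, trivial, trivial⟩) _ _ h₂)
    obtain ⟨l, hl, hl', h₄⟩ := lift _ a (by omega) _ h₃
    obtain rfl := hinj l hl _ ha hl'
    -- On the contracted path, the first edge that leads above a can only be a → a + 1.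
    have h₅ : ∀ x, Relation.ReflTransGen
        (fun a' b => E a' b ∧ (a' = a ∨ True) ∧ True) a x → a < x → E a (a + 1) := by
      intro x h
      induction h with
      | refl => intro h; omega
      | @tail b c _ hbc ih =>
        intro hc
        by_cases hb : a < b
        · exact ih hb
        · have := hE _ _ hbc.1
          obtain rfl : b = a := by omega
          obtain rfl : c = b + 1 := by omega
          exact hbc.1
    exact h₅ _ h₄ (by omega)
  have hiff : ∀ i j l, i < k → j < k → l < k →
      (HasPathAvoiding G (f i) (f j) (f l) ↔ AvoidReach E i j l) := by
    intro i j l hi hj hl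
    constructor
    · rintro ⟨h₁, h₂, h⟩
      obtain ⟨m, hm, hm', h'⟩ := lift _ j hj _
        (contract_path (C := C) (fun v => v ≠ f i) (hf j hj) (hf l hl) h)
      obtain rfl := hinj m hm _ hl hm'
      refine ⟨fun h => h₁ (by rw [h]), fun h => h₂ (by rw [h]),
        Relation.ReflTransGen.mono (fun x y hxy => ⟨hxy.1, ?_, fun h => hxy.2.2 (by rw [h])⟩) _ _ h'⟩
      rcases hxy.2.1 with rfl | h
      · exact fun h => h₁ (by rw [h])
      · exact fun h' => h (by rw [h'])
    · rintro ⟨h₁, h₂, h⟩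
      have hne : ∀ c < k, c ≠ i → f c ≠ f i := fun c hc h h' => h (hinj c hc _ hi h')
      clear h₂ hl
      induction h with
      | refl => exact .refl G (hne j hj h₁)
      | @tail b c _ hbc ih =>
        exact ih.trans (hbc.1.2.2.hasPathAvoiding (hf i hi) (hne b hbc.1.1 hbc.2.1)
          (hne c hbc.1.2.1 hbc.2.2))
  exact (backEdgeReach_avoidReach (k := k) hE (fun a b h => h.1) hs).congr hiff

end Contract

/-! ### Queries on a directed path with back edges by range maxima -/

/-- `q` is the leftmost position of the maximum of `h` on `[l, r]`. -/
structure IsLeftmostMax (h : ℕ → ℕ) (l r q : ℕ) : Prop where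
  left_le : l ≤ q
  le_right : q ≤ r
  le : ∀ x, l ≤ x → x ≤ r → h x ≤ h q
  lt : ∀ x, l ≤ x → x < q → h x < h q

/-- The value of `h a` is the last position `i > a` without which `a` is not reachable from
`a + 1`. -/
def IsHeight (k : ℕ) (P : ℕ → ℕ → ℕ → Prop) (h : ℕ → ℕ) : Prop :=
  ∀ a < k, h a < k ∧ ∀ i < k, a < i → (¬ P i (a + 1) a ↔ i ≤ h a)

namespace BackEdgeReach

variable {k : ℕ} {P : ℕ → ℕ → ℕ → Prop} (hP : BackEdgeReach k P)
include hP

/-- Reversing both the order and the edges keeps the forward path forward and back edges back.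
Reachability to the left above i thus becomes reachability to the left below the mirror image of i.
-/
theorem mirror : BackEdgeReach k fun i j l => P (k - 1 - i) (k - 1 - l) (k - 1 - j) where
  refl hi hj h := hP.refl (by omega) (by omega) (by omega)
  ne_left hi hj hl h h' := hP.ne_right (by omega) (by omega) (by omega) h (by rw [h'])
  ne_right hi hj hl h h' := hP.ne_left (by omega) (by omega) (by omega) h (by rw [h'])
  trans hi ha hb hc h h' := hP.trans (by omega) (by omega) (by omega) (by omega) h' h
  forward hi hl hjl h := hP.forward (by omega) (by omega) (by omega) (by omega)
  blocked hj hl hk h := hP.blocked (by omega) (by omega) (by omega) h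
  mono_right hj hl hi hk h :=
    hP.mono_left (by omega) (by omega) (by omega) (by omega) (by omega) h
  mono_left hi hj hl hjk hlk h :=
    hP.mono_right (by omega) (by omega) (by omega) (by omega) h
  cross {i j l c} hi hj h hl hc := by
    obtain ⟨a, b, p₁, p₂, p₃, p₄, p₅, p₆⟩ :=
      hP.cross (c := k - 2 - c) (by omega) (by omega) h (by omega) (by omega)
    refine ⟨k - 1 - b, k - 1 - a, by omega, by omega, by omega, ?_, ?_, fun i' hi' h₁ h₂ => ?_⟩
    · rwa [show k - 1 - (k - 1 - a) = a by omega]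
    · rwa [show k - 1 - (k - 1 - b) = b by omega]
    · rw [show k - 1 - (k - 1 - a) = a by omega, show k - 1 - (k - 1 - b) = b by omega]
      exact p₆ _ (by omega) (by omega) (by omega)

variable {h : ℕ → ℕ} (hh : IsHeight k P h)
include hh

/-- Let H be the height of `a₁`. Without H + 1, the vertex `a₁` is reached from `a₁ + 1`, by some
back edge b → a across `a₁`. Here b ≤ H because H + 1 is not crossed, and b = H because otherwise
the same route would avoid H. The edge H → a passes over `a₂` too, so `a₂ + 1` reaches `a₂` without
H + 1. -/
theorem height_le {a₁ a₂ i : ℕ} (h₁₂ : a₁ < a₂) (h₂ : a₂ < i) (hi : i ≤ h a₁) (hik : i < k) :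
    h a₂ ≤ h a₁ := by
  obtain ⟨h₁k, hbad₁⟩ := hh a₁ (by omega)
  obtain ⟨h₂k, hbad₂⟩ := hh a₂ (by omega)
  set H := h a₁ with hH
  by_cases hk : H + 1 < k
  swap
  · omega
  have hp : P (H + 1) (a₁ + 1) a₁ := by
    by_contra hn
    have := (hbad₁ (H + 1) hk (by omega)).1 hn
    omega
  obtain ⟨a, b, p₁, p₂, p₃, p₄, p₅, p₆⟩ := hP.cross hk (by omega) hp le_rfl (by omega)
  have hbH : b ≤ H := by
    by_contra! hbH
    rcases Nat.lt_or_eq_of_le hbH with h' | h'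
    · exact hP.blocked (by omega) h' p₃ p₄
    · exact hP.ne_right hk (by omega) p₃ p₄ h'.symm
  have hb : b = H := by
    by_contra hne
    refine (hbad₁ H h₁k (by omega)).2 le_rfl ?_
    refine hP.trans h₁k (b := b) (by omega) (by omega) (by omega)
      (hP.forward h₁k p₃ (by omega) (by omega)) ?_
    exact hP.trans h₁k (b := a) (by omega) (by omega) (by omega)
      (p₆ H h₁k (by omega) (by omega)) (hP.forward h₁k (by omega) p₁ (by omega))
  subst hb
  by_contra! hlt
  refine (hbad₂ (H + 1) hk (by omega)).2 hlt ?_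
  refine hP.trans hk (b := H) (by omega) (by omega) (by omega)
    (hP.forward hk p₃ (by omega) (by omega)) ?_
  exact hP.trans hk (b := a) (by omega) (by omega) (by omega)
    (p₆ _ hk (by omega) (by omega)) (hP.forward hk (by omega) (by omega) (by omega))

/-- Below a deleted position, reachability to the left is decided by a range maximum. -/
theorem reach_iff_le {i l q : ℕ} (hli : l < i) (hik : i < k)
    (hq : IsLeftmostMax h l (i - 1) q) {j : ℕ} (hlj : l ≤ j) (hji : j < i) :
    P i j l ↔ j ≤ q := by
  have hlq := hq.left_le
  have hqi := hq.le_right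
  -- The height of i - 1 is at least i, because deleting i removes the starting point of the step
  -- from i to i - 1.
  have hiq : i ≤ h q := by
    have h₁ : i ≤ h (i - 1) := by
      refine ((hh (i - 1) (by omega)).2 i hik (by omega)).1 fun hp => ?_
      exact hP.ne_left hik (by omega) (by omega) hp (by omega)
    exact h₁.trans (hq.le _ (by omega) le_rfl)
  -- A step blocked by i would give `h a ≥ i > q`, hence `h q ≤ h a` by nesting, although q is the
  -- leftmost maximum.
  have hstep : ∀ a, l ≤ a → a < q → P i (a + 1) a := by
    intro a hla haq
    by_contra hn
    have h₁ := ((hh a (by omega)).2 i hik (by omega)).1 hn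
    have h₂ := hP.height_le hh haq (by omega : q < i) h₁ hik
    have h₃ := hq.lt a hla haq
    omega
  have hql : ∀ x, l ≤ x → x ≤ q → P i x l := by
    intro x hx
    induction x, hx using Nat.le_induction with
    | base => exact fun _ => hP.refl hik (by omega) (by omega)
    | succ x hx ih =>
      intro hxq
      exact hP.trans hik (b := x) (by omega) (by omega) (by omega) (hstep x hx (by omega))
        (ih (by omega))
  refine ⟨fun hp => ?_, fun hjq => hql j hlj hjq⟩
  by_contra! hjq
  -- If some j > q reached l, then q + 1 → j → l → q would be a route without i, against `i ≤ h q`.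
  refine ((hh q (by omega)).2 i hik (by omega)).2 hiq ?_
  refine hP.trans hik (b := j) (by omega) (by omega) (by omega)
    (hP.forward hik (by omega) (by omega) (by omega)) ?_
  exact hP.trans hik (b := l) (by omega) (by omega) (by omega) hp
    (hP.forward hik (by omega) (by omega) (by omega))

omit hh in
/-- Above a deleted position, reachability to the left is decided by a range maximum. -/
theorem reach_iff_ge {h' : ℕ → ℕ}
    (hh' : IsHeight k (fun i j l => P (k - 1 - i) (k - 1 - l) (k - 1 - j)) h') {i j q : ℕ}
    (hij : i < j) (hjk : j < k) (hq : IsLeftmostMax h' (k - 1 - j) (k - 1 - i - 1) q) {l : ℕ}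
    (hil : i < l) (hlj : l ≤ j) : P i j l ↔ k - 1 - q ≤ l := by
  have := hP.mirror.reach_iff_le hh' (i := k - 1 - i) (l := k - 1 - j) (by omega) (by omega) hq
    (j := k - 1 - l) (by omega) (by omega)
  rw [show k - 1 - (k - 1 - i) = i by omega, show k - 1 - (k - 1 - j) = j by omega,
    show k - 1 - (k - 1 - l) = l by omega] at this
  have hq' := hq.le_right
  rw [this]
  omega

/-- Reachability to the left across a deleted position. -/
theorem reach_iff_across {h' : ℕ → ℕ}
    (hh' : IsHeight k (fun i j l => P (k - 1 - i) (k - 1 - l) (k - 1 - j)) h') {i j l q q' : ℕ}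
    (hli : l < i) (hij : i < j) (hjk : j < k)
    (hq : IsLeftmostMax h l (i - 1) q)
    (hq' : IsLeftmostMax h' (k - 1 - j) (k - 1 - i - 1) q') {low : ℕ}
    (hlow : ∀ i < k - 1 - q', low < i → P i (k - 1 - q') low)
    (hmin : ∀ x, (∀ i < k - 1 - q', x < i → P i (k - 1 - q') x) → low ≤ x) :
    P i j l ↔ low ≤ q := by
  have h₁ := hq.left_le
  have h₂ := hq.le_right
  have h₃ := hq'.left_le
  have h₄ := hq'.le_right
  set m := k - 1 - q' with hm
  have hik : i < k := by omega
  constructor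
  · intro hp
    -- The path jumps over i by an edge b → a with a < i < b. Here b is at least the first vertex m
    -- above i that j reaches.
    obtain ⟨a, b, p₁, p₂, p₃, p₄, p₅, p₆⟩ := hP.cross (c := i - 1) hik hjk hp (by omega) (by omega)
    have hbi := hP.ne_right hik hjk p₃ p₄
    have hmb : m ≤ b := by
      by_cases hbj : b ≤ j
      · exact (hP.reach_iff_ge hh' hij hjk hq' (by omega) hbj).1 p₄
      · omega
    -- From m one can go forward to b and take the edge to a, under deletion of any single vertex
    -- strictly between a and m.
    have hla : low ≤ a := by
      refine hmin a fun i' hi' hai => ?_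
      exact hP.trans (by omega) (b := b) (by omega) (by omega) (by omega)
        (hP.forward (by omega) p₃ hmb (by omega)) (p₆ i' (by omega) (by omega) (by omega))
    by_cases hal : l ≤ a
    · exact hla.trans ((hP.reach_iff_le hh hli hik hq hal (by omega)).1 p₅)
    · omega
  · intro hle
    -- The route without i is j → m → low → q → l, with low → q forward.
    refine hP.trans hik (b := m) (by omega) (by omega) (by omega)
      ((hP.reach_iff_ge hh' hij hjk hq' (by omega) (by omega)).2 le_rfl) ?_
    refine hP.trans hik (b := low) (by omega) (by omega) (by omega)
      (hlow i (by omega) (by omega)) ?_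
    refine hP.trans hik (b := q) (by omega) (by omega) (by omega)
      (hP.forward hik (by omega) hle (by omega)) ?_
    exact (hP.reach_iff_le hh hli hik hq h₁ (by omega)).2 le_rfl

omit hh in
theorem reach_iff_of_le {i j l : ℕ} (hi : i < k) (hl : l < k) (hjl : j ≤ l) :
    P i j l ↔ i < j ∨ l < i := by
  refine ⟨fun h => ?_, fun h => hP.forward hi hl hjl h⟩
  by_contra! hn
  rcases Nat.lt_or_eq_of_le hn.1 with h₁ | h₁
  · rcases Nat.lt_or_eq_of_le hn.2 with h₂ | h₂
    · exact hP.blocked h₁ h₂ hl h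
    · exact hP.ne_right hi (by omega) hl h h₂.symm
  · exact hP.ne_left hi (by omega) hl h h₁

end BackEdgeReach

/-! ### Range maxima in constant time -/

/-- The intervals may overlap. Ties must go to q, since the position sought is the leftmost one. -/
theorem IsLeftmostMax.union {h : ℕ → ℕ} {l m l' r q q' : ℕ} (hq : IsLeftmostMax h l m q)
    (hq' : IsLeftmostMax h l' r q') (hl : l ≤ l') (hm : l' ≤ m + 1) (hr : m ≤ r) :
    IsLeftmostMax h l r (if h q' ≤ h q then q else q') := by
  obtain ⟨a₁, a₂, a₃, a₄⟩ := hq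
  obtain ⟨b₁, b₂, b₃, b₄⟩ := hq'
  split
  · refine ⟨a₁, by omega, fun x hx hxr => ?_, a₄⟩
    by_cases hxm : x ≤ m
    · exact a₃ x hx hxm
    · have := b₃ x (by omega) hxr
      omega
  · refine ⟨by omega, b₂, fun x hx hxr => ?_, fun x hx hxq => ?_⟩
    · by_cases hxm : x ≤ m
      · have := a₃ x hx hxm
        omega
      · exact b₃ x (by omega) hxr
    · by_cases hxm : x ≤ m
      · have := a₃ x hx hxm
        omega
      · exact b₄ x (by omega) hxq

theorem exists_isLeftmostMax (h : ℕ → ℕ) {l r : ℕ} (hlr : l ≤ r) : ∃ q, IsLeftmostMax h l r q := by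
  induction r, hlr using Nat.le_induction with
  | base =>
    refine ⟨l, le_rfl, le_rfl, fun x h₁ h₂ => ?_, fun x h₁ h₂ => by omega⟩
    obtain rfl : x = l := by omega
    rfl
  | succ r hlr ih =>
    obtain ⟨q, hq⟩ := ih
    refine ⟨_, hq.union (l' := r + 1) (r := r + 1) (q' := r + 1)
      ⟨le_rfl, le_rfl, fun x h₁ h₂ => ?_, fun x h₁ h₂ => by omega⟩ (by omega) le_rfl (by omega)⟩
    obtain rfl : x = r + 1 := by omega
    rfl

/-! ### Correctness of the tables for range maxima -/

namespace WordRAM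

variable {I : Inst}

namespace Inst

theorem isLeftmostMax_argMax (e : ℕ) {l r : ℕ} (hlr : l ≤ r) :
    IsLeftmostMax (I.hgt e) l r (I.argMax e l r) := by
  obtain ⟨q, hq⟩ := exists_isLeftmostMax (I.hgt e) hlr
  have : I.argMax e l r = q := by
    refine least_eq (by have := hq.le_right; omega)
      ⟨hq.left_le, fun x hx hlx => hq.le x hlx (by omega)⟩ fun j hj hc => ?_
    have h₁ := hc.2 q (by have := hq.le_right; omega) hq.left_le
    have h₂ := hq.lt j hc.1 hj
    omega
  rwa [this]

theorem isHeight_hgt (e : ℕ) (hP : BackEdgeReach I.k (I.P e)) :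
    IsHeight I.k (I.P e) (I.hgt e) := by
  intro a ha
  obtain ⟨h₁, h₂, h₃⟩ := least_spec (b := I.k)
    (c := fun m => ∀ i < I.k, a < i → ¬ I.P e i (a + 1) a → i ≤ m)
    ⟨I.k - 1, by omega, fun i hi _ _ => by omega⟩
  refine ⟨h₁, fun i hi hai => ⟨h₂ i hi hai, fun hle hp => ?_⟩⟩
  have hne := hP.ne_left hi (by omega) (by omega) hp
  -- If deleting i is harmless, so is deleting anything later, because the route stays below i. Then
  -- i - 1 would already bound all harmful positions.
  refine h₃ (i - 1) (by change i ≤ I.hgt e a at hle; change _ < I.hgt e a; omega)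
    fun j hj haj hn => ?_
  by_contra! hij
  rcases Nat.lt_or_eq_of_le (show i ≤ j by omega) with h | h
  · exact hn (hP.mono_right (by omega) hai h hj hp)
  · exact hn (h ▸ hp)

theorem blk_pos : 0 < I.blk := Nat.succ_pos _

theorem two_pow_blk_le (hk : 0 < I.k) : 2 ^ I.blk ≤ 2 * I.k := by
  rw [blk, pow_succ, mul_comm]
  exact Nat.mul_le_mul_left 2 (Nat.pow_log_le_self 2 hk.ne')

theorem blk_le (hk : 0 < I.k) : I.blk ≤ I.k := Nat.log_lt_self 2 hk.ne'

theorem shiftRight_mod_two (m t : ℕ) : m >>> t % 2 = 1 ↔ m.testBit t = true := by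
  rw [Nat.testBit_eq_decide_div_mod_eq, Nat.shiftRight_eq_div_pow]
  simp

theorem mask_spec (hk : 0 < I.k) (e r : ℕ) : I.mask e r < 2 * I.k ∧
    ∀ t < I.blk, (I.mask e r >>> t % 2 = 1 ↔ (I.blk * (r / I.blk) + t ≤ r ∧
      ∀ q < r + 1, I.blk * (r / I.blk) + t ≤ q →
        I.hgt e q ≤ I.hgt e (I.blk * (r / I.blk) + t))) := by
  classical
  have := least_spec (b := 2 * I.k) (c := fun m => ∀ t < I.blk, (m >>> t % 2 = 1 ↔
    (I.blk * (r / I.blk) + t ≤ r ∧ ∀ q < r + 1, I.blk * (r / I.blk) + t ≤ q →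
        I.hgt e q ≤ I.hgt e (I.blk * (r / I.blk) + t)))) (by
      -- A mask has `blk` bits and `2 ^ blk ≤ 2 * k`, so the bounded search finds it, and it is
      -- small enough to index the table of least significant bits.
      refine ⟨Nat.ofBits (n := I.blk) fun t => decide (I.blk * (r / I.blk) + t ≤ r ∧
        ∀ q < r + 1, I.blk * (r / I.blk) + t ≤ q →
          I.hgt e q ≤ I.hgt e (I.blk * (r / I.blk) + t)),
        (Nat.ofBits_lt_two_pow _).trans_le (two_pow_blk_le hk), fun t ht => ?_⟩
      rw [shiftRight_mod_two, Nat.testBit_ofBits_lt _ _ ht, decide_eq_true_iff])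
  exact ⟨this.1, this.2.1⟩

theorem lsb_spec {v t : ℕ} (h : v >>> t % 2 = 1) :
    lsb v ≤ t ∧ v >>> lsb v % 2 = 1 ∧ ∀ j < lsb v, ¬ v >>> j % 2 = 1 := by
  have htv : t < v := by
    by_contra! hle
    rw [Nat.shiftRight_eq_div_pow, Nat.div_eq_of_lt (hle.trans_lt Nat.lt_two_pow_self)] at h
    omega
  obtain ⟨-, h₂, h₃⟩ := least_spec (b := v) (c := fun t => v >>> t % 2 = 1) ⟨t, htv, h⟩
  refine ⟨?_, h₂, h₃⟩
  by_contra! hlt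
  exact h₃ t hlt h

theorem pow_eq {t : ℕ} (ht : 2 ^ t ≤ I.k) : I.pow t = 2 ^ t := by
  refine least_eq (by omega) ?_ fun j hj => ?_
  · rw [Nat.shiftRight_eq_div_pow, Nat.div_self (by positivity)]
  · rw [Nat.shiftRight_eq_div_pow, Nat.div_eq_of_lt hj]
    omega

/-- The leftmost maximum of [l, r] is the first position from l on that is at least as high as
everything from it up to r. Shifting the mask by the offset of l in its block drops the earlier
positions. -/
theorem isLeftmostMax_of_mask (hk : 0 < I.k) (e : ℕ) {l r : ℕ} (hlr : l ≤ r)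
    (hb : l / I.blk = r / I.blk) :
    IsLeftmostMax (I.hgt e) l r (l + lsb (I.mask e r >>> (l % I.blk))) := by
  have hB : 0 < I.blk := blk_pos
  obtain ⟨-, hmask⟩ := mask_spec hk e r
  have hl := Nat.div_add_mod l I.blk
  have hr := Nat.div_add_mod r I.blk
  have hrB := Nat.mod_lt r hB
  rw [hb] at hl
  generalize hL : l % I.blk = L at *
  generalize hR : r % I.blk = R at *
  generalize hc : I.blk * (r / I.blk) = c at *
  -- The position r is itself a suffix maximum, so the shifted mask is nonzero.
  have h₀ : I.mask e r >>> L >>> (R - L) % 2 = 1 := by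
    rw [← Nat.shiftRight_add, hmask _ (by omega)]
    refine ⟨by omega, fun q hq hq' => ?_⟩
    obtain rfl : q = c + (L + (R - L)) := by omega
    rfl
  obtain ⟨h₁, h₂, h₃⟩ := lsb_spec h₀
  generalize lsb (I.mask e r >>> L) = t at *
  rw [← Nat.shiftRight_add, hmask _ (by omega)] at h₂
  obtain ⟨h₄, h₅⟩ := h₂
  rw [← add_assoc, hl] at h₄ h₅
  -- If an earlier x were as high, the leftmost maximum q before l + t would also be a suffix
  -- maximum, and its lower bit would be set.
  have hlt : ∀ x, l ≤ x → x < l + t → I.hgt e x < I.hgt e (l + t) := by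
    intro x hx hxt
    by_contra! hge
    obtain ⟨q, hq⟩ := exists_isLeftmostMax (I.hgt e) (l := l) (r := l + t - 1) (by omega)
    have hq₁ := hq.left_le
    have hq₂ := hq.le_right
    refine h₃ (q - l) (by omega) ?_
    rw [← Nat.shiftRight_add, hmask _ (by omega), show c + (L + (q - l)) = q by omega]
    refine ⟨by omega, fun y hy hqy => ?_⟩
    by_cases hyt : y < l + t
    · exact hq.le y (by omega) (by omega)
    · exact (h₅ y hy (by omega)).trans (hge.trans (hq.le x hx (by omega)))
  refine ⟨by omega, by omega, fun x hx hxr => ?_, hlt⟩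
  by_cases hxt : x < l + t
  · exact (hlt x hx hxt).le
  · exact h₅ x (by omega) (by omega)

end Inst

/-! ### The query -/

/-- The `r`-th entry of the `q`-th column of the oracle. -/
def entry (m : ℕ → ℕ) (q r : ℕ) : ℕ := m (18 * r + q)

/-- The memory `m` contains the oracle of `I`. -/
def HasOracle (I : Inst) (m : ℕ → ℕ) : Prop :=
  ∀ q < 18, ∀ r < 6 * I.k, entry m q r = I.col q r

def queryBlock (m : ℕ → ℕ) (e l r : ℕ) : ℕ :=
  l + entry m 8 (entry m (14 + e) r >>> (l % entry m 3 0))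

def querySparse (m : ℕ → ℕ) (e a b : ℕ) : ℕ :=
  entry m (16 + e) (a * (entry m 0 0 / entry m 3 0 + 1) + b)

def queryBetter (m : ℕ → ℕ) (e q q' : ℕ) : ℕ :=
  if entry m (12 + e) q' ≤ entry m (12 + e) q then q else q'

def queryMax (m : ℕ → ℕ) (e l r : ℕ) : ℕ :=
  if l / entry m 3 0 = r / entry m 3 0 then queryBlock m e l r
  else if r / entry m 3 0 = l / entry m 3 0 + 1 then
    queryBetter m e
      (queryBlock m e l (l / entry m 3 0 * entry m 3 0 + (entry m 3 0 - 1)))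
      (queryBlock m e (r / entry m 3 0 * entry m 3 0) r)
  else
    queryBetter m e
      (queryBetter m e
        (queryBlock m e l (l / entry m 3 0 * entry m 3 0 + (entry m 3 0 - 1)))
        (querySparse m e (entry m 9 (r / entry m 3 0 - l / entry m 3 0 - 1))
          (l / entry m 3 0 + 1)))
      (queryBetter m e
        (querySparse m e (entry m 9 (r / entry m 3 0 - l / entry m 3 0 - 1))
          (r / entry m 3 0 - entry m 10 (r / entry m 3 0 - l / entry m 3 0 - 1)))
        (queryBlock m e (r / entry m 3 0 * entry m 3 0) r))

namespace HasOracle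

variable {m : ℕ → ℕ} (hm : HasOracle I m)
include hm

theorem isLeftmostMax_queryBlock {e : ℕ} (he : e < 2) {l r : ℕ} (hlr : l ≤ r) (hr : r < I.k)
    (hb : l / I.blk = r / I.blk) : IsLeftmostMax (I.hgt e) l r (queryBlock m e l r) := by
  have h := Inst.isLeftmostMax_of_mask (I := I) (by omega) e hlr hb
  have hmask : entry m (14 + e) r = I.mask e r := by
    rw [hm _ (by omega) _ (by omega)]
    interval_cases e <;> simp [Inst.col]
  have hlt := (Inst.mask_spec (I := I) (by omega) e r).1
  have hle : I.mask e r >>> (l % I.blk) ≤ I.mask e r := by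
    rw [Nat.shiftRight_eq_div_pow]; exact Nat.div_le_self _ _
  rwa [queryBlock, hmask, hm 3 (by omega) 0 (by omega), show I.col 3 0 = I.blk by simp [Inst.col],
    hm 8 (by omega) _ (by omega), show ∀ v, I.col 8 v = Inst.lsb v by simp [Inst.col]]

theorem queryBetter_eq {e : ℕ} (he : e < 2) {q q' : ℕ} (hq : q < I.k) (hq' : q' < I.k) :
    queryBetter m e q q' = if I.hgt e q' ≤ I.hgt e q then q else q' := by
  have h : ∀ x < I.k, entry m (12 + e) x = I.hgt e x := fun x hx => by
    rw [hm _ (by omega) _ (by omega)]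
    interval_cases e <;> simp [Inst.col]
  rw [queryBetter, h q hq, h q' hq']

theorem isLeftmostMax_querySparse {e : ℕ} (he : e < 2) {a b : ℕ}
    (hab : (b + 2 ^ a) * I.blk ≤ I.k) :
    IsLeftmostMax (I.hgt e) (b * I.blk) ((b + 2 ^ a) * I.blk - 1) (querySparse m e a b) := by
  have hB : 0 < I.blk := Inst.blk_pos
  have h1 : 1 ≤ 2 ^ a := Nat.one_le_two_pow
  have hk : 0 < I.k := lt_of_lt_of_le (by positivity) hab
  have hbk : b + 2 ^ a ≤ I.k / I.blk := (Nat.le_div_iff_mul_le hB).2 hab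
  have h2k : 2 ^ a ≤ I.k := (Nat.le_add_left _ _).trans (hbk.trans (Nat.div_le_self _ _))
  have ha : a + 1 ≤ I.blk :=
    Nat.succ_le_succ ((Nat.le_log_iff_pow_le (by norm_num) hk.ne').2 h2k)
  -- There are at most `blk` exponents and `k / blk + 1` block numbers, so fewer than `k + blk + 1 ≤
  -- 2 * k + 1` rows are used.
  have hrow : a * (I.k / I.blk + 1) + b < 6 * I.k := by
    have h₁ : (a + 1) * (I.k / I.blk + 1) ≤ I.blk * (I.k / I.blk + 1) := Nat.mul_le_mul_right _ ha
    have h₂ := Nat.mul_div_le I.k I.blk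
    have h₃ := Inst.blk_le hk
    have h₄ : (a + 1) * (I.k / I.blk + 1) = a * (I.k / I.blk + 1) + (I.k / I.blk + 1) := by ring
    have h₅ : I.blk * (I.k / I.blk + 1) = I.blk * (I.k / I.blk) + I.blk := by ring
    omega
  have hcol : ∀ r, I.col (16 + e) r = I.sparse e r := fun r => by
    interval_cases e <;> simp [Inst.col]
  rw [querySparse, hm 3 (by omega) 0 (by omega), hm 0 (by omega) 0 (by omega),
    show I.col 3 0 = I.blk by simp [Inst.col], show I.col 0 0 = I.k by simp [Inst.col],
    hm _ (by omega) _ hrow, hcol, Inst.sparse]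
  rw [mul_comm a, Nat.mul_add_mod, Nat.mod_eq_of_lt (show b < I.k / I.blk + 1 by omega),
    Nat.mul_add_div (by omega), Nat.div_eq_of_lt (show b < I.k / I.blk + 1 by omega), add_zero,
    Inst.pow_eq h2k]
  refine Inst.isLeftmostMax_argMax e ?_
  have : (b + 2 ^ a) * I.blk = b * I.blk + 2 ^ a * I.blk := by ring
  have : 1 * 1 ≤ 2 ^ a * I.blk := Nat.mul_le_mul h1 hB
  omega

theorem isLeftmostMax_queryMax {e : ℕ} (he : e < 2) {l r : ℕ} (hlr : l ≤ r) (hr : r < I.k) :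
    IsLeftmostMax (I.hgt e) l r (queryMax m e l r) := by
  have hB : 0 < I.blk := Inst.blk_pos
  rw [queryMax, hm 3 (by omega) 0 (by omega), show I.col 3 0 = I.blk by simp [Inst.col]]
  have hl₁ := Nat.div_add_mod' l I.blk
  have hr₁ := Nat.div_add_mod' r I.blk
  have hl₂ := Nat.mod_lt l hB
  have hr₂ := Nat.mod_lt r hB
  have hle : l / I.blk ≤ r / I.blk := Nat.div_le_div_right hlr
  have hrk : r / I.blk ≤ r := Nat.div_le_self r I.blk
  have hdiv : ∀ x y, x < I.blk → (y * I.blk + x) / I.blk = y := fun x y hx => by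
    rw [add_comm, Nat.add_mul_div_right _ _ hB, Nat.div_eq_of_lt hx, zero_add]
  generalize hlb : l / I.blk = lb at *
  generalize hrb : r / I.blk = rb at *
  split
  · next h => exact hm.isLeftmostMax_queryBlock he hlr hr (by rw [hlb, hrb, h])
  next hne =>
  have hlt : (lb + 1) * I.blk ≤ rb * I.blk := Nat.mul_le_mul_right _ (by omega)
  rw [Nat.add_mul, one_mul] at hlt
  have hL := hm.isLeftmostMax_queryBlock he (l := l) (r := lb * I.blk + (I.blk - 1))
    (by omega) (by omega) (by rw [hlb, hdiv _ _ (by omega)])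
  have hR := hm.isLeftmostMax_queryBlock he (l := rb * I.blk) (r := r) (by omega) hr
    (by rw [hrb, Nat.mul_div_cancel _ hB])
  have hL₁ := hL.le_right
  have hR₁ := hR.le_right
  split
  · next h =>
    rw [hm.queryBetter_eq he (by omega) (by omega)]
    refine hL.union hR (by omega) ?_ (by omega)
    rw [h, Nat.add_mul]
    omega
  next hne' =>
  have hlen : rb - lb - 1 ≠ 0 := by omega
  have hlenk : rb - lb - 1 < I.k := by omega
  set len := rb - lb - 1 with hlen'
  -- Two runs of `2 ^ a` blocks, the largest power of two up to `len`, cover the `len` whole blocks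
  -- between the ends; they may overlap.
  have hlog := Nat.pow_log_le_self 2 hlen
  have hlog' := Nat.lt_pow_succ_log_self (b := 2) (by norm_num) len
  rw [pow_succ] at hlog'
  rw [hm 9 (by omega) _ (by omega), hm 10 (by omega) _ (by omega),
    show I.col 9 len = Nat.log 2 len by simp [Inst.col],
    show I.col 10 len = I.pow (Nat.log 2 len) by simp [Inst.col], Inst.pow_eq (by omega)]
  generalize Nat.log 2 len = a at *
  have hS : (lb + 1 + 2 ^ a) * I.blk ≤ rb * I.blk :=
    Nat.mul_le_mul_right _ (by omega)
  have hS' : (rb - 2 ^ a + 2 ^ a) * I.blk = rb * I.blk := by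
    rw [Nat.sub_add_cancel (by omega)]
  have h₁ := hm.isLeftmostMax_querySparse he (a := a) (b := lb + 1) (by omega)
  have h₂ := hm.isLeftmostMax_querySparse he (a := a) (b := rb - 2 ^ a) (by omega)
  have h₃ : (rb - 2 ^ a) * I.blk ≤ (lb + 1 + 2 ^ a) * I.blk :=
    Nat.mul_le_mul_right _ (by omega)
  have h₄ : (lb + 1) * I.blk ≤ (rb - 2 ^ a) * I.blk :=
    Nat.mul_le_mul_right _ (by omega)
  have h₅ : (lb + 2) * I.blk ≤ (lb + 1 + 2 ^ a) * I.blk :=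
    Nat.mul_le_mul_right _ (by have := Nat.one_le_two_pow (n := a); omega)
  have h₆ : (rb - 2 ^ a + 1) * I.blk ≤ (rb - 2 ^ a + 2 ^ a) * I.blk :=
    Nat.mul_le_mul_right _ (by have := Nat.one_le_two_pow (n := a); omega)
  have h₇ : (lb + 1) * I.blk = lb * I.blk + I.blk := by ring
  have h₈ : (lb + 2) * I.blk = lb * I.blk + I.blk + I.blk := by ring
  have h₁' := h₁.le_right
  have h₂' := h₂.le_right
  rw [hm.queryBetter_eq he (q := queryBlock m e l (lb * I.blk + (I.blk - 1)))
    (by omega) (by omega),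
    hm.queryBetter_eq he (q' := queryBlock m e (rb * I.blk) r) (by omega) (by omega)]
  have hl := hL.union h₁ (by omega) (by omega) (by omega)
  have hr := h₂.union hR (by omega) (by omega) (by omega)
  have hl' := hl.le_right
  have hr' := hr.le_right
  rw [hm.queryBetter_eq he (by omega) (by omega)]
  exact hl.union hr (by omega) (by omega) (by omega)

end HasOracle

end WordRAM

/-! ### Perfect hashing -/

section Hash

variable {p : ℕ}

/-- Two distinct keys collide for few multipliers. -/
theorem card_collisions_le (hp : p.Prime) {x y : ℕ} (hx : x < p) (hy : y < p) (hxy : x ≠ y)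
    {m : ℕ} (hm : 0 < m) : ((Finset.Icc 1 (p - 1)).filter fun a => a * x % p % m = a * y % p % m).card ≤
      2 * ((p - 1) / m) := by
  have : Fact p.Prime := ⟨hp⟩
  have hxy' : ((x : ZMod p) - y) ≠ 0 := by
    intro h
    rw [sub_eq_zero, ZMod.natCast_eq_natCast_iff', Nat.mod_eq_of_lt hx, Nat.mod_eq_of_lt hy] at h
    exact hxy h
  -- The two residues of a colliding pair differ by a nonzero multiple of m of absolute value at
  -- most p - 1, so there are 2K possible differences. Modulo p the difference is a(x - y), which
  -- determines a.
  set K : ℤ := (((p - 1) / m : ℕ) : ℤ) with hK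
  have hK0 : 0 ≤ K := Int.natCast_nonneg _
  have hcard : ((Finset.Icc (-K) K).erase 0).card = 2 * ((p - 1) / m) := by
    rw [Finset.card_erase_of_mem (by simp [hK0]), Int.card_Icc]
    omega
  have hmod : ∀ a : ℕ, ((((a * x % p : ℕ) : ℤ) - ((a * y % p : ℕ) : ℤ) : ℤ) : ZMod p) =
      a * ((x : ZMod p) - y) := by
    intro a
    push_cast [ZMod.natCast_mod]
    ring
  have hdvd : ∀ a : ℕ, a * x % p % m = a * y % p % m →
      (m : ℤ) ∣ ((a * x % p : ℕ) : ℤ) - ((a * y % p : ℕ) : ℤ) := by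
    intro a h
    exact (Nat.modEq_iff_dvd.1 (show a * y % p ≡ a * x % p [MOD m] from h.symm))
  have hinj : ∀ a b : ℕ, 1 ≤ a → a < p → 1 ≤ b → b < p → (a : ZMod p) = b → a = b := by
    intro a b _ ha _ hb h
    rwa [ZMod.natCast_eq_natCast_iff', Nat.mod_eq_of_lt ha, Nat.mod_eq_of_lt hb] at h
  rw [← hcard]
  refine Finset.card_le_card_of_injOn
    (fun a => (((a * x % p : ℕ) : ℤ) - ((a * y % p : ℕ) : ℤ)) / m) ?_ ?_
  · intro a ha
    simp only [Finset.coe_filter, Finset.mem_Icc, Set.mem_ofPred_eq] at ha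
    obtain ⟨⟨ha₁, ha₂⟩, ha₃⟩ := ha
    have hp2 := hp.two_le
    obtain ⟨d, hd⟩ := hdvd a ha₃
    have h₁ : (a * x % p) < p := Nat.mod_lt _ hp.pos
    have h₂ : (a * y % p) < p := Nat.mod_lt _ hp.pos
    have hd0 : d ≠ 0 := by
      rintro rfl
      have := hmod a
      rw [hd, mul_zero, Int.cast_zero, eq_comm, mul_eq_zero] at this
      rcases this with h | h
      · have := (ZMod.natCast_eq_zero_iff a p).1 h
        have := Nat.le_of_dvd (by omega) this
        omega
      · exact hxy' h
    simp only [Finset.coe_erase, Finset.coe_Icc, Set.mem_sdiff, Set.mem_Icc, Set.mem_singleton_iff]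
    rw [hd, Int.mul_ediv_cancel_left _ (by omega)]
    have habs : (m : ℤ) * |d| ≤ p - 1 := by
      rw [← abs_of_nonneg (show (0 : ℤ) ≤ m by omega), ← abs_mul, ← hd, abs_le]
      constructor <;> omega
    have hdK : |d| ≤ K := by
      rw [hK]
      push_cast
      rw [Int.le_ediv_iff_mul_le (by omega), mul_comm, Nat.cast_sub (by omega)]
      exact_mod_cast habs
    exact ⟨abs_le.1 hdK, hd0⟩
  · intro a ha b hb hab
    simp only [Finset.coe_filter, Finset.mem_Icc, Set.mem_ofPred_eq] at ha hb
    have hp2 := hp.two_le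
    have h := (Int.ediv_left_inj (hdvd a ha.2) (hdvd b hb.2)).1 hab
    refine hinj a b ha.1.1 (by omega) hb.1.1 (by omega) (mul_right_cancel₀ hxy' ?_)
    rw [← hmod, ← hmod, h]

theorem sum_collisions_le (hp : p.Prime) {T : Finset ℕ} (hT : ∀ x ∈ T, x < p) {m : ℕ}
    (hm : 0 < m) :
    ∑ a ∈ Finset.Icc 1 (p - 1),
      (T.offDiag.filter fun q => a * q.1 % p % m = a * q.2 % p % m).card ≤
      (T.card * T.card - T.card) * (2 * ((p - 1) / m)) := by
  rw [← Finset.offDiag_card, ← smul_eq_mul, ← Finset.sum_const]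
  calc _ = ∑ q ∈ T.offDiag, ((Finset.Icc 1 (p - 1)).filter fun a =>
        a * q.1 % p % m = a * q.2 % p % m).card :=
        Finset.sum_card_bipartiteAbove_eq_sum_card_bipartiteBelow _
    _ ≤ _ := Finset.sum_le_sum fun q hq => by
        rw [Finset.mem_offDiag] at hq
        exact card_collisions_le hp (hT _ hq.1) (hT _ hq.2.1) hq.2.2 hm

/-- Some multiplier has few collisions. -/
theorem exists_few_collisions (hp : p.Prime) {T : Finset ℕ} (hT : ∀ x ∈ T, x < p) :
    ∃ a < p, ((T ×ˢ T).filter fun q => a * q.1 % p % T.card = a * q.2 % p % T.card).card ≤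
      3 * T.card := by
  have hp2 := hp.two_le
  rcases T.eq_empty_or_nonempty with rfl | hne
  · exact ⟨0, by omega, by simp⟩
  -- Averaged over p - 1 multipliers, at most 2|T| ordered pairs of distinct keys collide; the
  -- diagonal adds |T|.
  obtain ⟨a, ha, h⟩ := Finset.exists_le_of_sum_le (s := Finset.Icc 1 (p - 1))
    (f := fun a => (T.offDiag.filter fun q => a * q.1 % p % T.card = a * q.2 % p % T.card).card)
    (g := fun _ => 2 * T.card) ⟨1, by simp; omega⟩ (by
      refine (sum_collisions_le hp hT hne.card_pos).trans ?_
      rw [Finset.sum_const, Nat.card_Icc, smul_eq_mul]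
      have h := Nat.mul_div_le (p - 1) T.card
      calc (T.card * T.card - T.card) * (2 * ((p - 1) / T.card))
          ≤ (T.card * T.card) * (2 * ((p - 1) / T.card)) :=
            Nat.mul_le_mul_right _ (Nat.sub_le _ _)
        _ = T.card * ((p - 1) / T.card) * (2 * T.card) := by ring
        _ ≤ (p - 1) * (2 * T.card) := Nat.mul_le_mul_right _ h
        _ = _ := by simp)
  rw [Finset.mem_Icc] at ha
  refine ⟨a, by omega, ?_⟩
  calc _ ≤ (T.diag ∪ T.offDiag.filter fun q =>
        a * q.1 % p % T.card = a * q.2 % p % T.card).card := by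
        refine Finset.card_le_card fun q hq => ?_
        simp only [Finset.mem_filter, Finset.mem_product, Finset.mem_union, Finset.mem_diag,
          Finset.mem_offDiag] at hq ⊢
        by_cases h : q.1 = q.2
        · exact .inl ⟨hq.1.1, h⟩
        · exact .inr ⟨⟨hq.1.1, hq.1.2, h⟩, hq.2⟩
    _ ≤ T.card + 2 * T.card := (Finset.card_union_le _ _).trans
        (Nat.add_le_add (Finset.diag_card T).le h)
    _ = 3 * T.card := by ring

/-- Some multiplier is injective into a table of quadratic size. -/
theorem exists_no_collision (hp : p.Prime) {T : Finset ℕ} (hT : ∀ x ∈ T, x < p) :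
    ∃ a < p, ∀ x ∈ T, ∀ y ∈ T, a * x % p % (2 * (T.card * T.card)) =
      a * y % p % (2 * (T.card * T.card)) → x = y := by
  have hp2 := hp.two_le
  rcases T.eq_empty_or_nonempty with rfl | hne
  · exact ⟨0, by omega, by simp⟩
  have hpos := hne.card_pos
  obtain ⟨a, ha, h⟩ := Finset.exists_lt_of_sum_lt (s := Finset.Icc 1 (p - 1))
    (f := fun a => (T.offDiag.filter fun q => a * q.1 % p % (2 * (T.card * T.card)) =
      a * q.2 % p % (2 * (T.card * T.card))).card)
    (g := fun _ => 1) (by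
      refine (sum_collisions_le hp hT (by positivity)).trans_lt ?_
      rw [Finset.sum_const, Nat.card_Icc, smul_eq_mul]
      generalize T.card = c at *
      have h := Nat.mul_div_le (p - 1) (2 * (c * c))
      generalize (p - 1) / (2 * (c * c)) = q at *
      -- With c keys, the total number of collisions is at most 2q(c² - c). For q > 0 this is less
      -- than 2qc² ≤ p - 1; for q = 0 it is 0 and p - 1 is positive. So some multiplier has none.
      rcases Nat.eq_zero_or_pos q with rfl | hq
      · simp; omega
      · have h₁ : 0 < c * (2 * q) := by positivity
        rw [Nat.sub_mul]
        have h₂ : c * (2 * q) ≤ c * c * (2 * q) :=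
          Nat.mul_le_mul_right _ (Nat.le_mul_of_pos_left _ hpos)
        have h₃ : 2 * (c * c) * q = c * c * (2 * q) := by ring
        omega)
  rw [Finset.mem_Icc] at ha
  refine ⟨a, by omega, fun x hx y hy hxy => ?_⟩
  by_contra hn
  have := Finset.card_eq_zero.1 (Nat.lt_one_iff.1 h)
  have h' : (x, y) ∈ T.offDiag.filter fun q => a * q.1 % p % (2 * (T.card * T.card)) =
      a * q.2 % p % (2 * (T.card * T.card)) := by
    simp [hx, hy, hn, hxy]
  rw [this] at h'
  simp at h'

end Hash

/-! ### The two-level hash table of the oracle -/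

namespace WordRAM.Inst

variable {I : Inst}

open Classical in
/-- The set of the marked vertices. -/
noncomputable def support (I : Inst) : Finset ℕ := (Finset.range I.n).filter I.C

theorem mem_support {v : ℕ} : v ∈ I.support ↔ I.C v := by
  simp only [support, Finset.mem_filter, Finset.mem_range, and_iff_right_iff_imp]
  exact fun h => h.1

theorem card_support : I.support.card = I.k := by
  classical
  rw [k, cnt_eq_card, support]

/-- By Bertrand's postulate the search finds a prime up to 2n; its condition is trial division. -/
theorem p_spec (hn : 0 < I.n) : I.p.Prime ∧ I.n < I.p := by
  obtain ⟨q, hq, h₁, h₂⟩ := Nat.exists_prime_lt_and_le_two_mul I.n hn.ne'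
  obtain ⟨-, ⟨h₃, h₄, h₅⟩, -⟩ := least_spec (b := 2 * I.n + 2)
    (c := fun q => I.n < q ∧ 2 ≤ q ∧ ∀ d < q, 2 ≤ d → q % d ≠ 0)
    ⟨q, by omega, h₁, hq.two_le, fun d hd hd2 h => by
      rcases (Nat.dvd_prime hq).1 (Nat.dvd_of_mod_eq_zero h) with h | h <;> omega⟩
  refine ⟨Nat.prime_def_lt'.2 ⟨h₄, fun d hd2 hd h => h₅ d hd hd2 ?_⟩, h₃⟩
  exact Nat.mod_eq_zero_of_dvd h

theorem lt_p_of_mem (hn : 0 < I.n) : ∀ x ∈ I.support, x < I.p := fun x hx => by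
  have := (mem_support.1 hx).1
  have := (I.p_spec hn).2
  omega

open Classical in
theorem sum_cnt_eq (f : ℕ → ℕ) :
    ∑ u ∈ Finset.range I.n, cnt I.n (fun v => I.C u ∧ I.C v ∧ f u = f v) =
      ((I.support ×ˢ I.support).filter fun q => f q.1 = f q.2).card := by
  rw [Finset.card_filter, Finset.sum_product, support, Finset.sum_filter]
  refine Finset.sum_congr rfl fun u _ => ?_
  rw [cnt]
  split
  · next h => rw [Finset.sum_filter]; exact Finset.sum_congr rfl fun v _ => by simp [h, ite_and]
  · next h => simp [h]

theorem mul₀_spec (hn : 0 < I.n) :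
    ((I.support ×ˢ I.support).filter fun q => I.bucket q.1 = I.bucket q.2).card ≤ 3 * I.k := by
  obtain ⟨a, ha, h⟩ := exists_few_collisions (I.p_spec hn).1 (I.lt_p_of_mem hn)
  obtain ⟨-, h₂, -⟩ := least_spec (b := I.p)
    (c := fun a => ∑ u ∈ Finset.range I.n, cnt I.n (fun v => I.C u ∧ I.C v ∧
      I.hash a I.k u = I.hash a I.k v) ≤ 3 * I.k) ⟨a, ha, by
        rw [sum_cnt_eq]
        rw [card_support] at h
        exact h⟩
  rw [sum_cnt_eq] at h₂
  exact h₂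

open Classical in
noncomputable def bucketSet (I : Inst) (b : ℕ) : Finset ℕ := I.support.filter (I.bucket · = b)

theorem size_eq (b : ℕ) : I.size b = 2 * ((I.bucketSet b).card * (I.bucketSet b).card) := by
  classical
  have : cnt I.n (fun u => I.C u ∧ I.bucket u = b) = (I.bucketSet b).card := by
    rw [cnt_eq_card, bucketSet, support, Finset.filter_filter]
  rw [size, this]

theorem mul_spec (hn : 0 < I.n) {b u v : ℕ} (hu : I.C u) (hv : I.C v) (hub : I.bucket u = b)
    (hvb : I.bucket v = b)
    (h : I.hash (I.mul b) (I.size b) u = I.hash (I.mul b) (I.size b) v) : u = v := by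
  classical
  obtain ⟨a, ha, h'⟩ := exists_no_collision (T := I.bucketSet b) (I.p_spec hn).1
    fun x hx => I.lt_p_of_mem hn x (Finset.mem_filter.1 hx).1
  rw [← size_eq] at h'
  obtain ⟨-, h₂, -⟩ := least_spec (b := I.p)
    (c := fun a => ∀ u < I.n, ∀ v < I.n, I.C u → I.C v → I.bucket u = b → I.bucket v = b →
      I.hash a (I.size b) u = I.hash a (I.size b) v → u = v) ⟨a, ha, by
        intro u _ v _ hu hv hub hvb h
        exact h' u (Finset.mem_filter.2 ⟨mem_support.2 hu, hub⟩) v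
          (Finset.mem_filter.2 ⟨mem_support.2 hv, hvb⟩) h⟩
  exact h₂ u hu.1 v hv.1 hu hv hub hvb h

theorem bucket_lt (hk : 0 < I.k) (v : ℕ) : I.bucket v < I.k := Nat.mod_lt _ hk

/-- The squared bucket sizes sum to the number of ordered colliding pairs, diagonal included, which
is at most 3k. Each bucket takes twice its squared size. -/
theorem offset_le (hn : 0 < I.n) (hk : 0 < I.k) : I.offset I.k ≤ 6 * I.k := by
  classical
  have h := I.mul₀_spec hn
  have h₁ : ((I.support ×ˢ I.support).filter fun q => I.bucket q.1 = I.bucket q.2).card =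
      ∑ b ∈ Finset.range I.k, (I.bucketSet b).card * (I.bucketSet b).card := by
    rw [Finset.card_eq_sum_card_fiberwise (f := fun q => I.bucket q.1) (t := Finset.range I.k)]
    · refine Finset.sum_congr rfl fun b _ => ?_
      rw [← Finset.card_product]
      congr 1
      ext q
      simp only [Finset.mem_filter, Finset.mem_product, bucketSet]
      constructor
      · rintro ⟨⟨⟨h₁, h₂⟩, h₃⟩, h₄⟩; exact ⟨⟨h₁, h₄⟩, h₂, h₃ ▸ h₄⟩
      · rintro ⟨⟨h₁, h₂⟩, h₃, h₄⟩; exact ⟨⟨⟨h₁, h₃⟩, h₂.trans h₄.symm⟩, h₂⟩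
    · intro q _
      simpa using bucket_lt hk q.1
  rw [offset]
  simp only [size_eq]
  rw [← Finset.mul_sum]
  omega

theorem hash_lt_size {v : ℕ} (hv : I.C v) :
    I.hash (I.mul (I.bucket v)) (I.size (I.bucket v)) v < I.size (I.bucket v) := by
  classical
  refine Nat.mod_lt _ ?_
  rw [size_eq]
  have : 0 < (I.bucketSet (I.bucket v)).card :=
    Finset.card_pos.2 ⟨v, Finset.mem_filter.2 ⟨mem_support.2 hv, rfl⟩⟩
  positivity

theorem offset_mono {a b : ℕ} (h : a ≤ b) : I.offset a ≤ I.offset b :=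
  Finset.sum_le_sum_of_subset (Finset.range_mono h)

theorem offset_succ (b : ℕ) : I.offset (b + 1) = I.offset b + I.size b :=
  Finset.sum_range_succ _ _

theorem slot_lt (hn : 0 < I.n) (hk : 0 < I.k) {v : ℕ} (hv : I.C v) : I.slot v < 6 * I.k := by
  have h₁ := hash_lt_size hv
  have h₂ := I.offset_mono (bucket_lt hk v : I.bucket v + 1 ≤ I.k)
  have h₃ := I.offset_le hn hk
  rw [offset_succ] at h₂
  rw [slot]
  omega

/-- Distinct buckets own disjoint intervals of slots, and within a bucket the second hash function
is injective. No keys need to be stored, since only members of C are queried. -/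
theorem slot_inj (hn : 0 < I.n) {u v : ℕ} (hu : I.C u) (hv : I.C v) (h : I.slot u = I.slot v) :
    u = v := by
  have h₁ := hash_lt_size hu
  have h₂ := hash_lt_size hv
  rw [slot, slot] at h
  rcases Nat.lt_trichotomy (I.bucket u) (I.bucket v) with hlt | heq | hlt
  · have := I.offset_mono (show I.bucket u + 1 ≤ I.bucket v from hlt)
    rw [offset_succ] at this
    omega
  · rw [heq] at h
    exact mul_spec hn hu hv heq rfl (by omega)
  · have := I.offset_mono (show I.bucket v + 1 ≤ I.bucket u from hlt)
    rw [offset_succ] at this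
    omega

theorem posAt_slot (hn : 0 < I.n) {v : ℕ} (hv : I.C v) : I.posAt (I.slot v) = I.pos v := by
  rw [posAt, least_eq (m := v) hv.1 ⟨hv, rfl⟩ fun j hj h => ?_]
  have := slot_inj hn h.1 hv h.2
  omega

end WordRAM.Inst

namespace WordRAM

/-! ### Loops that fill the memory -/

/-- Here a loop may overwrite memory that later rounds read, which `Comp` does not allow; J is the
loop invariant on memory. Register 3 holds the counter and register 4 the bound. -/
theorem exists_storeLoop (b a v : State → ℕ) [hb : StraightLine b] [ha : StraightLine a]
    [hv : StraightLine v] : ∃ p : Cmd, ∀ A, ∃ K, ∀ N σ w (J : ℕ → (ℕ → ℕ) → Prop), 2 ≤ N →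
      N ^ K ≤ 2 ^ w → Bounded N A σ → b σ < N ^ A → (∀ j μ, J j μ → ∀ a, μ a < N ^ A) →
      J 0 σ.mem →
      (∀ j μ τ, j < b σ → J j μ →
        τ = ⟨Function.update (Function.update σ.reg 4 (b σ)) 3 j, μ⟩ →
        J (j + 1) (Function.update μ (a τ) (v τ))) →
      ∃ τ, Run w p σ (N ^ K) τ ∧
        τ.reg = Function.update (Function.update σ.reg 4 (b σ)) 3 (b σ) ∧ J (b σ) τ.mem := by
  obtain ⟨eb, heb⟩ := hb.out
  obtain ⟨ea, hea⟩ := ha.out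
  obtain ⟨ev, hev⟩ := hv.out
  refine ⟨.seq (.assign 4 eb) (forCmd 3 4 (.store ea ev)), fun A => ?_⟩
  obtain ⟨Kb, hKb⟩ := heb A
  obtain ⟨Ka, hKa⟩ := hea A
  obtain ⟨Kv, hKv⟩ := hev A
  set c := eb.cost + ea.cost + ev.cost + 16 with hc
  refine ⟨Kb + Ka + Kv + A + c, fun N σ w J hN hw hB hbA hJ h0 hs => ?_⟩
  have hle : ∀ k ≤ Kb + Ka + Kv + A + c, N ^ k ≤ 2 ^ w := fun k hk =>
    (Nat.pow_le_pow_right (by omega) hk).trans hw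
  have hw1 : 1 ≤ w := by
    rcases Nat.eq_zero_or_pos w with h | h
    · subst h
      have := hle 1 (by omega)
      rw [pow_one, pow_zero] at this
      omega
    · exact h
  have hbd : ∀ j μ, j ≤ b σ → J j μ →
      Bounded N A ⟨Function.update (Function.update σ.reg 4 (b σ)) 3 j, μ⟩ := by
    refine fun j μ hj hμ => ⟨fun r => ?_, hJ j μ hμ⟩
    by_cases h3 : r = 3
    · subst h3; simpa using hj.trans_lt hbA
    by_cases h4 : r = 4
    · subst h4; simpa using hbA
    · simpa [h3, h4] using hB.1 r
  obtain ⟨τ, hτ, hI, hJτ⟩ := run_forCmd (w := w) (i := 3) (b := 4) (m := b σ)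
    (B := ea.cost + ev.cost + 1) (body := .store ea ev) (σ := σ.set 4 (b σ))
    (fun j τ => τ.reg = Function.update (Function.update σ.reg 4 (b σ)) 3 j ∧ J j τ.mem)
    (hbA.trans_le (hle _ (by omega))) hw1 (fun j τ h => by rw [h.1]; simp) ⟨rfl, h0⟩ (by
      rintro j ⟨ρ, μ⟩ hj ⟨rfl, hμ⟩
      refine ⟨_, Run.store ((hKa N _ hN (hbd j μ hj.le hμ)).2 w (hle _ (by omega)))
        ((hKv N _ hN (hbd j μ hj.le hμ)).2 w (hle _ (by omega))), by simp, ?_,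
        hs j μ _ hj hμ rfl⟩
      simp [State.set])
  refine ⟨τ, (Run.seq (Run.assign ((hKb N σ hN hB).2 w (hle _ (by omega)))) hτ).mono ?_, hI, hJτ⟩
  have h₁ : c < N ^ c := lit_lt_pow hN
  have h₂ : N ^ A ≤ N ^ (Kb + Ka + Kv + A) := Nat.pow_le_pow_right (by omega) (by omega)
  have h₃ : (b σ + 1) * c ≤ N ^ (Kb + Ka + Kv + A) * N ^ c :=
    Nat.mul_le_mul (by omega) h₁.le
  rw [pow_add _ _ c]
  refine le_trans ?_ h₃
  have h₄ : b σ * (ea.cost + ev.cost + 1 + 8) ≤ b σ * c := Nat.mul_le_mul_left _ (by omega)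
  have h₅ : (b σ + 1) * c = b σ * c + c := by ring
  omega

/-! ### Reachability without a vertex, by the Floyd-Warshall algorithm -/

/-- Nontrivial reachability along `E` through intermediate points below `K` other than `x`. -/
def Through (E : ℕ → ℕ → Prop) (x : ℕ) : ℕ → ℕ → ℕ → Prop
  | 0, u, v => E u v
  | K + 1, u, v => Through E x K u v ∨ K ≠ x ∧ Through E x K u K ∧ Through E x K K v

/-- By induction on K. If both parts pass through the newest point, the loop between the two visits
is cut out. -/
theorem Through.trans {E : ℕ → ℕ → Prop} {x m : ℕ} (hm : m ≠ x) : ∀ {K u v : ℕ}, m < K →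
    Through E x K u m → Through E x K m v → Through E x K u v := by
  intro K
  induction K with
  | zero => intro u v h; omega
  | succ K ih =>
    intro u v hmK h h'
    rcases Nat.lt_or_eq_of_le (Nat.le_of_lt_succ hmK) with hlt | rfl
    · rcases h with h | ⟨hK, h₁, h₂⟩ <;> rcases h' with h' | ⟨hK', h₁', h₂'⟩
      · exact .inl (ih hlt h h')
      · exact .inr ⟨hK', ih hlt h h₁', h₂'⟩
      · exact .inr ⟨hK, h₁, ih hlt h₂ h'⟩
      · exact .inr ⟨hK, h₁, h₂'⟩
    · refine .inr ⟨hm, ?_, ?_⟩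
      · exact h.elim id fun h => h.2.1
      · exact h'.elim id fun h => h.2.2

theorem Through.of_edge {E : ℕ → ℕ → Prop} {x u v : ℕ} (h : E u v) : ∀ K, Through E x K u v
  | 0 => h
  | K + 1 => .inl (Through.of_edge h K)

theorem Through.of_path {E : ℕ → ℕ → Prop} {n x u v : ℕ} (h : Relation.ReflTransGen
    (fun a b => (E a b ∧ a < n ∧ b < n) ∧ a ≠ x ∧ b ≠ x) u v) : u = v ∨ Through E x n u v := by
  induction h with
  | refl => exact .inl rfl
  | @tail b c _ hbc ih =>
    rcases ih with rfl | ih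
    · exact .inr (.of_edge hbc.1.1 n)
    · exact .inr (ih.trans hbc.2.1 hbc.1.2.1 (.of_edge hbc.1.1 n))

theorem mul_add_inj {n a b c d : ℕ} (hb : b < n) (hd : d < n) (h : a * n + b = c * n + d) :
    a = c ∧ b = d := by
  have hn : 0 < n := by omega
  have h₁ := congrArg (· / n) h
  have h₂ := congrArg (· % n) h
  simp only [mul_comm _ n, Nat.mul_add_div hn, Nat.div_eq_of_lt hb, Nat.div_eq_of_lt hd,
    Nat.mul_add_mod, Nat.mod_eq_of_lt hb, Nat.mod_eq_of_lt hd, add_zero] at h₁ h₂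
  exact ⟨h₁, h₂⟩

theorem mul_add_lt {n a b c : ℕ} (hb : b < n) (hac : a < c) : a * n + b < c * n := by
  have : (a + 1) * n ≤ c * n := Nat.mul_le_mul_right n hac
  rw [Nat.add_mul] at this
  omega

/-- The input of the Floyd-Warshall algorithm, in `mem`, has been turned into its output, in `μ`. -/
structure IsClosureTable (n : ℕ) (mem μ : ℕ → ℕ) : Prop where
  input : ∀ a < n * n + n, μ a = mem a
  le_one : ∀ a, μ a ≤ 1
  iff : ∀ x < n, ∀ u < n, ∀ v < n, u ≠ x → v ≠ x →
    (u = v ∨ μ (n * n + n + ((x * n + u) * n + v)) = 1 ↔ Relation.ReflTransGen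
      (fun a b => (mem (a * n + b) = 1 ∧ a < n ∧ b < n) ∧ a ≠ x ∧ b ≠ x) u v)

def fwIndex (n x u v : ℕ) : ℕ := n * n + n + ((x * n + u) * n + v)

def fwX (σ : State) : ℕ := σ.reg 3 / (σ.reg 0 * σ.reg 0 * σ.reg 0)
def fwK (σ : State) : ℕ := σ.reg 3 / (σ.reg 0 * σ.reg 0) % σ.reg 0
def fwU (σ : State) : ℕ := σ.reg 3 / σ.reg 0 % σ.reg 0
def fwV (σ : State) : ℕ := σ.reg 3 % σ.reg 0

theorem fw_decode {n j : ℕ} (hj : j < n * n * n * n) :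
    ∃ x < n, ∃ k < n, ∃ u < n, ∃ v < n, j = ((x * n + k) * n + u) * n + v ∧
      j / (n * n * n) = x ∧ j / (n * n) % n = k ∧ j / n % n = u ∧ j % n = v := by
  have hn : 0 < n := by
    rcases Nat.eq_zero_or_pos n with rfl | h
    · simp at hj
    · exact h
  refine ⟨j / (n * n * n), Nat.div_lt_of_lt_mul hj, j / (n * n) % n, Nat.mod_lt _ hn,
    j / n % n, Nat.mod_lt _ hn, j % n, Nat.mod_lt _ hn, ?_, rfl, rfl, rfl, rfl⟩
  rw [← Nat.div_div_eq_div_mul, ← Nat.div_div_eq_div_mul, Nat.div_add_mod', Nat.div_add_mod',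
    Nat.div_add_mod']

/-- One loop over the numbers below n⁴ encodes the four loops over the deleted vertex x, the
intermediate k, and the pair u, v. The table is updated in place: entries never return to 0, and
every 1 stands for a true path, so reading entries already updated in the same round does no harm.
-/
theorem exists_closure : ∃ p : Cmd, ∃ K, ∀ N σ w n, 2 ≤ N → N ^ K ≤ 2 ^ w → n < N →
    σ.reg 0 = n → (∀ r, σ.reg r < N) → (∀ a, σ.mem a ≤ 1) →
    ∃ τ, Run w p σ (N ^ K) τ ∧ τ.reg 0 = n ∧ τ.reg 1 = σ.reg 1 ∧ (∀ r, τ.reg r < N ^ 5) ∧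
      IsClosureTable n σ.mem τ.mem := by
  obtain ⟨p₁, h₁⟩ := exists_storeLoop (fun σ => σ.reg 0 * σ.reg 0 * σ.reg 0)
    (fun σ => σ.reg 0 * σ.reg 0 + σ.reg 0 + σ.reg 3)
    (fun σ => σ.mem (σ.reg 3 % (σ.reg 0 * σ.reg 0)))
  obtain ⟨p₂, h₂⟩ := by
    have := exists_storeLoop (fun σ => σ.reg 0 * σ.reg 0 * σ.reg 0 * σ.reg 0)
      (fun σ => fwIndex (σ.reg 0) (fwX σ) (fwU σ) (fwV σ))
      (fun σ => if σ.mem (fwIndex (σ.reg 0) (fwX σ) (fwU σ) (fwV σ)) = 1 ∨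
        (fwK σ ≠ fwX σ ∧ σ.mem (fwIndex (σ.reg 0) (fwX σ) (fwU σ) (fwK σ)) = 1 ∧
          σ.mem (fwIndex (σ.reg 0) (fwX σ) (fwK σ) (fwV σ)) = 1) then 1 else 0)
      (ha := by unfold fwIndex fwX fwU fwV; infer_instance)
      (hv := by unfold fwIndex fwX fwK fwU fwV; infer_instance)
    exact this
  -- The exponent 5 covers the counters, which run up to n³ and n⁴.
  obtain ⟨K₁, h₁⟩ := h₁ 5
  obtain ⟨K₂, h₂⟩ := h₂ 5
  refine ⟨.seq p₁ p₂, K₁ + K₂ + 1, fun N σ w n hN hw hnN hn hreg hmem => ?_⟩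
  have hle : ∀ k ≤ K₁ + K₂ + 1, N ^ k ≤ 2 ^ w := fun k hk =>
    (Nat.pow_le_pow_right (by omega) hk).trans hw
  have hN5 : N ≤ N ^ 5 := Nat.le_self_pow (by norm_num) N
  have hn3 : n * n * n < N ^ 5 := by
    calc n * n * n < N * N * N := by gcongr
      _ = N ^ 3 := by ring
      _ ≤ N ^ 5 := Nat.pow_le_pow_right (by omega) (by norm_num)
  have hn4 : n * n * n * n < N ^ 5 := by
    calc n * n * n * n < N * N * N * N := by gcongr
      _ = N ^ 4 := by ring
      _ ≤ N ^ 5 := Nat.pow_le_pow_right (by omega) (by norm_num)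
  -- the tables are initialized with the adjacency matrix
  obtain ⟨τ, hτ, hτr, hτi, hτ1, hτc⟩ := h₁ N σ w (fun j μ => (∀ a < n * n + n, μ a = σ.mem a) ∧
      (∀ a, μ a ≤ 1) ∧ ∀ c < j, μ (n * n + n + c) = σ.mem (c % (n * n))) hN (hle _ (by omega))
    ⟨fun r => (hreg r).trans_le hN5, fun a => by have := hmem a; omega⟩
    (by simpa only [hn] using hn3) (fun j μ h a => by have := h.2.1 a; omega)
    ⟨fun a _ => rfl, hmem, fun c hc => by omega⟩ (by
      rintro j μ τ hj ⟨hi, h1, hc⟩ rfl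
      simp only [hn] at hj
      have hnn : 0 < n * n := by
        rcases Nat.eq_zero_or_pos (n * n) with h | h
        · simp [h] at hj
        · exact h
      have hv := hi (j % (n * n)) ((Nat.mod_lt _ hnn).trans_le (by omega))
      simp only [Function.update_self, ne_eq, not_false_eq_true, Function.update_of_ne, show (0 : ℕ) ≠ 3 by norm_num, show (0 : ℕ) ≠ 4 by norm_num, hn, hv]
      refine ⟨fun a ha => ?_, fun a => ?_, fun c hc' => ?_⟩
      · rw [Function.update_of_ne (by omega), hi a ha]
      · by_cases h : a = n * n + n + j
        · rw [h, Function.update_self]; exact hmem _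
        · rw [Function.update_of_ne h]; exact h1 a
      · by_cases h : c = j
        · rw [h, Function.update_self]
        · rw [Function.update_of_ne (by omega)]; exact hc c (by omega))
  simp only [hn] at hτr hτc
  have hτ0 : τ.reg 0 = n := by rw [hτr]; simpa using hn
  have hτreg : ∀ r, τ.reg r < N ^ 5 := by
    intro r
    rw [hτr]
    by_cases h3 : r = 3
    · subst h3; simpa using hn3
    by_cases h4 : r = 4
    · subst h4; simpa using hn3
    · simpa [h3, h4] using (hreg r).trans_le hN5
  set E : ℕ → ℕ → Prop := fun a b => σ.mem (a * n + b) = 1 with hE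
  set S : ℕ → ℕ → ℕ → Prop := fun x => Relation.ReflTransGen
      (fun a b => (E a b ∧ a < n ∧ b < n) ∧ a ≠ x ∧ b ≠ x) with hS
  have hinj : ∀ {x u v x' u' v'}, u < n → v < n → u' < n → v' < n →
      fwIndex n x u v = fwIndex n x' u' v' → x = x' ∧ u = u' ∧ v = v' := by
    intro x u v x' u' v' hu hv hu' hv' h
    obtain ⟨h₁, h₂⟩ := mul_add_inj hv hv' (Nat.add_left_cancel h)
    obtain ⟨h₃, h₄⟩ := mul_add_inj hu hu' h₁
    exact ⟨h₃, h₄, h₂⟩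
  -- the rounds of the algorithm
  obtain ⟨ρ, hρ, hρr, hρi, hρ1, hρs, hρe, hρc⟩ := h₂ N τ w (fun j μ =>
      (∀ a < n * n + n, μ a = σ.mem a) ∧ (∀ a, μ a ≤ 1) ∧
      (∀ x < n, ∀ u < n, ∀ v < n, u ≠ x → v ≠ x → μ (fwIndex n x u v) = 1 → S x u v) ∧
      (∀ x < n, ∀ u < n, ∀ v < n, E u v → μ (fwIndex n x u v) = 1) ∧
      (∀ x < n, ∀ u < n, ∀ v < n, ∀ k < n, ((x * n + k) * n + u) * n + v < j →
        Through E x (k + 1) u v → μ (fwIndex n x u v) = 1)) hN (hle _ (by omega))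
    ⟨hτreg, fun a => by have := hτ1 a; omega⟩ (by simpa only [hτ0] using hn4)
    (fun j μ h a => by have := h.2.1 a; omega)
    (by
      have hinit : ∀ x < n, ∀ u < n, ∀ v < n,
          τ.mem (fwIndex n x u v) = σ.mem (u * n + v) := by
        intro x hx u hu v hv
        rw [fwIndex, hτc _ (mul_add_lt hv (mul_add_lt hu hx))]
        congr 1
        rw [show (x * n + u) * n + v = (n * n) * x + (u * n + v) by ring, Nat.mul_add_mod]
        exact Nat.mod_eq_of_lt (mul_add_lt hv hu)
      refine ⟨hτi, hτ1, fun x hx u hu v hv hux hvx h => ?_, fun x hx u hu v hv h => ?_,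
        fun x _ u _ v _ k _ h => by omega⟩
      · rw [hinit x hx u hu v hv] at h
        exact .single ⟨⟨h, hu, hv⟩, hux, hvx⟩
      · rw [hinit x hx u hu v hv]; exact h)
    (by
      rintro j μ τ' hj ⟨hi, h1, hs, he, hc⟩ hτ'
      simp only [hτ0] at hj
      obtain ⟨x, hx, k, hk, u, hu, v, hv, hjx, d₁, d₂, d₃, d₄⟩ := fw_decode hj
      have hτ'0 : τ'.reg 0 = n := by rw [hτ']; simpa using hτ0
      have hτ'3 : τ'.reg 3 = j := by rw [hτ']; simp
      have hτ'm : τ'.mem = μ := by rw [hτ']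
      have e₁ : fwX τ' = x := by rw [fwX, hτ'0, hτ'3, d₁]
      have e₂ : fwK τ' = k := by rw [fwK, hτ'0, hτ'3, d₂]
      have e₃ : fwU τ' = u := by rw [fwU, hτ'0, hτ'3, d₃]
      have e₄ : fwV τ' = v := by rw [fwV, hτ'0, hτ'3, d₄]
      rw [hτ'0, e₁, e₂, e₃, e₄, hτ'm]
      set new := if μ (fwIndex n x u v) = 1 ∨ (k ≠ x ∧ μ (fwIndex n x u k) = 1 ∧
        μ (fwIndex n x k v) = 1) then 1 else 0 with hnew
      have hmono : ∀ a, μ a = 1 → Function.update μ (fwIndex n x u v) new a = 1 := by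
        intro a ha
        by_cases h : a = fwIndex n x u v
        · subst h; rw [Function.update_self, hnew, if_pos (.inl ha)]
        · rw [Function.update_of_ne h, ha]
      refine ⟨fun a ha => ?_, fun a => ?_, fun x' hx' u' hu' v' hv' hux hvx h => ?_,
        fun x' hx' u' hu' v' hv' h => hmono _ (he x' hx' u' hu' v' hv' h),
        fun x' hx' u' hu' v' hv' k' hk' hlt h => ?_⟩
      · rw [Function.update_of_ne (by rw [fwIndex]; omega), hi a ha]
      · by_cases h : a = fwIndex n x u v
        · rw [h, Function.update_self, hnew]; split <;> omega
        · rw [Function.update_of_ne h]; exact h1 a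
      · by_cases hidx : fwIndex n x' u' v' = fwIndex n x u v
        · obtain ⟨rfl, rfl, rfl⟩ := hinj hu' hv' hu hv hidx
          rw [Function.update_self, hnew] at h
          split at h
          · next hor =>
            rcases hor with h' | ⟨hkx, h', h''⟩
            · exact hs _ hx _ hu _ hv hux hvx h'
            · exact (hs _ hx _ hu _ hk hux hkx h').trans (hs _ hx _ hk _ hv hkx hvx h'')
          · omega
        · rw [Function.update_of_ne hidx] at h
          exact hs x' hx' u' hu' v' hv' hux hvx h
      · by_cases hlt' : ((x' * n + k') * n + u') * n + v' < j
        · exact hmono _ (hc x' hx' u' hu' v' hv' k' hk' hlt' h)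
        · obtain ⟨e₅, rfl⟩ := mul_add_inj hv' hv
            (show ((x' * n + k') * n + u') * n + v' = ((x * n + k) * n + u) * n + v by omega)
          obtain ⟨e₆, rfl⟩ := mul_add_inj hu' hu e₅
          obtain ⟨rfl, rfl⟩ := mul_add_inj hk' hk e₆
          -- entries from the previous round
          have hprev : ∀ a < n, ∀ b < n, Through E x' k' a b → μ (fwIndex n x' a b) = 1 := by
            intro a ha b hb h
            cases k' with
            | zero => exact he x' hx a ha b hb h
            | succ k' =>
              refine hc x' hx a ha b hb k' (by omega) ?_ h
              rw [hjx]
              have h₁ : (x' * n + k') * n + a < (x' * n + (k' + 1)) * n := mul_add_lt ha (by omega)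
              have h₂ := mul_add_lt hb h₁
              have h₃ : (x' * n + (k' + 1)) * n * n ≤ ((x' * n + (k' + 1)) * n + u') * n :=
                Nat.mul_le_mul_right n (by omega)
              omega
          rw [Function.update_self, hnew, if_pos]
          rcases h with h | ⟨h₁, h₂, h₃⟩
          · exact .inl (hprev _ hu _ hv h)
          · exact .inr ⟨h₁, hprev _ hu _ hk h₂, hprev _ hk _ hv h₃⟩)
  simp only [hτ0] at hρr hρc
  refine ⟨ρ, (hτ.seq hρ).mono ?_, ?_, ?_, fun r => ?_, hρi, hρ1,
    fun x hx u hu v hv hux hvx => ?_⟩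
  · have g₁ : N ^ K₁ ≤ N ^ (K₁ + K₂) := Nat.pow_le_pow_right (by omega) (by omega)
    have g₂ : N ^ K₂ ≤ N ^ (K₁ + K₂) := Nat.pow_le_pow_right (by omega) (by omega)
    have g₃ : N ^ (K₁ + K₂) * 2 ≤ N ^ (K₁ + K₂ + 1) := by
      rw [pow_succ]; exact Nat.mul_le_mul_left _ hN
    omega
  · rw [hρr]; simpa using hτ0
  · rw [hρr, hτr]; simp
  · rw [hρr]
    by_cases h3 : r = 3
    · subst h3; simpa using hn4
    by_cases h4 : r = 4
    · subst h4; simpa using hn4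
    · simpa [h3, h4] using hτreg r
  · constructor
    · rintro (rfl | h)
      · exact .refl
      · exact hρs x hx u hu v hv hux hvx h
    · intro h
      refine (Through.of_path h).imp id fun h => ?_
      -- The last round, with intermediate n - 1, admits all intermediate vertices.
      obtain ⟨n, rfl⟩ : ∃ n', n = n' + 1 := ⟨n - 1, by omega⟩
      refine hρc x hx u hu v hv n (by omega) ?_ h
      refine mul_add_lt hv ?_
      refine mul_add_lt hu ?_
      exact mul_add_lt (by omega) hx

end WordRAM

namespace WordRAM

/-! ### Writing the oracle -/

/-- The words are written from address `lim` on, behind the table, so the table stays readable while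
they are computed. Their number is 18 columns times 6k rows. -/
theorem exists_output : ∃ p : Cmd, ∀ A, ∃ K, ∀ N (I : Inst) σ w, Bdd N A I →
    Rep (fun _ => 3) I σ → N ^ K ≤ 2 ^ w →
    (∃ τ, Run w p σ (N ^ K) τ ∧ τ.output = (List.range (108 * I.k)).map I.word) ∧
      ∀ i < 108 * I.k, I.word i < N ^ K := by
  have hc : Comp fun γ : Inst => 108 * (Ctx.inst γ).k := inferInstance
  have hd : Comp fun q : Inst × ℕ => (Ctx.inst q).word q.2 := inferInstance
  obtain ⟨p, hp⟩ := hc.prog (fun _ => 3) 4 (by norm_num) (fun _ _ => by norm_num)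
  obtain ⟨q, hq⟩ := hd.prog (Function.update (fun _ => 3) 0 3) 5 (by norm_num) (fun i _ => by
    by_cases h : i = 0
    · subst h; simp
    · simp [h])
  refine ⟨.seq p (.seq (forCmd 3 4 (.seq q (.store (.bin .add (.reg 2) (.reg 3)) (.reg 5))))
    (.seq (.assign 0 (.reg 4)) (.assign 1 (.reg 2)))), fun A => ?_⟩
  obtain ⟨K₁, hK₁⟩ := hc.bound A
  obtain ⟨K₂, hK₂⟩ := hd.bound (A + K₁)
  obtain ⟨K₃, hK₃⟩ := hp A
  obtain ⟨K₄, hK₄⟩ := hq (A + K₁)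
  refine ⟨A + K₁ + K₂ + K₃ + K₄ + 5, fun N I σ w hB hR hw => ?_⟩
  have hN := hB.two_le
  have hle : ∀ k ≤ A + K₁ + K₂ + K₃ + K₄ + 5, N ^ k ≤ 2 ^ w := fun k hk =>
    (Nat.pow_le_pow_right (by omega) hk).trans hw
  have hb : 108 * I.k < N ^ K₁ := hK₁ N I hB
  have hb' : N ^ K₁ ≤ N ^ (A + K₁) := Nat.pow_le_pow_right (by omega) (by omega)
  have hBi : ∀ i < 108 * I.k, Bdd N (A + K₁) (I, i) := fun i hi =>
    (hB.mono (by omega)).pair (by omega)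
  have hword : ∀ i < 108 * I.k, I.word i < N ^ K₂ := fun i hi => hK₂ N (I, i) (hBi i hi)
  refine ⟨?_, fun i hi => (hword i hi).trans_le (Nat.pow_le_pow_right (by omega) (by omega))⟩
  have hw1 : 1 ≤ w := by
    rcases Nat.eq_zero_or_pos w with h | h
    · subst h
      have := hle 1 (by omega)
      rw [pow_one, pow_zero] at this
      omega
    · exact h
  have hlim : I.lim < N ^ A := hB.lim_le
  have hlim2 : N ^ A + N ^ K₁ ≤ 2 ^ w := by
    have h₁ : N ^ A ≤ N ^ (A + K₁) := Nat.pow_le_pow_right (by omega) (by omega)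
    have h₂ : N ^ (A + K₁) * 2 ≤ N ^ (A + K₁ + 1) := by
      rw [pow_succ]; exact Nat.mul_le_mul_left _ hN
    have := hle (A + K₁ + 1) (by omega)
    omega
  obtain ⟨τ, hτ, hτm, hτr, hτ4⟩ := hK₃ N I σ w hB hR (hle _ (by omega))
  obtain ⟨ρ, hρ, hρr, hρ4, -, hρm, hρo⟩ := run_forCmd (w := w) (i := 3) (b := 4) (m := 108 * I.k)
    (B := N ^ K₄ + 5) (σ := τ)
    (body := .seq q (.store (.bin .add (.reg 2) (.reg 3)) (.reg 5)))
    (fun j ρ => (∀ r < 3, ρ.reg r = σ.reg r) ∧ ρ.reg 4 = 108 * I.k ∧ ρ.reg 3 = j ∧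
      (∀ a < I.lim, ρ.mem a = I.cell a) ∧ ∀ i < j, ρ.mem (I.lim + i) = I.word i)
    (hb.trans_le (hle _ (by omega))) hw1 (fun j ρ h => ⟨h.2.2.1, h.2.1⟩)
    ⟨fun r hr => by rw [State.set_reg_of_ne _ _ (by omega), hτr r (by omega)],
      by rw [State.set_reg_of_ne _ _ (by omega)]; exact hτ4, State.set_reg_self _ _ _,
      fun a ha => by rw [State.set_mem, hτm]; exact hR.cell_eq a ha, fun i hi => by omega⟩
    (by
      rintro j ρ hj ⟨h₁, h₂, h₃, h₄, h₅⟩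
      have hRj : Rep (fun _ => 3) I ρ := ⟨(h₁ 0 (by norm_num)).trans hR.n_eq,
        (h₁ 1 (by norm_num)).trans hR.s_eq, (h₁ 2 (by norm_num)).trans hR.lim_eq, h₄,
        hR.cell_zero, fun i hi => by simp only [Ctx.arity] at hi; omega⟩
      obtain ⟨ρ', hρ', hm, hr, hv⟩ := hK₄ N (I, j) ρ w (hBi j hj) (hRj.pair h₃) (hle _ (by omega))
      have h2 : ρ'.reg 2 = I.lim := by
        rw [hr 2 (by norm_num), h₁ 2 (by norm_num)]; exact hR.lim_eq
      have h3 : ρ'.reg 3 = j := by rw [hr 3 (by norm_num), h₃]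
      have hE : (Exp.bin .add (.reg 2) (.reg 3)).eval w ρ' = I.lim + j := by
        simp only [Exp.eval, Op.eval, h2, h3]
        exact Nat.mod_eq_of_lt (by omega)
      refine ⟨_, (hρ'.seq (Run.store (e₂ := .reg 5) hE hv)).mono (by simp [Exp.cost]), h3, fun r hr' => ?_, ?_,
        State.set_reg_self _ _ _, fun a ha => ?_, fun i hi => ?_⟩
      · rw [State.set_reg_of_ne _ _ (by omega)]
        change ρ'.reg r = _
        rw [hr r (by omega), h₁ r hr']
      · rw [State.set_reg_of_ne _ _ (by omega)]
        change ρ'.reg 4 = _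
        rw [hr 4 (by omega), h₂]
      · rw [State.set_mem]
        change Function.update ρ'.mem _ _ a = _
        rw [Function.update_of_ne (by omega), hm, h₄ a ha]
      · rw [State.set_mem]
        change Function.update ρ'.mem _ _ _ = _
        by_cases h : i = j
        · rw [h, Function.update_self]; rfl
        · rw [Function.update_of_ne (by omega), hm, h₅ i (by omega)])
  have hρ2 : ρ.reg 2 = I.lim := (hρr 2 (by norm_num)).trans hR.lim_eq
  refine ⟨(ρ.set 0 (108 * I.k)).set 1 I.lim, (hτ.seq (hρ.seq ((Run.assign (by simpa [Exp.eval]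
    using hρ4)).seq (Run.assign (by
      simp only [Exp.eval]
      rw [State.set_reg_of_ne _ _ (by norm_num), hρ2]))))).mono ?_, ?_⟩
  · have g₁ : N ^ K₃ ≤ N ^ (A + K₁ + K₂ + K₃ + K₄) := Nat.pow_le_pow_right (by omega) (by omega)
    have g₂ : N ^ K₁ * N ^ K₄ ≤ N ^ (A + K₁ + K₂ + K₃ + K₄) := by
      rw [← pow_add]; exact Nat.pow_le_pow_right (by omega) (by omega)
    have g₃ : 1 ≤ N ^ K₄ := Nat.one_le_pow _ _ (by omega)
    have g₄ : 32 ≤ N ^ 5 := Nat.pow_le_pow_left hN 5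
    have g₅ : 1 ≤ N ^ (A + K₁ + K₂ + K₃ + K₄) := Nat.one_le_pow _ _ (by omega)
    have g₆ : 108 * I.k * (N ^ K₄ + 5 + 8) ≤ 14 * (N ^ K₁ * N ^ K₄) := by
      calc 108 * I.k * (N ^ K₄ + 5 + 8) ≤ N ^ K₁ * (14 * N ^ K₄) :=
            Nat.mul_le_mul hb.le (by omega)
        _ = _ := by ring
    rw [pow_add _ _ 5]
    simp only [Exp.cost]
    nlinarith
  · rw [State.output, State.set_reg_self, State.set_reg_of_ne _ _ (by norm_num),
      State.set_reg_self]
    refine List.map_congr_left fun i hi => ?_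
    exact hρo i (List.mem_range.1 hi)

/-! ### Answering queries -/

def queryPos (m : ℕ → ℕ) (x : ℕ) : ℕ :=
  entry m 7 (entry m 5 (entry m 2 0 * x % entry m 1 0 % entry m 0 0) +
    entry m 4 (entry m 2 0 * x % entry m 1 0 % entry m 0 0) * x % entry m 1 0 %
      entry m 6 (entry m 2 0 * x % entry m 1 0 % entry m 0 0))

/-- The last three cases are: deleted position above both ends, below both ends, and strictly
between them. Column 11 is the table of `low`. -/
def queryReach (m : ℕ → ℕ) (i j l : ℕ) : ℕ :=
  if i = j ∨ i = l then 0
  else if j ≤ l then (if i < j ∨ l < i then 1 else 0)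
  else if j < i then (if j ≤ queryMax m 0 l (i - 1) then 1 else 0)
  else if i < l then
    (if entry m 0 0 - 1 - queryMax m 1 (entry m 0 0 - 1 - j) (entry m 0 0 - 1 - i - 1) ≤ l
      then 1 else 0)
  else
    (if entry m 11
        (entry m 0 0 - 1 - queryMax m 1 (entry m 0 0 - 1 - j) (entry m 0 0 - 1 - i - 1)) ≤
          queryMax m 0 l (i - 1)
      then 1 else 0)

def queryAnswer (m : ℕ → ℕ) (x y z : ℕ) : ℕ :=
  queryReach m (queryPos m x) (queryPos m y) (queryPos m z)

section

variable (f g h : State → ℕ) [StraightLine f] [StraightLine g] [StraightLine h]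

instance : StraightLine fun σ => entry σ.mem (f σ) (g σ) := by
  unfold entry; infer_instance
instance (e : ℕ) : StraightLine fun σ => queryBlock σ.mem e (f σ) (g σ) := by
  unfold queryBlock; infer_instance
instance (e : ℕ) : StraightLine fun σ => querySparse σ.mem e (f σ) (g σ) := by
  unfold querySparse; infer_instance
instance (e : ℕ) : StraightLine fun σ => queryBetter σ.mem e (f σ) (g σ) := by
  unfold queryBetter; infer_instance
set_option synthInstance.maxHeartbeats 200000 in
set_option synthInstance.maxSize 2000 in
instance (e : ℕ) : StraightLine fun σ => queryMax σ.mem e (f σ) (g σ) := by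
  unfold queryMax; infer_instance
instance : StraightLine fun σ => queryPos σ.mem (f σ) := by
  unfold queryPos; infer_instance
instance : StraightLine fun σ => queryReach σ.mem (f σ) (g σ) (h σ) := by
  unfold queryReach; infer_instance
instance : StraightLine fun σ => queryAnswer σ.mem (f σ) (g σ) (h σ) := by
  unfold queryAnswer; infer_instance

end

namespace HasOracle

variable {I : Inst} {m : ℕ → ℕ} (hm : HasOracle I m)
include hm

theorem queryPos_eq (hn : 0 < I.n) (hk : 0 < I.k) {v : ℕ} (hv : I.C v) :
    queryPos m v = I.pos v := by
  have hb : entry m 2 0 * v % entry m 1 0 % entry m 0 0 = I.bucket v := by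
    rw [hm 2 (by omega) 0 (by omega), hm 1 (by omega) 0 (by omega), hm 0 (by omega) 0 (by omega)]
    rfl
  have hlt := Inst.bucket_lt hk v
  rw [queryPos, hb, hm 5 (by omega) _ (by omega), hm 4 (by omega) _ (by omega),
    hm 6 (by omega) _ (by omega), hm 1 (by omega) _ (by omega)]
  change entry m 7 (I.slot v) = _
  rw [hm 7 (by omega) _ (Inst.slot_lt hn hk hv)]
  change I.posAt (I.slot v) = _
  rw [Inst.posAt_slot hn hv]

theorem queryReach_eq (hP : BackEdgeReach I.k (I.P 0)) {i j l : ℕ} (hi : i < I.k) (hj : j < I.k)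
    (hl : l < I.k) [Decidable (I.P 0 i j l)] :
    queryReach m i j l = if I.P 0 i j l then 1 else 0 := by
  have hP1 : I.P 1 = fun i j l => I.P 0 (I.k - 1 - i) (I.k - 1 - l) (I.k - 1 - j) := by
    funext i j l
    simp [Inst.P]
  have h0 := Inst.isHeight_hgt 0 hP
  have h1 := Inst.isHeight_hgt (I := I) 1 (hP1 ▸ hP.mirror)
  rw [hP1] at h1
  rw [queryReach, hm 0 (by omega) 0 (by omega), show I.col 0 0 = I.k by simp [Inst.col]]
  split
  · next h =>
    rw [if_neg]
    intro hp
    rcases h with h | h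
    · exact hP.ne_left hi hj hl hp h.symm
    · exact hP.ne_right hi hj hl hp h.symm
  next hne =>
  split
  · next hjl => simp only [hP.reach_iff_of_le hi hl hjl]
  next hjl =>
  split
  · next hji =>
    have hq := hm.isLeftmostMax_queryMax (e := 0) (l := l) (r := i - 1) (by omega) (by omega)
      (by omega)
    simp only [hP.reach_iff_le h0 (by omega) hi hq (by omega) hji]
  next hji =>
  have hq' := hm.isLeftmostMax_queryMax (e := 1) (l := I.k - 1 - j) (r := I.k - 1 - i - 1)
    (by omega) (by omega) (by omega)
  split
  · next hil => simp only [hP.reach_iff_ge h1 (by omega) hj hq' hil (by omega)]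
  next hil =>
  have hq := hm.isLeftmostMax_queryMax (e := 0) (l := l) (r := i - 1) (by omega) (by omega)
      (by omega)
  have hq₁ := hq'.left_le
  have hq₂ := hq'.le_right
  generalize queryMax m 1 (I.k - 1 - j) (I.k - 1 - i - 1) = q' at *
  -- The position just before m = k - 1 - q' qualifies vacuously, so the search defining `low`
  -- succeeds.
  obtain ⟨-, g₂, g₃⟩ := least_spec (b := I.k)
    (c := fun l => ∀ i < I.k - 1 - q', l < i → I.P 0 i (I.k - 1 - q') l)
    ⟨I.k - 1 - q' - 1, by omega, fun i hi hi' => by omega⟩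
  rw [hm 11 (by omega) _ (by omega),
    show I.col 11 (I.k - 1 - q') = I.low (I.k - 1 - q') by simp [Inst.col]]
  simp only [hP.reach_iff_across h0 h1 (by omega) (by omega) hj hq hq' (low := I.low (I.k - 1 - q'))
    g₂ fun x hx => by
      by_contra! hlt
      exact g₃ x hlt hx]

end HasOracle

end WordRAM

namespace WordRAM

/-! ### The positions of the cut-vertices -/

/-- The data `I` describe the set `C` of vertices of `G` and reachability in the digraphs `G - x`. -/
structure Models {n : ℕ} (G : Digraph (Fin n)) (s : Fin n) (C : Finset (Fin n)) (I : Inst) :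
    Prop where
  n_eq : I.n = n
  s_eq : I.s = s
  C_iff : ∀ v : Fin n, I.C v ↔ v ∈ C
  R_iff : ∀ x u v : Fin n, I.R x u v ↔ HasPathAvoiding G x u v

namespace Models

variable {n : ℕ} {G : Digraph (Fin n)} {s t : Fin n} {C : Finset (Fin n)} {I : Inst}
  (hM : Models G s C I)
include hM

theorem exists_fin {v : ℕ} (hv : I.C v) : ∃ u : Fin n, u ∈ C ∧ (u : ℕ) = v := by
  have h := hv.1
  rw [hM.n_eq] at h
  exact ⟨⟨v, h⟩, (hM.C_iff ⟨v, h⟩).1 hv, rfl⟩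

theorem k_eq : I.k = C.card := by
  rw [← Inst.card_support, ← Finset.card_map Fin.valEmbedding]
  congr 1
  ext v
  simp only [Inst.mem_support, Finset.mem_map, Fin.valEmbedding_apply]
  exact ⟨hM.exists_fin, by rintro ⟨u, hu, rfl⟩; exact (hM.C_iff u).2 hu⟩

open Classical in
theorem pos_eq (v : Fin n) :
    I.pos v = (C.filter fun u => HasPathAvoiding G v s u).card := by
  rw [Inst.pos, cnt_eq_card, ← Finset.card_map Fin.valEmbedding]
  congr 1
  ext u
  simp only [Finset.mem_filter, Finset.mem_range, Finset.mem_map, Fin.valEmbedding_apply]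
  constructor
  · rintro ⟨-, hu, hR⟩
    obtain ⟨u, huC, rfl⟩ := hM.exists_fin hu
    rw [hM.s_eq, hM.R_iff] at hR
    exact ⟨u, ⟨huC, hR⟩, rfl⟩
  · rintro ⟨u, ⟨hu, hR⟩, rfl⟩
    refine ⟨by rw [hM.n_eq]; exact u.2, (hM.C_iff u).2 hu, ?_⟩
    rwa [hM.s_eq, hM.R_iff]

theorem pos_lt_k {v : Fin n} (hv : v ∈ C) : I.pos v < I.k := by
  classical
  rw [hM.pos_eq, hM.k_eq]
  refine Finset.card_lt_card (Finset.filter_ssubset.2 ⟨v, hv, fun h => h.2.1 rfl⟩)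

variable (hst : HasPath G s t) (hC : ∀ v ∈ C, IsCutVertex G s t v)
include hst hC

/-- Whatever precedes u precedes v by transitivity, and u itself precedes v but not u. -/
theorem pos_lt_pos {u v : Fin n} (hu : u ∈ C) (h : HasPathAvoiding G v s u) :
    I.pos u < I.pos v := by
  classical
  rw [hM.pos_eq, hM.pos_eq]
  refine Finset.card_lt_card ⟨fun w hw => ?_, fun hsub => ?_⟩
  · rw [Finset.mem_filter] at hw ⊢
    exact ⟨hw.1, (hC w hw.1).trans hst (hC u hu) hw.2 h⟩
  · have := hsub (Finset.mem_filter.2 ⟨hu, h⟩)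
    exact (Finset.mem_filter.1 this).2.2.1 rfl

theorem pos_inj {u v : Fin n} (hu : u ∈ C) (hv : v ∈ C) (h : I.pos u = I.pos v) : u = v := by
  by_contra hne
  rcases (hC u hu).total hst hne with h' | h'
  · have := hM.pos_lt_pos hst hC hu h'
    omega
  · have := hM.pos_lt_pos hst hC hv h'
    omega

theorem vert_pos {v : Fin n} (hv : v ∈ C) : I.vert (I.pos v) = v := by
  refine least_eq (by rw [hM.n_eq]; exact v.2) ⟨(hM.C_iff v).2 hv, rfl⟩ fun j hj h => ?_
  obtain ⟨u, hu, rfl⟩ := hM.exists_fin h.1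
  have := hM.pos_inj hst hC hu hv h.2
  subst this
  omega

/-- Positions are injective on C and lie below k = |C|, so all of them occur. -/
theorem exists_pos_eq {i : ℕ} (hi : i < I.k) : ∃ v : Fin n, v ∈ C ∧ I.pos v = i := by
  have h : C.image (fun v : Fin n => I.pos v) = Finset.range I.k := by
    refine Finset.eq_of_subset_of_card_le (fun i hi => ?_) ?_
    · obtain ⟨v, hv, rfl⟩ := Finset.mem_image.1 hi
      exact Finset.mem_range.2 (hM.pos_lt_k hv)
    · rw [Finset.card_image_of_injOn fun u hu v hv h => hM.pos_inj hst hC hu hv h,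
        Finset.card_range, hM.k_eq]
  have := Finset.mem_range.2 hi
  rw [← h] at this
  obtain ⟨v, hv, h⟩ := Finset.mem_image.1 this
  exact ⟨v, hv, h⟩

theorem backEdgeReach : BackEdgeReach I.k (I.P 0) := by
  have : Nonempty (Fin n) := ⟨s⟩
  choose! f hfC hf using fun i (hi : i < I.k) => hM.exists_pos_eq hst hC hi
  have hvert : ∀ i < I.k, I.vert i = f i := fun i hi => by
    have := hM.vert_pos hst hC (hfC i hi)
    rwa [hf i hi] at this
  have hB := backEdgeReach_hasPathAvoiding (C := (C : Set (Fin n))) (k := I.k) (f := f) hst hC hfC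
    (fun c hc => ⟨I.pos c, hM.pos_lt_k hc, hM.pos_inj hst hC (hfC _ (hM.pos_lt_k hc)) hc
      (hf _ (hM.pos_lt_k hc))⟩)
    (fun i j hij hj => by
      have hne : f i ≠ f j := fun h => by
        have h₁ := hf i (hij.trans hj)
        rw [h, hf j hj] at h₁
        omega
      rcases (hC _ (hfC i (hij.trans hj))).total hst hne with h | h
      · exact h
      · have := hM.pos_lt_pos hst hC (hfC j hj) h
        rw [hf j hj, hf i (hij.trans hj)] at this
        omega)
  have hiff : ∀ i j l, i < I.k → j < I.k → l < I.k →
      (I.P 0 i j l ↔ HasPathAvoiding G (f i) (f j) (f l)) := fun i j l hi hj hl => by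
    rw [← hM.R_iff, ← hvert i hi, ← hvert j hj, ← hvert l hl]
    simp [Inst.P]
  exact hB.congr hiff

theorem P_pos_iff {x y z : Fin n} (hx : x ∈ C) (hy : y ∈ C) (hz : z ∈ C) :
    I.P 0 (I.pos x) (I.pos y) (I.pos z) ↔ HasPathAvoiding G x y z := by
  rw [← hM.R_iff, ← hM.vert_pos hst hC hx, ← hM.vert_pos hst hC hy, ← hM.vert_pos hst hC hz]
  simp only [Inst.P, if_true, hM.vert_pos hst hC hx, hM.vert_pos hst hC hy,
    hM.vert_pos hst hC hz]

theorem queryAnswer_eq {m : ℕ → ℕ} (hm : HasOracle I m) {x y z : Fin n} (hx : x ∈ C)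
    (hy : y ∈ C) (hz : z ∈ C) [Decidable (HasPathAvoiding G x y z)] :
    queryAnswer m x y z = if HasPathAvoiding G x y z then 1 else 0 := by
  classical
  have hn : 0 < I.n := by rw [hM.n_eq]; exact x.pos
  have hk : 0 < I.k := (Nat.zero_le _).trans_lt (hM.pos_lt_k hx)
  rw [queryAnswer, hm.queryPos_eq hn hk ((hM.C_iff x).2 hx),
    hm.queryPos_eq hn hk ((hM.C_iff y).2 hy), hm.queryPos_eq hn hk ((hM.C_iff z).2 hz),
    hm.queryReach_eq (hM.backEdgeReach hst hC) (hM.pos_lt_k hx) (hM.pos_lt_k hy) (hM.pos_lt_k hz)]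
  simp only [hM.P_pos_iff hst hC hx hy hz]

end Models

/-! ### The preprocessing program -/

theorem inputState_adj {n : ℕ} (G : Digraph (Fin n)) (s t : Fin n) (C : Finset (Fin n))
    (u v : Fin n) : (inputState G s t C).mem (u * n + v) = 1 ↔ G.Adj u v := by
  simp only [inputState, ite_eq_left_iff, zero_ne_one, imp_false, not_not]
  constructor
  · rintro (⟨u', v', h, hA⟩ | ⟨v', -, h⟩)
    · obtain ⟨h₁, h₂⟩ := mul_add_inj v.2 v'.2 h
      rwa [Fin.ext h₁, Fin.ext h₂]
    · have := mul_add_lt v.2 u.2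
      omega
  · exact fun h => .inl ⟨u, v, rfl, h⟩

theorem inputState_mark {n : ℕ} (G : Digraph (Fin n)) (s t : Fin n) (C : Finset (Fin n))
    (v : Fin n) : (inputState G s t C).mem (n * n + v) = 1 ↔ v ∈ C := by
  simp only [inputState, ite_eq_left_iff, zero_ne_one, imp_false, not_not]
  constructor
  · rintro (⟨u', v', h, -⟩ | ⟨v', hv', h⟩)
    · have := mul_add_lt v'.2 u'.2
      omega
    · rwa [Fin.ext (by omega : (v : ℕ) = v')]
  · exact fun h => .inr ⟨v, h, rfl⟩

/-- The instance whose table is contained in the memory `μ`. -/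
def tableInst (n s : ℕ) (μ : ℕ → ℕ) : Inst where
  n := n
  s := s
  lim := n * n + n + n * n * n
  cell a := if a < n * n + n + n * n * n then μ a else 0

theorem models_tableInst {n : ℕ} {G : Digraph (Fin n)} {s t : Fin n} {C : Finset (Fin n)}
    {μ : ℕ → ℕ} (hμ : IsClosureTable n (inputState G s t C).mem μ) :
    Models G s C (tableInst n s μ) where
  n_eq := rfl
  s_eq := rfl
  C_iff v := by
    have h := v.2
    simp only [Inst.C, tableInst]
    rw [if_pos (by omega), hμ.input _ (by omega), inputState_mark]
    exact and_iff_right h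
  R_iff x u v := by
    have h : (x * n + u) * n + (v : ℕ) < n * n * n := mul_add_lt v.2 (mul_add_lt u.2 x.2)
    simp only [Inst.R, tableInst]
    rw [if_pos (by omega)]
    constructor
    · rintro ⟨hu, hv, hR⟩
      rw [hμ.iff x x.2 u u.2 v v.2 hu hv] at hR
      refine ⟨fun h => hu (by rw [h]), fun h => hv (by rw [h]), ?_⟩
      have key : ∀ b : ℕ, Relation.ReflTransGen (fun a b =>
          ((inputState G s t C).mem (a * n + b) = 1 ∧ a < n ∧ b < n) ∧ a ≠ x ∧ b ≠ x) u b →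
          ∃ b' : Fin n, (b' : ℕ) = b ∧
            Relation.ReflTransGen (fun a b => G.Adj a b ∧ a ≠ x ∧ b ≠ x) u b' := by
        intro b hb
        induction hb with
        | refl => exact ⟨u, rfl, .refl⟩
        | @tail b c _ hbc ih =>
          obtain ⟨b', rfl, ih⟩ := ih
          refine ⟨⟨c, hbc.1.2.2⟩, rfl, ih.tail ⟨(inputState_adj G s t C b' ⟨c, _⟩).1 hbc.1.1,
            fun h => hbc.2.1 (by rw [h]), fun h => hbc.2.2 (by rw [← h])⟩⟩
      obtain ⟨b', hb', h'⟩ := key v hR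
      rwa [← Fin.ext hb']
    · rintro ⟨hu, hv, hR⟩
      have hu' : (u : ℕ) ≠ x := fun h => hu (Fin.ext h)
      have hv' : (v : ℕ) ≠ x := fun h => hv (Fin.ext h)
      refine ⟨hu', hv', (hμ.iff x x.2 u u.2 v v.2 hu' hv').2 ?_⟩
      clear hv hv' h
      induction hR with
      | refl => exact .refl
      | @tail b c _ hbc ih =>
        exact ih.tail ⟨⟨(inputState_adj G s t C b c).2 hbc.1, b.2, c.2⟩,
          fun h => hbc.2.1 (Fin.ext h), fun h => hbc.2.2 (Fin.ext h)⟩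

theorem exists_build : ∃ build : Cmd, ∃ K, ∀ (n : ℕ) (G : Digraph (Fin n)) (s t : Fin n)
    (C : Finset (Fin n)) (N w : ℕ), 2 ≤ N → n < N → N ^ K ≤ 2 ^ w → ∃ I τ, Models G s C I ∧
      Run w build (inputState G s t C) (N ^ K) τ ∧
      τ.output = (List.range (108 * I.k)).map I.word ∧ ∀ i < 108 * I.k, I.word i < N ^ K := by
  obtain ⟨p, K₁, hp⟩ := exists_closure
  obtain ⟨q, hq⟩ := exists_output
  obtain ⟨K₂, hq⟩ := hq 5
  have hl : StraightLine fun σ => σ.reg 0 * σ.reg 0 + σ.reg 0 + σ.reg 0 * σ.reg 0 * σ.reg 0 :=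
    inferInstance
  obtain ⟨e, he⟩ := hl.out
  obtain ⟨K₃, he⟩ := he 5
  refine ⟨.seq p (.seq (.assign 2 e) q), K₁ + K₂ + K₃ + e.cost + 3,
    fun n G s t C N w hN hnN hw => ?_⟩
  have hle : ∀ k ≤ K₁ + K₂ + K₃ + e.cost + 3, N ^ k ≤ 2 ^ w := fun k hk =>
    (Nat.pow_le_pow_right (by omega) hk).trans hw
  have h1N : 1 < N ^ 5 := Nat.one_lt_pow (by norm_num) (by omega)
  obtain ⟨τ, hτ, hτ0, hτ1, hτr, hτt⟩ := hp N (inputState G s t C) w n hN (hle _ (by omega)) hnN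
    rfl (fun r => by
      have := s.2
      have := t.2
      simp only [inputState]
      split_ifs <;> omega)
    (fun a => by simp only [inputState]; split_ifs <;> omega)
  have heval := (he N τ hN ⟨hτr, fun a => (hτt.le_one a).trans_lt h1N⟩).2 w (hle _ (by omega))
  simp only [hτ0] at heval
  have hτ1' : τ.reg 1 = s := by rw [hτ1]; simp [inputState]
  have hlim : n * n + n + n * n * n < N ^ 5 := by
    have h₁ : n * n ≤ N * N := Nat.mul_le_mul hnN.le hnN.le
    have h₂ : n * n * n ≤ N * N * N := Nat.mul_le_mul h₁ hnN.le
    have h₃ : N * N ≤ N * N * N := Nat.le_mul_of_pos_right _ (by omega)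
    have h₄ : N ≤ N * N := Nat.le_mul_of_pos_right _ (by omega)
    have h₅ : N * N * N * (2 * 2) ≤ N * N * N * (N * N) :=
      Nat.mul_le_mul_left _ (Nat.mul_le_mul hN hN)
    have h₆ : N ^ 5 = N * N * N * (N * N) := by ring
    omega
  have hN5 : N ≤ N ^ 5 := Nat.le_self_pow (by norm_num) N
  obtain ⟨⟨ρ, hρ, hρo⟩, hword⟩ := hq N (tableInst n s τ.mem)
    (τ.set 2 (n * n + n + n * n * n)) w
    ⟨hN, hnN.trans_le hN5, (s.2.trans hnN).trans_le hN5, hlim, fun a => by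
      simp only [Ctx.inst, tableInst]
      have := hτt.le_one a
      split <;> omega, fun i hi => by simp only [Ctx.arity] at hi; omega⟩
    ⟨by rw [State.set_reg_of_ne _ _ (by norm_num)]; exact hτ0,
      by rw [State.set_reg_of_ne _ _ (by norm_num)]; exact hτ1', State.set_reg_self _ _ _,
      fun a ha => (if_pos ha).symm, fun a ha => if_neg (by exact Nat.not_lt.2 ha),
      fun i hi => by simp only [Ctx.arity] at hi; omega⟩ (hle _ (by omega))
  refine ⟨tableInst n s τ.mem, ρ, models_tableInst hτt,
    (hτ.seq ((Run.assign heval).seq hρ)).mono ?_, hρo,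
    fun i hi => (hword i hi).trans_le (Nat.pow_le_pow_right (by omega) (by omega))⟩
  have g₁ : N ^ K₁ ≤ N ^ (K₁ + K₂ + K₃ + e.cost) := Nat.pow_le_pow_right (by omega) (by omega)
  have g₂ : N ^ K₂ ≤ N ^ (K₁ + K₂ + K₃ + e.cost) := Nat.pow_le_pow_right (by omega) (by omega)
  have g₃ : N ^ e.cost ≤ N ^ (K₁ + K₂ + K₃ + e.cost) := Nat.pow_le_pow_right (by omega) (by omega)
  have g₄ : e.cost < N ^ e.cost := lit_lt_pow hN
  have g₅ : 8 ≤ N ^ 3 := Nat.pow_le_pow_left hN 3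
  have g₆ : N ^ (K₁ + K₂ + K₃ + e.cost) * 8 ≤ N ^ (K₁ + K₂ + K₃ + e.cost + 3) := by
    rw [pow_add _ _ 3]; exact Nat.mul_le_mul_left _ g₅
  omega

/-- The query is a single assignment of one fixed expression, so its time is constant and memory is
untouched. -/
theorem exists_query : ∃ query : Cmd, ∃ c, ∀ A, ∃ K, ∀ N (D : List ℕ) x y z w, 2 ≤ N →
    x < N ^ A → y < N ^ A → z < N ^ A → (∀ a ∈ D, a < N ^ A) → N ^ K ≤ 2 ^ w →
    ∃ τ, Run w query (queryState D x y z) c τ ∧ τ.mem = (queryState D x y z).mem ∧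
      τ.reg 0 = queryAnswer (fun a => D.getD a 0) x y z := by
  have h : StraightLine fun σ => queryAnswer σ.mem (σ.reg 0) (σ.reg 1) (σ.reg 2) := inferInstance
  obtain ⟨e, he⟩ := h.out
  refine ⟨.assign 0 e, e.cost + 1, fun A => ?_⟩
  obtain ⟨K, hK⟩ := he A
  refine ⟨K, fun N D x y z w hN hx hy hz hD hw => ⟨_, Run.assign ((hK N _ hN ?_).2 w hw), rfl, ?_⟩⟩
  · have h0 : 0 < N ^ A := by positivity
    refine ⟨fun r => ?_, fun a => ?_⟩
    · simp only [queryState]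
      split_ifs <;> assumption
    · simp only [queryState]
      by_cases ha : a < D.length
      · rw [List.getD_eq_getElem _ _ ha]
        exact hD _ (List.getElem_mem ha)
      · rw [List.getD_eq_default _ _ (by omega)]
        exact h0
  · rw [State.set_reg_self]
    simp [queryState]

theorem hasOracle_getD (I : Inst) :
    HasOracle I fun a => ((List.range (108 * I.k)).map I.word).getD a 0 := by
  intro q hq r hr
  have hlt : 18 * r + q < 108 * I.k := by omega
  rw [entry, List.getD_eq_getElem _ _ (by simpa using hlt)]
  simp only [List.getElem_map, List.getElem_range, Inst.word]
  congr 1 <;> omega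

end WordRAM

/-! ### Choice of the constants -/

open WordRAM in
theorem mainTheorem10 :
    -- one preprocessing program, one query program, and absolute constants
    ∃ (build query : Cmd) (cWord cTime cSize cQuery : ℕ), 1 ≤ cWord ∧
      ∀ (n : ℕ) (G : Digraph (Fin n)) (s t : Fin n), HasPath G s t →
      ∀ C : Finset (Fin n), (∀ v ∈ C, IsCutVertex G s t v) →
      -- the preprocessing halts in polynomial time
      ∃ (T : ℕ) (τ : State),
        Exec (wordSize cWord n) build (inputState G s t C) T τ ∧
        T ≤ cTime * n ^ cTime ∧
        -- its output, the oracle, consists of `O(|C|)` words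
        τ.output.length ≤ cSize * C.card ∧
        (∀ a ∈ τ.output, a < 2 ^ wordSize cWord n) ∧
        -- each query is answered in `O(1)` time, and leaves the oracle intact
        ∀ x ∈ C, ∀ y ∈ C, ∀ z ∈ C,
          ∃ (T' : ℕ) (τ' : State),
            Exec (wordSize cWord n) query (queryState τ.output x y z) T' τ' ∧
            T' ≤ cQuery ∧
            τ'.mem = (queryState τ.output x y z).mem ∧
            (HasPathAvoiding G x y z → τ'.reg 0 = 1) ∧
            (¬ HasPathAvoiding G x y z → τ'.reg 0 = 0) := by
  obtain ⟨build, K, hbuild⟩ := exists_build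
  obtain ⟨query, c, hquery⟩ := exists_query
  -- The exponent K + 1 bounds the oracle words, which are below `N ^ K`, and also the vertex names
  -- below N, even if K = 0.
  obtain ⟨L, hquery⟩ := hquery (K + 1)
  -- The time constant is both coefficient and exponent: the time is at most `(2 * n) ^ K`, and `2 ^
  -- K` exceeds K.
  refine ⟨build, query, K + L + 1, 2 ^ K, 108, c, by omega, fun n G s t hst C hC => ?_⟩
  have hn : 0 < n := s.pos
  -- This N satisfies `n < N ≤ 2 * n` and is at least 2 even for n = 1. Its powers are exactly the
  -- powers `2 ^ wordSize c n`.
  set N := 2 ^ (Nat.log 2 n + 1) with hNdef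
  have hN : 2 ≤ N := by
    rw [hNdef, pow_succ]
    have := Nat.one_le_two_pow (n := Nat.log 2 n)
    omega
  have hnN : n < N := Nat.lt_pow_succ_log_self (by norm_num) n
  have hN2n : N ≤ 2 * n := by
    rw [hNdef, pow_succ, mul_comm]
    exact Nat.mul_le_mul_left 2 (Nat.pow_log_le_self 2 hn.ne')
  have hw : 2 ^ wordSize (K + L + 1) n = N ^ (K + L + 1) := by
    rw [wordSize, hNdef, ← pow_mul, mul_comm]
  have hle : ∀ k ≤ K + L + 1, N ^ k ≤ 2 ^ wordSize (K + L + 1) n := fun k hk => by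
    rw [hw]; exact Nat.pow_le_pow_right (by omega) hk
  obtain ⟨I, τ, hM, ⟨T, hT, hE⟩, ho, hword⟩ :=
    hbuild n G s t C N (wordSize (K + L + 1) n) hN hnN (hle K (by omega))
  have hout : ∀ a ∈ τ.output, a < N ^ K := by
    intro a ha
    rw [ho] at ha
    obtain ⟨i, hi, rfl⟩ := List.mem_map.1 ha
    exact hword i (List.mem_range.1 hi)
  refine ⟨T, τ, hE, ?_, ?_, fun a ha => (hout a ha).trans_le (hle K (by omega)), ?_⟩
  · calc T ≤ N ^ K := hT
      _ ≤ (2 * n) ^ K := Nat.pow_le_pow_left hN2n K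
      _ = 2 ^ K * n ^ K := Nat.mul_pow _ _ _
      _ ≤ 2 ^ K * n ^ 2 ^ K :=
        Nat.mul_le_mul_left _ (Nat.pow_le_pow_right hn Nat.lt_two_pow_self.le)
  · rw [ho, List.length_map, List.length_range, hM.k_eq]
  · intro x hx y hy z hz
    classical
    have hlt : ∀ v : Fin n, (v : ℕ) < N ^ (K + 1) := fun v =>
      (v.2.trans hnN).trans_le (Nat.le_self_pow (by omega) N)
    obtain ⟨τ', ⟨T', hT', hE'⟩, hmem, hreg⟩ := hquery N τ.output x y z (wordSize (K + L + 1) n) hN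
      (hlt x) (hlt y) (hlt z)
      (fun a ha => (hout a ha).trans_le (Nat.pow_le_pow_right (by omega) (by omega)))
      (hle L (by omega))
    refine ⟨T', τ', hE', hT', hmem, ?_⟩
    rw [hreg, ho, hM.queryAnswer_eq hst hC (hasOracle_getD I) hx hy hz]
    exact ⟨fun h => if_pos h, fun h => if_neg h⟩
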